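/- Let $G$ be a connected, simply connected nilpotent (real) Lie group with Lie algebra $\mathfrak g$. An integrable left-invariant horizontal CR structure of type $(n,k)$ on $G$ consists of a subspace $\mathfrak h\subseteq\mathfrak g$ of dimension $2n$ that generates $\mathfrak g$ as a Lie algebra, an ideal $\mathfrak n$ of $\mathfrak g$ of dimension $k$ with $\mathfrak g=\mathfrak h\oplus\mathfrak n$ as vector spaces, and a linear map $J:\mathfrak h\to\mathfrak h$ with $J^2=-1$ such that $\mathfrak h^{01}=\{X+iJX: X\in\mathfrak h\}$ is closed under the bracket of $\mathfrak g_{\mathbb C}=\mathbb C\otimes\mathfrak g$. The $(0,1)$ vectors at $g\in G$ are the values at $g$ of $X+iJX$, $X\in\mathfrak h$, where $X$ and $JX$ are extended to left-invariant vector fields. A CR embedding of $G$ into a complex vector space is a smooth embedding whose complexified differential maps $(0,1)$ vectors to $(0,1)$ vectors. Fix such a structure. Then there is a basis of $\mathfrak g$ that consists of a basis $X_1,\dots,X_n,JX_1,\dots,JX_n$ of $\mathfrak h$ and a basis $T_1,\dots,T_k$ of $\mathfrak n$. For every such basis, the map $({\bf x},{\bf y},{\bf t})\mapsto\exp\big(\sum_j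 x_jX_j+\sum_j y_jJX_j+\sum_l t_lT_l\big)$ is a bijection from $\mathbb R^n\times\mathbb R^n\times\mathbb R^k$ onto $G$, and there is a CR embedding $\iota:G\to\mathbb C^{n+k}$ which, in these coordinates on $G$, has the form $$({\bf x}+i{\bf y},{\bf t})\mapsto({\bf x}+i{\bf y}+{\bf p}({\bf x},{\bf y}),\ {\bf t}+{\bf q}({\bf x},{\bf y},{\bf t})),$$ where ${\bf p}$ is a vector of $n$ and ${\bf q}$ a vector of $k$ (possibly complex-valued) polynomials. Moreover, let $G_{\mathbb C}$ be the connected, simply connected complex Lie group with Lie algebra $\mathfrak g_{\mathbb C}$, with the homomorphism $G\to G_{\mathbb C}$ induced by $\mathfrak g\subset\mathfrak g_{\mathbb C}$, and put $\mathfrak h^{10}=\{X-iJX:X\in\mathfrak h\}$, $\mathfrak n_{\mathbb C}=\mathbb C\otimes\mathfrak n$, $H^{01}=\exp(\mathfrak h^{01})$ and $M=\exp(\mathfrak h^{10}\oplus\mathfrak n_{\mathbb C})$. Then $H^{01}$ is a subgroup of $G_{\mathbb C}$, and $\iota$ is the restriction to $G$ of the map $\Phi: G_{\mathbb C}\to G_{\mathbb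 C}/H^{01}\cong M\cong\mathbb C^{n+k}$. Here $M\cong\mathbb C^{n+k}$ is given by the coordinates $\exp\big(\sum_j z_j\tfrac12(X_j-iJX_j)+\sum_l w_lT_l\big)\mapsto(z,w)$, and $G_{\mathbb C}/H^{01}\cong M$ is the inverse of the restriction to $M$ of the projection $G_{\mathbb C}\to G_{\mathbb C}/H^{01}$; that is, $\Phi$ is holomorphic, its fibres are exactly the left cosets of $H^{01}$, and it is left inverse to the holomorphic parametrization $(z,w)\mapsto\exp\big(\sum_j z_j\tfrac12(X_j-iJX_j)+\sum_l w_lT_l\big)$ of $M$. -/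

import Mathlib

open scoped Manifold ContDiff TensorProduct

noncomputable section

/-! ### Horizontal CR structures on a real Lie algebra -/

/-- The element `X + i J X` of the complexification `ℂ ⊗ 𝔤`, for `X` in a subspace `𝔥` of `𝔤`
with an endomorphism `J` of `𝔥`. -/
def vec01 {𝔤 : Type*} [AddCommGroup 𝔤] [Module ℝ 𝔤] {𝔥 : Submodule ℝ 𝔤}
    (J : 𝔥 →ₗ[ℝ] 𝔥) (X : 𝔥) : ℂ ⊗[ℝ] 𝔤 :=
  (1 : ℂ) ⊗ₜ[ℝ] (X : 𝔤) + Complex.I ⊗ₜ[ℝ] ((J X : 𝔥) : 𝔤)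

/-- The element `X - i J X` of the complexification `ℂ ⊗ 𝔤`. -/
def vec10 {𝔤 : Type*} [AddCommGroup 𝔤] [Module ℝ 𝔤] {𝔥 : Submodule ℝ 𝔤}
    (J : 𝔥 →ₗ[ℝ] 𝔥) (X : 𝔥) : ℂ ⊗[ℝ] 𝔤 :=
  (1 : ℂ) ⊗ₜ[ℝ] (X : 𝔤) - Complex.I ⊗ₜ[ℝ] ((J X : 𝔥) : 𝔤)

/-- An integrable horizontal CR structure of type `(n, k)` on a real Lie algebra `𝔤`: a subspace
`𝔥` of dimension `2n` that generates `𝔤` as a Lie algebra, an ideal `𝔫` of dimension `k` with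
`𝔤 = 𝔥 ⊕ 𝔫`, and a complex structure `J` on `𝔥` such that `{X + i J X : X ∈ 𝔥}` is closed under
the bracket of `ℂ ⊗ 𝔤`. -/
structure HorizontalCR (𝔤 : Type*) [LieRing 𝔤] [LieAlgebra ℝ 𝔤] (n k : ℕ) where
  𝔥 : Submodule ℝ 𝔤
  𝔫 : LieIdeal ℝ 𝔤
  J : 𝔥 →ₗ[ℝ] 𝔥
  generates : LieSubalgebra.lieSpan ℝ 𝔤 (𝔥 : Set 𝔤) = ⊤
  isCompl : IsCompl 𝔥 𝔫.toSubmodule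
  J_sq : ∀ X : 𝔥, J (J X) = -X
  integrable : ∀ X Y : 𝔥, ∃ Z : 𝔥, ⁅vec01 J X, vec01 J Y⁆ = vec01 J Z
  finrank_𝔥 : Module.finrank ℝ 𝔥 = 2 * n
  finrank_𝔫 : Module.finrank ℝ 𝔫 = k

namespace HorizontalCR

variable {𝔤 : Type*} [LieRing 𝔤] [LieAlgebra ℝ 𝔤] {n k : ℕ}

/-- The set `𝔥⁰¹ = {X + i J X : X ∈ 𝔥}`. -/
def h01 (S : HorizontalCR 𝔤 n k) : Set (ℂ ⊗[ℝ] 𝔤) := Set.range (vec01 S.J)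

/-- The set `𝔥¹⁰ = {X - i J X : X ∈ 𝔥}`. -/
def h10 (S : HorizontalCR 𝔤 n k) : Set (ℂ ⊗[ℝ] 𝔤) := Set.range (vec10 S.J)

/-- The space `𝔪 = 𝔥¹⁰ ⊕ 𝔫_ℂ`. -/
def m (S : HorizontalCR 𝔤 n k) : Set (ℂ ⊗[ℝ] 𝔤) :=
  {z | ∃ a ∈ S.h10, ∃ b ∈ S.𝔫.toSubmodule.baseChange ℂ, z = a + b}

/-- A basis of `𝔤` adapted to a horizontal CR structure: a real basis of `𝔥` of the form
`X₁, …, Xₙ, J X₁, …, J Xₙ` and a real basis `T₁, …, Tₖ` of `𝔫`. -/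
structure AdaptedBasis (S : HorizontalCR 𝔤 n k) where
  basis𝔥 : Module.Basis (Fin n ⊕ Fin n) ℝ S.𝔥
  basis𝔥_inr : ∀ j : Fin n, basis𝔥 (Sum.inr j) = S.J (basis𝔥 (Sum.inl j))
  basis𝔫 : Module.Basis (Fin k) ℝ S.𝔫

variable {S : HorizontalCR 𝔤 n k}

/-- The vector `∑ xⱼ Xⱼ + ∑ yⱼ J Xⱼ + ∑ tₗ Tₗ` of `𝔤`. -/
def AdaptedBasis.realVec (b : S.AdaptedBasis)
    (v : (Fin n → ℝ) × (Fin n → ℝ) × (Fin k → ℝ)) : 𝔤 :=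
  ∑ j, v.1 j • (b.basis𝔥 (Sum.inl j) : 𝔤) + ∑ j, v.2.1 j • (b.basis𝔥 (Sum.inr j) : 𝔤)
    + ∑ l, v.2.2 l • (b.basis𝔫 l : 𝔤)

/-- The vector `∑ zⱼ ½(Xⱼ - i J Xⱼ) + ∑ wₗ Tₗ` of `𝔪 = 𝔥¹⁰ ⊕ 𝔫_ℂ`. -/
def AdaptedBasis.complexVec (b : S.AdaptedBasis)
    (v : (Fin n → ℂ) × (Fin k → ℂ)) : ℂ ⊗[ℝ] 𝔤 :=
  ∑ j, (v.1 j / 2) • vec10 S.J (b.basis𝔥 (Sum.inl j))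
    + ∑ l, v.2 l • ((1 : ℂ) ⊗ₜ[ℝ] (b.basis𝔫 l : 𝔤))

end HorizontalCR

/-! ### Lie groups: exponential map and complexification -/

section LieGroups

variable {E : Type*} [NormedAddCommGroup E] [NormedSpace ℝ E]
  {G : Type*} [TopologicalSpace G] [ChartedSpace E G] [Group G]

/-- A smooth real Lie group has the regularity that Mathlib asks for to define its Lie algebra. -/
instance instLieGroupMinSmoothness [LieGroup 𝓘(ℝ, E) ∞ G] :
    LieGroup 𝓘(ℝ, E) (minSmoothness ℝ 3) G := by
  rw [minSmoothness_of_isRCLikeNormedField]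
  infer_instance

open scoped Classical in
/-- The exponential map of a Lie group: `exp X` is the value at time `1` of the integral curve,
starting at `1`, of the left-invariant vector field that equals `X` at `1` (for a smooth Hausdorff
Lie group such a curve exists and is unique). -/
def lieExp (X : GroupLieAlgebra 𝓘(ℝ, E) G) : G :=
  if h : ∃ γ : ℝ → G, γ 0 = 1 ∧ IsMIntegralCurve (I := 𝓘(ℝ, E)) γ (mulInvariantVectorField X)
  then h.choose 1 else 1

/-- The differential at the identity of a map from `G` to a complex Lie group `K`, as a real linear
map from the Lie algebra of `G` to that of `K`, which is `ℂᵈ` as a vector space. -/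
def derivOne {d : ℕ} {K : Type*} [TopologicalSpace K] [ChartedSpace (Fin d → ℂ) K]
    (f : G → K) : GroupLieAlgebra 𝓘(ℝ, E) G →ₗ[ℝ] (Fin d → ℂ) :=
  (mfderiv 𝓘(ℝ, E) 𝓘(ℝ, Fin d → ℂ) f 1 : E →L[ℝ] (Fin d → ℂ)).toLinearMap

/-- The complex linear extension of `derivOne` to `ℂ ⊗ 𝔤`. -/
def complexDerivOne {d : ℕ} {K : Type*} [TopologicalSpace K] [ChartedSpace (Fin d → ℂ) K]
    (f : G → K) : ℂ ⊗[ℝ] GroupLieAlgebra 𝓘(ℝ, E) G →ₗ[ℂ] (Fin d → ℂ) :=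
  LinearMap.liftBaseChange ℂ (derivOne (E := E) f)

end LieGroups

/-- A complexification of a simply connected real Lie group `G`: a connected, simply connected
complex Lie group with a smooth homomorphism from `G`, whose differential at the identity extends
to a complex linear isomorphism from `ℂ ⊗ 𝔤` onto the Lie algebra of the complex group. -/
structure Complexification {E : Type*} [NormedAddCommGroup E] [NormedSpace ℝ E]
    (G : Type*) [TopologicalSpace G] [ChartedSpace E G] [Group G] where
  dim : ℕ
  carrier : Type
  [top : TopologicalSpace carrier]
  [grp : Group carrier]
  [charted : ChartedSpace (Fin dim → ℂ) carrier]
  [lie : LieGroup 𝓘(ℂ, Fin dim → ℂ) ω carrier]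
  [t2 : T2Space carrier]
  [simplyConnected : SimplyConnectedSpace carrier]
  incl : G →* carrier
  incl_smooth : ContMDiff 𝓘(ℝ, E) 𝓘(ℝ, Fin dim → ℂ) ∞ incl
  bijective : Function.Bijective (complexDerivOne (E := E) (d := dim) incl)

namespace Complexification

attribute [instance] top grp charted lie t2 simplyConnected

variable {E : Type*} [NormedAddCommGroup E] [NormedSpace ℝ E]
  {G : Type*} [TopologicalSpace G] [ChartedSpace E G] [Group G]

/-- The exponential map of the complex group, read on `ℂ ⊗ 𝔤` through the identification of the
latter with the Lie algebra of the complex group. -/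
def exp (C : Complexification (E := E) G) (z : ℂ ⊗[ℝ] GroupLieAlgebra 𝓘(ℝ, E) G) : C.carrier :=
  lieExp (E := Fin C.dim → ℂ) (complexDerivOne (E := E) (d := C.dim) C.incl z)

end Complexification

/-! ### CR embeddings -/

section CREmbedding

variable {E : Type*} [NormedAddCommGroup E] [NormedSpace ℝ E]
  {G : Type*} [TopologicalSpace G] [ChartedSpace E G] [Group G] [LieGroup 𝓘(ℝ, E) ∞ G]
  [CompleteSpace E] {n k : ℕ}

/-- The `(0,1)` vectors at `g` of the left-invariant CR structure on `G` that `S` defines: the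
complex tangent vectors that are the values at `g` of `X + i J X`, where `X` and `J X` are extended
to left-invariant vector fields. -/
def HorizontalCR.tangent01 (S : HorizontalCR (GroupLieAlgebra 𝓘(ℝ, E) G) n k) (g : G) :
    Set (ℂ ⊗[ℝ] TangentSpace 𝓘(ℝ, E) g) :=
  {u | ∃ X : S.𝔥, u =
    (1 : ℂ) ⊗ₜ[ℝ] mulInvariantVectorField (X : GroupLieAlgebra 𝓘(ℝ, E) G) g
      + Complex.I ⊗ₜ[ℝ] mulInvariantVectorField ((S.J X : S.𝔥) : GroupLieAlgebra 𝓘(ℝ, E) G) g}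

/-- The `(0,1)` vectors of a complex vector space `W`: the elements `v + i (i v)` of `ℂ ⊗ W`,
where the inner `i` is the complex structure of `W`. -/
def complexTangent01 (W : Type*) [AddCommGroup W] [Module ℝ W] [Module ℂ W] : Set (ℂ ⊗[ℝ] W) :=
  {u | ∃ v : W, u = (1 : ℂ) ⊗ₜ[ℝ] v + Complex.I ⊗ₜ[ℝ] (Complex.I • v)}

/-- `ι` is a CR embedding of `G`, with the left-invariant CR structure that `S` defines, into the
complex space `W`: it is a smooth embedding whose complexified differential maps `(0,1)` vectors
to `(0,1)` vectors. -/
def IsCREmbedding {W : Type*} [NormedAddCommGroup W] [NormedSpace ℝ W] [NormedSpace ℂ W]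
    [IsScalarTower ℝ ℂ W]
    (S : HorizontalCR (GroupLieAlgebra 𝓘(ℝ, E) G) n k) (ι : G → W) : Prop :=
  Manifold.IsSmoothEmbedding 𝓘(ℝ, E) 𝓘(ℝ, W) ∞ ι ∧
  ∀ g : G, Set.MapsTo
    (LinearMap.baseChange ℂ
      (mfderiv 𝓘(ℝ, E) 𝓘(ℝ, W) ι g : TangentSpace 𝓘(ℝ, E) g →L[ℝ] W).toLinearMap)
    (S.tangent01 g) (complexTangent01 W)

end CREmbedding

end

noncomputable section

/-! ### Nilpotent brackets and the Baker-Campbell-Hausdorff product -/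

/-! The complexified algebra splits as 𝔥⁰¹ ⊕ 𝔪 with 𝔪 = 𝔥¹⁰ ⊕ 𝔫_ℂ, and both summands are
subalgebras: 𝔥⁰¹ by integrability, 𝔥¹⁰ as its complex conjugate, and 𝔫_ℂ is an ideal. In a nilpotent
group, two subalgebras that span factor the group with polynomial factors
(`NilBracket.exists_factorization`), and the factors are unique if the subalgebras are complementary
(`NilBracket.eq_iff_bch_neg_mem`). So every g in G_ℂ is uniquely m · h with m in exp 𝔪 and h in exp
𝔥⁰¹, and Φ reads off the linear coordinates of log m. It is polynomial, hence holomorphic, and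
separates exactly the left cosets of exp 𝔥⁰¹.

Since Φ is invariant under right multiplication by exp 𝔥⁰¹, its complex differential kills the
left-invariant fields of X + iJX; on real fields this says dΦ(JX) = i dΦ(X), which is the CR
condition (`IsBracketOf.isCREmbedding`). Moving g by the ideal 𝔫 moves m by 𝔫_ℂ only, so the first n
coordinates do not see t (`NilBracket.factor_sub_factor_mem`). That ι is an embedding follows from a
smooth left inverse: G_ℂ is also the product of G and exp(𝔥⁰¹ ⊕ 𝔫_ℂ), and these two meet only inside
exp 𝔫_ℂ, where the projection to exp 𝔪 is the identity
(`NilBracket.exists_contDiff_leftInverse_factor`).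

All this takes place in exponential coordinates, with the Baker-Campbell-Hausdorff product as a
polynomial map. The product is defined as the time-one solution of γ' = mcInv(γ) Y, γ(0) = X, the
equation of an integral curve of a left-invariant field in such coordinates. Nilpotency makes the
solution polynomial, and associativity comes from the Maurer-Cartan equation
(`NilBracket.maurerCartan`, `NilBracket.mc_fderiv_bch`).

An abstract simply connected G is identified with this model in two stages. Locally, a frame with
the right structure constants integrates to a chart by a Gronwall estimate
(`NilBracket.exists_local_primitive`). Globally, local multiplicativity and compatibility with
powers give a homomorphism (`NilGroup.map_mul_of_pow`), which is a covering and hence bijective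
(`MonoidHom.injective_of_isDiscrete_ker`). The complexification is the same model on ℂ ⊗ 𝔤. -/

theorem Finset.sum_range_sum_range_eq_sum_antidiagonal {A : Type*} [AddCommMonoid A]
    (f : ℕ → ℕ → A) (M : ℕ) (h : ∀ i j, M ≤ i + j → f i j = 0) :
    ∑ i ∈ Finset.range M, ∑ j ∈ Finset.range M, f i j =
      ∑ k ∈ Finset.range M, ∑ p ∈ Finset.HasAntidiagonal.antidiagonal k, f p.1 p.2 := by
  rw [← Finset.sum_product', Finset.sum_sigma']
  symm
  apply Finset.sum_bij_ne_zero (fun a _ _ => a.2)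
  · rintro ⟨k, p⟩ h1 _
    simp only [Finset.mem_sigma, Finset.mem_range, Finset.HasAntidiagonal.mem_antidiagonal, Finset.mem_product]
      at h1 ⊢
    omega
  · rintro ⟨k, p⟩ h1 _ ⟨k', p'⟩ h1' _ h
    simp only [Finset.mem_sigma, Finset.mem_range, Finset.HasAntidiagonal.mem_antidiagonal] at h1 h1'
    simp only at h
    subst h
    obtain rfl : k = k' := by omega
    rfl
  · rintro ⟨i, j⟩ h1 h2
    refine ⟨⟨i + j, (i, j)⟩, ?_, h2, rfl⟩
    simp only [Finset.mem_sigma, Finset.mem_range, Finset.HasAntidiagonal.mem_antidiagonal, and_true]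
    by_contra h3
    exact h2 (h i j (by omega))
  · rintro ⟨k, p⟩ h1 _
    rfl

/-- The coefficients of `(1 - exp (-x)) / x`. -/
def expQuotCoeff (k : ℕ) : ℚ := (-1) ^ k / (k + 1).factorial

/-- The coefficients of `x / (1 - exp (-x))`. -/
def expQuotInvCoeff (k : ℕ) : ℚ := PowerSeries.coeff k (PowerSeries.mk expQuotCoeff)⁻¹

theorem sum_expQuotCoeff_mul_inv (n : ℕ) :
    ∑ p ∈ Finset.HasAntidiagonal.antidiagonal n, expQuotCoeff p.1 * expQuotInvCoeff p.2 =
      if n = 0 then 1 else 0 := by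
  have h : PowerSeries.mk expQuotCoeff * (PowerSeries.mk expQuotCoeff)⁻¹ = 1 := by
    apply PowerSeries.mul_inv_cancel
    simp [← PowerSeries.coeff_zero_eq_constantCoeff_apply, expQuotCoeff]
  have := congrArg (PowerSeries.coeff n) h
  rw [PowerSeries.coeff_mul, PowerSeries.coeff_one] at this
  simpa [expQuotInvCoeff] using this

section NilBracket

variable {𝕜 : Type*} [RCLike 𝕜] {L : Type*} [NormedAddCommGroup L] [NormedSpace 𝕜 L]

/-- The lower central series of a bilinear bracket. -/
def bracketLCS (br : L →L[𝕜] L →L[𝕜] L) : ℕ → Submodule 𝕜 L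
  | 0 => ⊤
  | k + 1 => Submodule.span 𝕜 {z | ∃ x, ∃ y ∈ bracketLCS br k, br x y = z}

variable (𝕜 L) in
/-- A continuous nilpotent Lie bracket on a normed space. -/
structure NilBracket where
  br : L →L[𝕜] L →L[𝕜] L
  self : ∀ x, br x x = 0
  jacobi : ∀ x y z, br x (br y z) = br (br x y) z + br y (br x z)
  cls : ℕ
  nil : bracketLCS br cls = ⊥

namespace NilBracket

variable (β : NilBracket 𝕜 L)

theorem skew (x y : L) : β.br x y = - β.br y x := by
  have h := β.self (x + y)
  simp only [map_add, add_apply, β.self, zero_add, add_zero] at h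
  exact eq_neg_of_add_eq_zero_right h

theorem br_mem_lcs (x : L) {y : L} {k : ℕ} (hy : y ∈ bracketLCS β.br k) :
    β.br x y ∈ bracketLCS β.br (k + 1) :=
  Submodule.subset_span ⟨x, y, hy, rfl⟩

theorem lcs_succ_le (k : ℕ) : bracketLCS β.br (k + 1) ≤ bracketLCS β.br k := by
  induction k with
  | zero => exact le_top
  | succ k ih =>
    apply Submodule.span_mono
    rintro z ⟨x, y, hy, rfl⟩
    exact ⟨x, y, ih hy, rfl⟩

theorem lcs_antitone : Antitone (bracketLCS β.br) := antitone_nat_of_succ_le β.lcs_succ_le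

theorem lcs_eq_bot {k : ℕ} (hk : β.cls ≤ k) : bracketLCS β.br k = ⊥ :=
  le_bot_iff.1 ((β.lcs_antitone hk).trans β.nil.le)

/-- Induction on the left level: Jacobi writes [[u,v],y] as [u,[v,y]] − [v,[u,y]]. The second term
raises the level on the right, so j has to stay general. -/
theorem br_mem_lcs_add {i : ℕ} : ∀ {j : ℕ} {x y : L}, x ∈ bracketLCS β.br i →
    y ∈ bracketLCS β.br j → β.br x y ∈ bracketLCS β.br (i + j + 1) := by
  induction i with
  | zero => intro j x y _ hy; rw [zero_add]; exact β.br_mem_lcs x hy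
  | succ i ih =>
    intro j x y hx hy
    induction hx using Submodule.span_induction with
    | mem z hz =>
      obtain ⟨u, v, hv, rfl⟩ := hz
      have h := β.jacobi u v y
      rw [← sub_eq_iff_eq_add] at h
      rw [← h]
      refine Submodule.sub_mem _ ?_ ?_
      · have := β.br_mem_lcs u (ih hv hy)
        rwa [show i + 1 + j + 1 = i + j + 1 + 1 by ring]
      · have := ih hv (β.br_mem_lcs u hy)
        rwa [show i + 1 + j + 1 = i + (j + 1) + 1 by ring]
    | zero => simp
    | add a b _ _ ha hb => rw [map_add, add_apply]; exact add_mem ha hb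
    | smul c a _ ha =>
      rw [map_smul, smul_apply]; exact Submodule.smul_mem _ _ ha

theorem ad_pow_mem (Z V : L) (k : ℕ) : (β.br Z ^ k) V ∈ bracketLCS β.br k := by
  induction k with
  | zero => trivial
  | succ k ih =>
    rw [pow_succ', mul_apply_eq_comp]
    exact β.br_mem_lcs Z ih

theorem ad_pow_eq_zero (Z : L) {k : ℕ} (hk : β.cls ≤ k) : β.br Z ^ k = 0 := by
  ext V
  have := β.ad_pow_mem Z V k
  rw [β.lcs_eq_bot hk] at this
  simpa using this

/-- The left Maurer-Cartan form `(1 - exp (-ad Z)) / ad Z`. -/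
def mc (Z : L) : L →L[𝕜] L :=
  ∑ k ∈ Finset.range (β.cls + 1), (expQuotCoeff k : 𝕜) • β.br Z ^ k

/-- The inverse of the left Maurer-Cartan form. -/
def mcInv (Z : L) : L →L[𝕜] L :=
  ∑ k ∈ Finset.range (β.cls + 1), (expQuotInvCoeff k : 𝕜) • β.br Z ^ k

/-- Both operators are polynomials in ad Z whose coefficients come from reciprocal power series;
truncation costs nothing because high powers of ad Z vanish. -/
theorem mc_mcInv (Z V : L) : β.mc Z (β.mcInv Z V) = V := by
  have h : β.mc Z * β.mcInv Z = 1 := by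
    rw [mc, mcInv, Finset.sum_mul_sum, Finset.sum_range_sum_range_eq_sum_antidiagonal]
    · have : ∀ k, ∑ p ∈ Finset.HasAntidiagonal.antidiagonal k, ((expQuotCoeff p.1 : 𝕜) • β.br Z ^ p.1) *
          ((expQuotInvCoeff p.2 : 𝕜) • β.br Z ^ p.2) = if k = 0 then 1 else 0 := by
        intro k
        have h1 : ∀ p ∈ Finset.HasAntidiagonal.antidiagonal k, ((expQuotCoeff p.1 : 𝕜) • β.br Z ^ p.1) *
          ((expQuotInvCoeff p.2 : 𝕜) • β.br Z ^ p.2) =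
            ((expQuotCoeff p.1 * expQuotInvCoeff p.2 : ℚ) : 𝕜) • β.br Z ^ k := by
          intro p hp
          rw [smul_mul_smul_comm, ← pow_add, Finset.HasAntidiagonal.mem_antidiagonal.1 hp]
          push_cast
          rfl
        rw [Finset.sum_congr rfl h1, ← Finset.sum_smul, ← Rat.cast_sum,
          sum_expQuotCoeff_mul_inv]
        split_ifs with h
        · simp [h]
        · simp
      rw [Finset.sum_congr rfl fun k _ => this k]
      simp
    · intro i j hij
      rw [smul_mul_smul_comm, ← pow_add, β.ad_pow_eq_zero Z (by omega), smul_zero]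
  have := congrArg (fun A : L →L[𝕜] L => A V) h
  simpa using this

theorem mcInv_mc (Z V : L) : β.mcInv Z (β.mc Z V) = V := by
  have hc : β.mcInv Z * β.mc Z = β.mc Z * β.mcInv Z := by
    rw [mc, mcInv]
    refine Commute.sum_left _ _ _ fun i _ => Commute.sum_right _ _ _ fun j _ => ?_
    exact ((Commute.refl (β.br Z)).pow_pow i j).smul_left _ |>.smul_right _
  have h := congrArg (fun A : L →L[𝕜] L => A V) hc
  simp only [mul_apply_eq_comp, mc_mcInv] at h
  exact h

theorem mc_self (Z : L) (c : 𝕜) : β.mc (c • Z) Z = Z := by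
  rw [mc, sum_apply, Finset.sum_eq_single 0]
  · simp [expQuotCoeff]
  · intro k _ hk
    obtain ⟨k, rfl⟩ := Nat.exists_eq_succ_of_ne_zero hk
    rw [smul_apply, pow_succ, mul_apply_eq_comp, map_smul,
      smul_apply, β.self, smul_zero, map_zero, smul_zero]
  · simp

/-! #### The product -/

/-- The coefficients of the bracket of two power series. -/
def conv (g c : ℕ → L) (j : ℕ) : L := ∑ p ∈ Finset.HasAntidiagonal.antidiagonal j, β.br (g p.1) (c p.2)

/-- The coefficients of `(ad g)ᵏ Y` for a power series `g`. -/
def adPow (g : ℕ → L) (Y : L) : ℕ → ℕ → L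
  | 0 => Pi.single 0 Y
  | k + 1 => β.conv g (adPow g Y k)

/-- One step of the Picard iteration for `γ' = mcInv γ Y`, `γ 0 = X`, on coefficients. -/
def picardStep (X Y : L) (g : ℕ → L) : ℕ → L
  | 0 => X
  | j + 1 => (((j + 1 : ℚ)⁻¹ : ℚ) : 𝕜) • ∑ k ∈ Finset.range (β.cls + 1),
      (expQuotInvCoeff k : 𝕜) • β.adPow g Y k j

/-- The Picard iterates of `γ' = mcInv γ Y`, `γ 0 = X`, on coefficients. -/
def picard (X Y : L) (n : ℕ) : ℕ → L := (β.picardStep X Y)^[n] 0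

/-- The coefficients of the solution of `γ' = mcInv γ Y`, `γ 0 = X`. -/
def coef (X Y : L) (j : ℕ) : L := β.picard X Y (j + 1) j

/-- The Baker-Campbell-Hausdorff product. -/
def bch (X Y : L) : L := ∑ j ∈ Finset.range (β.cls + 2), β.coef X Y j

theorem picard_succ (X Y : L) (n : ℕ) :
    β.picard X Y (n + 1) = β.picardStep X Y (β.picard X Y n) :=
  Function.iterate_succ_apply' _ _ _

theorem conv_congr {g g' c c' : ℕ → L} {j : ℕ} (hg : ∀ i ≤ j, g i = g' i)
    (hc : ∀ i ≤ j, c i = c' i) : β.conv g c j = β.conv g' c' j := by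
  refine Finset.sum_congr rfl fun p hp => ?_
  have := Finset.HasAntidiagonal.mem_antidiagonal.1 hp
  rw [hg _ (by omega), hc _ (by omega)]

theorem adPow_congr {g g' : ℕ → L} {j : ℕ} (hg : ∀ i ≤ j, g i = g' i) (Y : L) (k : ℕ) :
    ∀ l ≤ j, β.adPow g Y k l = β.adPow g' Y k l := by
  induction k with
  | zero => intro l _; rfl
  | succ k ih =>
    intro l hl
    exact β.conv_congr (fun i hi => hg i (hi.trans hl)) (fun i hi => ih i (hi.trans hl))

theorem picardStep_congr (X Y : L) {g g' : ℕ → L} {j : ℕ} (hg : ∀ i < j, g i = g' i) :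
    ∀ i < j + 1, β.picardStep X Y g i = β.picardStep X Y g' i := by
  intro i hi
  cases i with
  | zero => rfl
  | succ i =>
    simp only [picardStep]
    congr 1
    refine Finset.sum_congr rfl fun k _ => ?_
    rw [β.adPow_congr (j := i) (fun l hl => hg l (by omega)) Y k i le_rfl]

/-- Coefficient j + 1 of a Picard step reads only coefficients up to j, so each step fixes one more
coefficient and the formal solution is reached without any limit. -/
theorem picard_stable (X Y : L) : ∀ n m : ℕ, n ≤ m → ∀ i < n,
    β.picard X Y n i = β.picard X Y m i := by
  intro n
  induction n with
  | zero => intro m _ i hi; omega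
  | succ n ih =>
    intro m hm
    obtain ⟨m, rfl⟩ : ∃ m', m = m' + 1 := ⟨m - 1, by omega⟩
    rw [picard_succ, picard_succ]
    exact β.picardStep_congr X Y (ih m (by omega))

theorem coef_eq_picard (X Y : L) {n j : ℕ} (h : j < n) : β.coef X Y j = β.picard X Y n j :=
  β.picard_stable X Y (j + 1) n h j (Nat.lt_succ_self j)

theorem coef_zero (X Y : L) : β.coef X Y 0 = X := by
  rw [coef, picard_succ]; rfl

theorem coef_succ (X Y : L) (j : ℕ) : β.coef X Y (j + 1) =
    (((j + 1 : ℚ)⁻¹ : ℚ) : 𝕜) • ∑ k ∈ Finset.range (β.cls + 1),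
      (expQuotInvCoeff k : 𝕜) • β.adPow (β.coef X Y) Y k j := by
  rw [coef, picard_succ, picardStep]
  congr 1
  refine Finset.sum_congr rfl fun k _ => ?_
  rw [β.adPow_congr (g' := β.coef X Y) (j := j)
    (fun l hl => (β.coef_eq_picard X Y (by omega)).symm) Y k j le_rfl]

/-- The constant term of g is arbitrary and its later terms lag one level behind their index; the
level gained by the bracket itself makes up for both. -/
theorem conv_mem_lcs {g c : ℕ → L} {n : ℕ} (hg : ∀ j, j + 1 ≤ n → g (j + 1) ∈ bracketLCS β.br j)
    (hc : ∀ j ≤ n, c j ∈ bracketLCS β.br j) : ∀ j ≤ n, β.conv g c j ∈ bracketLCS β.br j := by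
  intro j hj
  refine Submodule.sum_mem _ fun p hp => ?_
  have hp := Finset.HasAntidiagonal.mem_antidiagonal.1 hp
  obtain ⟨i, l⟩ := p
  simp only at hp ⊢
  cases i with
  | zero =>
    obtain rfl : l = j := by omega
    exact β.lcs_succ_le _ (β.br_mem_lcs _ (hc _ hj))
  | succ i =>
    have := β.br_mem_lcs_add (hg i (by omega)) (hc l (by omega))
    rwa [show i + l + 1 = j by omega] at this

theorem adPow_mem_lcs {g : ℕ → L} {n : ℕ}
    (hg : ∀ j, j + 1 ≤ n → g (j + 1) ∈ bracketLCS β.br j) (Y : L) (k : ℕ) :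
    ∀ j ≤ n, β.adPow g Y k j ∈ bracketLCS β.br j := by
  induction k with
  | zero =>
    intro j _
    cases j with
    | zero => trivial
    | succ j => simp [adPow]
  | succ k ih => exact β.conv_mem_lcs hg ih

/-- The coefficient of tʲ⁺¹ involves at least j nested brackets. Hence the coefficients vanish from
index `cls + 1` on, and a sum over `range (cls + 2)` captures the whole solution. -/
theorem coef_mem_lcs (X Y : L) (n : ℕ) :
    ∀ j, j + 1 ≤ n → β.coef X Y (j + 1) ∈ bracketLCS β.br j := by
  induction n with
  | zero => intro j hj; omega
  | succ n ih =>
    intro j hj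
    rw [coef_succ]
    refine Submodule.smul_mem _ _ (Submodule.sum_mem _ fun k _ => Submodule.smul_mem _ _ ?_)
    exact β.adPow_mem_lcs ih Y k j (by omega)

/-- Evaluation of a sequence of coefficients as a polynomial curve. -/
def evalCurve (c : ℕ → L) (t : 𝕜) : L := ∑ j ∈ Finset.range (β.cls + 2), t ^ j • c j

theorem evalCurve_conv {g c : ℕ → L} (hg : ∀ j, g (j + 1) ∈ bracketLCS β.br j)
    (hc : ∀ j, c j ∈ bracketLCS β.br j) (t : 𝕜) :
    β.evalCurve (β.conv g c) t = β.br (β.evalCurve g t) (β.evalCurve c t) := by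
  simp only [evalCurve, map_sum, sum_apply, map_smul, smul_apply, Finset.smul_sum, smul_smul,
    ← pow_add]
  rw [Finset.sum_comm, Finset.sum_range_sum_range_eq_sum_antidiagonal]
  · refine Finset.sum_congr rfl fun j _ => ?_
    rw [conv, Finset.smul_sum]
    refine Finset.sum_congr rfl fun p hp => ?_
    rw [add_comm p.2 p.1, Finset.HasAntidiagonal.mem_antidiagonal.1 hp]
  · intro i l hil
    have : β.br (g i) (c l) = 0 := by
      cases i with
      | zero =>
        have := hc l
        rw [β.lcs_eq_bot (by omega), Submodule.mem_bot] at this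
        rw [this, map_zero]
      | succ i =>
        have := β.br_mem_lcs_add (hg i) (hc l)
        rwa [β.lcs_eq_bot (by omega), Submodule.mem_bot] at this
    rw [this, smul_zero]

theorem evalCurve_adPow {g : ℕ → L} (hg : ∀ j, g (j + 1) ∈ bracketLCS β.br j) (Y : L) (k : ℕ)
    (t : 𝕜) : β.evalCurve (β.adPow g Y k) t = (β.br (β.evalCurve g t) ^ k) Y := by
  induction k with
  | zero =>
    rw [evalCurve, Finset.sum_eq_single 0]
    · simp [adPow]
    · intro j _ hj; simp [adPow, hj]
    · simp
  | succ k ih =>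
    rw [adPow, evalCurve_conv β hg fun j => β.adPow_mem_lcs (n := j) (fun i _ => hg i) Y k j le_rfl,
      ih, pow_succ', mul_apply_eq_comp]

theorem hasDerivAt_evalCurve_coef (X Y : L) (t : 𝕜) :
    HasDerivAt (β.evalCurve (β.coef X Y)) (β.mcInv (β.evalCurve (β.coef X Y) t) Y) t := by
  have hg : ∀ j, β.coef X Y (j + 1) ∈ bracketLCS β.br j := fun j =>
    β.coef_mem_lcs X Y (j + 1) j le_rfl
  have h1 : HasDerivAt (β.evalCurve (β.coef X Y))
      (∑ j ∈ Finset.range (β.cls + 2), ((j : 𝕜) * t ^ (j - 1)) • β.coef X Y j) t := by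
    exact HasDerivAt.fun_sum (u := Finset.range (β.cls + 2)) fun j _ => (hasDerivAt_pow j t).smul_const (β.coef X Y j)
  convert h1 using 1
  rw [Finset.sum_range_succ', mcInv, sum_apply]
  simp only [smul_apply, ← β.evalCurve_adPow hg, Nat.cast_zero, zero_mul, zero_smul, add_zero,
    coef_succ, Nat.add_sub_cancel]
  -- Differentiation lowers the degree by one, so the sum is shortened accordingly; the dropped term
  -- lies in a vanishing level of the lower central series.
  have h2 : ∀ k, β.evalCurve (β.adPow (β.coef X Y) Y k) t =
      ∑ j ∈ Finset.range (β.cls + 1), t ^ j • β.adPow (β.coef X Y) Y k j := by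
    intro k
    rw [evalCurve, Finset.sum_range_succ]
    have := β.adPow_mem_lcs (n := β.cls + 1) (fun i _ => hg i) Y k (β.cls + 1) le_rfl
    rw [β.lcs_eq_bot (Nat.le_succ _), Submodule.mem_bot] at this
    rw [this, smul_zero, add_zero]
  simp only [h2, Finset.smul_sum]
  rw [Finset.sum_comm]
  refine Finset.sum_congr rfl fun j _ => Finset.sum_congr rfl fun k _ => ?_
  rw [smul_smul, smul_smul, smul_smul]
  congr 1
  have : ((j : 𝕜) + 1) ≠ 0 := Nat.cast_add_one_ne_zero j
  push_cast
  field_simp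

theorem adPow_smul {g g' : ℕ → L} {t : 𝕜} {n : ℕ} (hg : ∀ j ≤ n, g' j = t ^ j • g j) (Y : L)
    (k : ℕ) : ∀ j ≤ n, β.adPow g' (t • Y) k j = t ^ (j + 1) • β.adPow g Y k j := by
  induction k with
  | zero =>
    intro j _
    cases j with
    | zero => simp [adPow]
    | succ j => simp [adPow]
  | succ k ih =>
    intro j hj
    simp only [adPow, conv, Finset.smul_sum]
    refine Finset.sum_congr rfl fun p hp => ?_
    have := Finset.HasAntidiagonal.mem_antidiagonal.1 hp
    rw [hg _ (by omega), ih _ (by omega), map_smul, map_smul, smul_apply, smul_smul, ← this]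
    ring_nf

/-- Scaling Y rescales time in γ' = mcInv(γ) Y. This turns the product with t • Y into the value of
the solution at time t. -/
theorem coef_smul (X Y : L) (t : 𝕜) (n : ℕ) :
    ∀ j ≤ n, β.coef X (t • Y) j = t ^ j • β.coef X Y j := by
  induction n with
  | zero =>
    intro j hj
    obtain rfl : j = 0 := by omega
    simp [coef_zero]
  | succ n ih =>
    intro j hj
    cases j with
    | zero => simp [coef_zero]
    | succ j =>
      rw [coef_succ, coef_succ, smul_comm (t ^ (j + 1))]
      congr 1
      rw [Finset.smul_sum]
      exact Finset.sum_congr rfl fun k _ => by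
        rw [β.adPow_smul ih Y k j (by omega), smul_comm]

theorem bch_smul (X Y : L) (t : 𝕜) : β.bch X (t • Y) = β.evalCurve (β.coef X Y) t :=
  Finset.sum_congr rfl fun j _ => β.coef_smul X Y t j j le_rfl

theorem hasDerivAt_bch_smul (X Y : L) (t : 𝕜) :
    HasDerivAt (fun s : 𝕜 => β.bch X (s • Y)) (β.mcInv (β.bch X (t • Y)) Y) t := by
  simp only [bch_smul]
  exact β.hasDerivAt_evalCurve_coef X Y t

theorem bch_zero_right (X : L) : β.bch X 0 = X := by
  have := β.bch_smul X 0 (0 : 𝕜)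
  rw [smul_zero] at this
  rw [this, evalCurve, Finset.sum_eq_single 0]
  · simp [coef_zero]
  · intro j _ hj; simp [hj]
  · simp

/-! #### Relations preserved by the product -/

/-- The product is a rational combination of iterated brackets, so it respects any additive relation
that is stable under rational scaling and brackets. Specializing R to a graph gives naturality, to a
subalgebra gives closure, and to a congruence gives compatibility with ideals. The classes must
agree because they set the truncation. -/
theorem bch_rel {𝕜' : Type*} [RCLike 𝕜'] {L' : Type*} [NormedAddCommGroup L']
    [NormedSpace 𝕜' L'] (β' : NilBracket 𝕜' L') (hcls : β.cls = β'.cls)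
    (R : AddSubgroup (L × L'))
    (hsmul : ∀ (q : ℚ) (p : L × L'), p ∈ R → ((q : 𝕜) • p.1, (q : 𝕜') • p.2) ∈ R)
    (hbr : ∀ p ∈ R, ∀ p' ∈ R, (β.br p.1 p'.1, β'.br p.2 p'.2) ∈ R)
    {X Y : L} {X' Y' : L'} (hX : (X, X') ∈ R) (hY : (Y, Y') ∈ R) :
    (β.bch X Y, β'.bch X' Y') ∈ R := by
  have hsum : ∀ {ι : Type} (s : Finset ι) (f : ι → L) (f' : ι → L'),
      (∀ i ∈ s, (f i, f' i) ∈ R) → (∑ i ∈ s, f i, ∑ i ∈ s, f' i) ∈ R := by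
    intro ι s f f' h
    have := sum_mem h
    convert this using 1
    ext <;> simp [Prod.fst_sum, Prod.snd_sum]
  have had : ∀ (g : ℕ → L) (g' : ℕ → L'), (∀ j, (g j, g' j) ∈ R) → ∀ k j,
      (β.adPow g Y k j, β'.adPow g' Y' k j) ∈ R := by
    intro g g' hg k
    induction k with
    | zero =>
      intro j
      cases j with
      | zero => simpa [adPow] using hY
      | succ j => simp only [adPow, ne_eq, Nat.succ_ne_zero, not_false_eq_true, Pi.single_eq_of_ne]; exact R.zero_mem
    | succ k ih =>
      intro j
      exact hsum (Finset.HasAntidiagonal.antidiagonal j) (fun p => β.br (g p.1) (β.adPow g Y k p.2))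
        (fun p => β'.br (g' p.1) (β'.adPow g' Y' k p.2)) fun p _ => hbr _ (hg p.1) _ (ih p.2)
  have hpic : ∀ n j, (β.picard X Y n j, β'.picard X' Y' n j) ∈ R := by
    intro n
    induction n with
    | zero => intro j; exact R.zero_mem
    | succ n ih =>
      intro j
      rw [picard_succ, picard_succ]
      cases j with
      | zero => exact hX
      | succ j =>
        simp only [picardStep, ← hcls]
        exact hsmul _ (_, _) (hsum (Finset.range (β.cls + 1)) (fun k => (expQuotInvCoeff k : 𝕜) • β.adPow _ Y k j)
          (fun k => (expQuotInvCoeff k : 𝕜') • β'.adPow _ Y' k j)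
          fun k _ => hsmul _ (_, _) (had _ _ ih k j))
  rw [bch, bch, ← hcls]
  exact hsum _ _ _ fun j _ => hpic _ _

theorem bch_map {𝕜' : Type*} [RCLike 𝕜'] {L' : Type*} [NormedAddCommGroup L']
    [NormedSpace 𝕜' L'] (β' : NilBracket 𝕜' L') (hcls : β.cls = β'.cls) (f : L →+ L')
    (hsmul : ∀ (q : ℚ) x, f ((q : 𝕜) • x) = (q : 𝕜') • f x)
    (hbr : ∀ x y, f (β.br x y) = β'.br (f x) (f y)) (X Y : L) :
    f (β.bch X Y) = β'.bch (f X) (f Y) :=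
  β.bch_rel β' hcls f.graph
    (fun q p hp => by
      rw [AddMonoidHom.mem_graph] at hp ⊢
      simp only [hsmul, hp])
    (fun p hp p' hp' => by
      rw [AddMonoidHom.mem_graph] at hp hp' ⊢
      simp only [hbr, hp, hp'])
    (X := X) (Y := Y) rfl rfl

theorem bch_mem (D : Submodule 𝕜 L) (hD : ∀ x ∈ D, ∀ y ∈ D, β.br x y ∈ D) {X Y : L}
    (hX : X ∈ D) (hY : Y ∈ D) : β.bch X Y ∈ D :=
  β.bch_rel β rfl (D.toAddSubgroup.prod ⊤)
    (fun _ _ hp => ⟨D.smul_mem _ hp.1, trivial⟩)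
    (fun _ hp _ hp' => ⟨hD _ hp.1 _ hp'.1, trivial⟩)
    (X' := 0) (Y' := 0) ⟨hX, trivial⟩ ⟨hY, trivial⟩ |>.1

theorem bch_sub_bch_mem (D : Submodule 𝕜 L) (hD : ∀ x, ∀ y ∈ D, β.br x y ∈ D) {X Y X' Y' : L}
    (hX : X - X' ∈ D) (hY : Y - Y' ∈ D) : β.bch X Y - β.bch X' Y' ∈ D := by
  have hD' : ∀ x ∈ D, ∀ y, β.br x y ∈ D := fun x hx y => by
    rw [β.skew]; exact D.neg_mem (hD y x hx)
  exact β.bch_rel β rfl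
    (D.toAddSubgroup.comap (AddMonoidHom.fst L L - AddMonoidHom.snd L L))
    (fun q p hp => by
      have := D.smul_mem (q : 𝕜) (show p.1 - p.2 ∈ D from hp)
      rw [smul_sub] at this
      exact this)
    (fun p hp p' hp' => by
      have h1 : p.1 - p.2 ∈ D := hp
      have h2 : p'.1 - p'.2 ∈ D := hp'
      change β.br p.1 p'.1 - β.br p.2 p'.2 ∈ D
      have : β.br p.1 p'.1 - β.br p.2 p'.2 = β.br (p.1 - p.2) p'.1 + β.br p.2 (p'.1 - p'.2) := by
        simp
      rw [this]
      exact add_mem (hD' _ h1 _) (hD _ _ h2))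
    (X := X) (Y := Y) hX hY

/-- The zero bracket, regarded as nilpotent of the same class as `β`. -/
def abelian : NilBracket 𝕜 L where
  br := 0
  self x := by simp
  jacobi x y z := by simp
  cls := β.cls
  nil := by
    have h := β.nil
    generalize β.cls = c at h
    cases c with
    | zero => exact h
    | succ c =>
      rw [bracketLCS, Submodule.span_eq_bot]
      rintro z ⟨x, y, _, rfl⟩
      simp

theorem bch_abelian (X Y : L) : β.abelian.bch X Y = X + Y := by
  have had : ∀ g k, β.abelian.adPow g Y (k + 1) = 0 := by
    intro g k
    ext j
    simp [adPow, conv, abelian]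
  have h1 : ∀ j, β.abelian.coef X Y (j + 1) = if j = 0 then Y else 0 := by
    intro j
    rw [coef_succ, Finset.sum_range_succ']
    simp only [had]
    have : expQuotInvCoeff 0 = 1 := by
      have := sum_expQuotCoeff_mul_inv 0
      simpa [expQuotCoeff] using this
    by_cases hj : j = 0
    · subst hj; simp [adPow, this]
    · simp [adPow, hj]
  rw [bch, Finset.sum_range_succ', Finset.sum_range_succ']
  simp only [h1, coef_zero, Nat.add_eq_zero_iff, one_ne_zero, and_false, if_false,
    Finset.sum_const_zero, if_true, zero_add]
  exact add_comm _ _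

/-- Comparison with the zero bracket: on D the two brackets agree modulo V, hence so do their
products. In the factorization this makes a linear functional that vanishes on V additive on the
group of D. -/
theorem bch_sub_add_mem (D V : Submodule 𝕜 L) (hD : ∀ x ∈ D, ∀ y ∈ D, β.br x y ∈ D)
    (hV : ∀ x ∈ D, ∀ y ∈ D, β.br x y ∈ V) {X Y : L} (hX : X ∈ D) (hY : Y ∈ D) :
    β.bch X Y - (X + Y) ∈ V := by
  rw [← bch_abelian β]
  exact (β.bch_rel β.abelian rfl
    ((V.toAddSubgroup.comap (AddMonoidHom.fst L L - AddMonoidHom.snd L L)) ⊓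
      D.toAddSubgroup.prod ⊤)
    (fun q p hp => by
      refine ⟨?_, D.smul_mem _ hp.2.1, trivial⟩
      have := V.smul_mem (q : 𝕜) (show p.1 - p.2 ∈ V from hp.1)
      rw [smul_sub] at this
      exact this)
    (fun p hp p' hp' => by
      refine ⟨?_, hD _ hp.2.1 _ hp'.2.1, trivial⟩
      change β.br p.1 p'.1 - 0 ∈ V
      rw [sub_zero]
      exact hV _ hp.2.1 _ hp'.2.1)
    (X := X) (Y := Y) (X' := X) (Y' := Y)
    ⟨by simp, hX, trivial⟩ ⟨by simp, hY, trivial⟩).1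

/-! #### Polynomial maps -/

end NilBracket

/-- The maps from `S` to `W` that are polynomial in coordinates `c` on `S`. -/
def polyMaps {S σ : Type*} (c : S → σ → 𝕜) (W : Type*) [AddCommGroup W] [Module 𝕜 W] :
    Submodule 𝕜 (S → W) :=
  Submodule.span 𝕜 {f | ∃ (P : MvPolynomial σ 𝕜) (w : W),
    f = fun s => MvPolynomial.eval (c s) P • w}

section polyMaps

variable {S σ : Type*} {c : S → σ → 𝕜} {W W' W'' : Type*} [AddCommGroup W] [Module 𝕜 W]
  [AddCommGroup W'] [Module 𝕜 W'] [AddCommGroup W''] [Module 𝕜 W'']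

theorem linear_mem_polyMaps (A : W →ₗ[𝕜] W') {f : S → W} (hf : f ∈ polyMaps c W) :
    (fun s => A (f s)) ∈ polyMaps c W' := by
  induction hf using Submodule.span_induction with
  | mem f hf =>
    obtain ⟨P, w, rfl⟩ := hf
    exact Submodule.subset_span ⟨P, A w, by simp⟩
  | zero => simp only [map_zero, Pi.zero_apply]; exact zero_mem _
  | add f g _ _ hf hg => simp only [map_add, Pi.add_apply]; exact add_mem hf hg
  | smul r f _ hf => simp only [map_smul, Pi.smul_apply]; exact Submodule.smul_mem _ r hf

theorem bilinear_mem_polyMaps (A : W →ₗ[𝕜] W' →ₗ[𝕜] W'') {f : S → W} {g : S → W'}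
    (hf : f ∈ polyMaps c W) (hg : g ∈ polyMaps c W') :
    (fun s => A (f s) (g s)) ∈ polyMaps c W'' := by
  induction hf using Submodule.span_induction with
  | mem f hf =>
    obtain ⟨P, w, rfl⟩ := hf
    induction hg using Submodule.span_induction with
    | mem g hg =>
      obtain ⟨Q, w', rfl⟩ := hg
      exact Submodule.subset_span ⟨P * Q, A w w', by ext s; simp [smul_smul, mul_comm]⟩
    | zero => simp only [map_zero, Pi.zero_apply]; exact zero_mem _
    | add f g _ _ hf hg => simp only [map_add, Pi.add_apply]; exact add_mem hf hg
    | smul r f _ hf =>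
      simp only [Pi.smul_apply, map_smul _ r]; exact Submodule.smul_mem _ r hf
  | zero => simp only [map_zero, Pi.zero_apply, LinearMap.zero_apply]; exact zero_mem _
  | add f g _ _ hf hg =>
    simp only [map_add, Pi.add_apply, LinearMap.add_apply]; exact add_mem hf hg
  | smul r f _ hf =>
    simp only [map_smul, Pi.smul_apply, LinearMap.smul_apply]; exact Submodule.smul_mem _ r hf

theorem exists_eval_of_mem_polyMaps {f : S → 𝕜} (hf : f ∈ polyMaps c 𝕜) :
    ∃ P : MvPolynomial σ 𝕜, ∀ s, f s = MvPolynomial.eval (c s) P := by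
  induction hf using Submodule.span_induction with
  | mem f hf =>
    obtain ⟨P, w, rfl⟩ := hf
    exact ⟨P * MvPolynomial.C w, by simp⟩
  | zero => exact ⟨0, by simp⟩
  | add f g _ _ hf hg =>
    obtain ⟨P, hP⟩ := hf
    obtain ⟨Q, hQ⟩ := hg
    exact ⟨P + Q, by simp [hP, hQ]⟩
  | smul r f _ hf =>
    obtain ⟨P, hP⟩ := hf
    exact ⟨MvPolynomial.C r * P, by simp [hP]⟩

/-- The product is built in finitely many steps from the bilinear bracket, sums and scalings, each
of which preserves polynomial maps. -/
theorem bch_mem_polyMaps (β : NilBracket 𝕜 L) {f g : S → L} (hf : f ∈ polyMaps c L)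
    (hg : g ∈ polyMaps c L) : (fun s => β.bch (f s) (g s)) ∈ polyMaps c L := by
  have hsum : ∀ {ι : Type} (s : Finset ι) (u : S → ι → L),
      (∀ i ∈ s, (fun x => u x i) ∈ polyMaps c L) → (fun x => ∑ i ∈ s, u x i) ∈ polyMaps c L := by
    intro ι s u h
    have := Submodule.sum_mem _ h
    convert! this using 1
    ext x
    simp
  have had : ∀ (u : S → ℕ → L), (∀ j, (fun x => u x j) ∈ polyMaps c L) → ∀ k j,
      (fun x => β.adPow (u x) (g x) k j) ∈ polyMaps c L := by
    intro u hu k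
    induction k with
    | zero =>
      intro j
      cases j with
      | zero => simpa [NilBracket.adPow] using hg
      | succ j =>
        simp only [NilBracket.adPow, ne_eq, Nat.succ_ne_zero, not_false_eq_true,
          Pi.single_eq_of_ne]
        exact zero_mem _
    | succ k ih =>
      intro j
      refine hsum (Finset.HasAntidiagonal.antidiagonal j)
        (fun x (p : ℕ × ℕ) => β.br (u x p.1) (β.adPow (u x) (g x) k p.2)) fun p _ => ?_
      exact bilinear_mem_polyMaps (β.br.toLinearMap₁₂) (hu p.1) (ih p.2)
  have hpic : ∀ n j, (fun x => β.picard (f x) (g x) n j) ∈ polyMaps c L := by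
    intro n
    induction n with
    | zero => intro j; exact zero_mem _
    | succ n ih =>
      intro j
      simp only [NilBracket.picard_succ]
      cases j with
      | zero => exact hf
      | succ j =>
        exact Submodule.smul_mem _ _ (hsum _ _ fun k _ =>
          Submodule.smul_mem _ (expQuotInvCoeff k : 𝕜) (had _ ih k j))
  exact hsum _ _ fun j _ => hpic _ _

theorem contDiff_of_mem_polyMaps {S : Type*} [NormedAddCommGroup S] [NormedSpace 𝕜 S]
    {W : Type*} [NormedAddCommGroup W] [NormedSpace 𝕜 W]
    {c : S → σ → 𝕜} {n : WithTop ℕ∞} (hc : ∀ i, ContDiff 𝕜 n fun s => c s i) {f : S → W}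
    (hf : f ∈ polyMaps c W) : ContDiff 𝕜 n f := by
  induction hf using Submodule.span_induction with
  | mem f hf =>
    obtain ⟨P, w, rfl⟩ := hf
    refine ContDiff.smul ?_ contDiff_const
    induction P using MvPolynomial.induction_on with
    | C a => simpa using contDiff_const
    | add p q hp hq => simpa using hp.add hq
    | mul_X p i hp => simpa using hp.mul (hc i)
  | zero => exact contDiff_const
  | add f g _ _ hf hg => exact hf.add hg
  | smul r f _ hf => exact hf.const_smul r

theorem mem_polyMaps_of_basis {ι : Type*} [Fintype ι] (b : Module.Basis ι 𝕜 W) {f : S → W}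
    (hf : ∀ i, (fun s => b.repr (f s) i) ∈ polyMaps c 𝕜) : f ∈ polyMaps c W := by
  have h : f = ∑ i, fun s => b.repr (f s) i • b i := by
    ext s
    simp [b.sum_repr]
  rw [h]
  refine Submodule.sum_mem _ fun i _ => ?_
  exact linear_mem_polyMaps (LinearMap.toSpanSingleton 𝕜 W (b i)) (hf i)

theorem coord_mem_polyMaps (i : σ) : (fun s => c s i) ∈ polyMaps c 𝕜 :=
  Submodule.subset_span ⟨MvPolynomial.X i, 1, by simp⟩

end polyMaps

theorem NilBracket.contDiff_bch [FiniteDimensional 𝕜 L] (β : NilBracket 𝕜 L)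
    {n : WithTop ℕ∞} : ContDiff 𝕜 n fun p : L × L => β.bch p.1 p.2 := by
  let b := Module.finBasis 𝕜 L
  let c : L × L → (Fin _ ⊕ Fin _) → 𝕜 := fun p => Sum.elim (b.repr p.1) (b.repr p.2)
  have hlin : ∀ i, ContDiff 𝕜 n fun x : L => b.repr x i := fun i =>
    (LinearMap.toContinuousLinearMap (b.coord i)).contDiff
  refine contDiff_of_mem_polyMaps (c := c) ?_ (bch_mem_polyMaps β ?_ ?_)
  · rintro (i | i)
    · exact (hlin i).comp contDiff_fst
    · exact (hlin i).comp contDiff_snd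
  · exact mem_polyMaps_of_basis b fun i => coord_mem_polyMaps (c := c) (Sum.inl i)
  · exact mem_polyMaps_of_basis b fun i => coord_mem_polyMaps (c := c) (Sum.inr i)

end NilBracket

/-! ### Uniqueness of solutions of autonomous differential equations -/

theorem eq_zero_of_hasDerivAt_linear {F : Type*} [NormedAddCommGroup F] [NormedSpace ℝ F]
    (B : F →L[ℝ] F) {u : ℝ → F} (hu : ∀ t, HasDerivAt u (B (u t)) t) (h0 : u 0 = 0) (t : ℝ) :
    u t = 0 := by
  have := ODE_solution_unique_univ (v := fun _ x => B x) (s := fun _ => Set.univ) (K := ‖B‖₊)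
    (f := u) (g := fun _ => 0) (t₀ := 0) (fun t => B.lipschitz.lipschitzOnWith)
    (fun t => ⟨hu t, trivial⟩)
    (fun t => ⟨by simpa using hasDerivAt_const t (0 : F), trivial⟩) h0
  exact congrFun this t

theorem eq_of_hasDerivAt_of_contDiff {F : Type*} [NormedAddCommGroup F] [NormedSpace ℝ F]
    {v : F → F} (hv : ContDiff ℝ 1 v) {f g : ℝ → F} {b : ℝ} (hb : 0 ≤ b)
    (hf : ∀ t ∈ Set.Icc 0 b, HasDerivAt f (v (f t)) t)
    (hg : ∀ t ∈ Set.Icc 0 b, HasDerivAt g (v (g t)) t) (h0 : f 0 = g 0) : f b = g b := by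
  have hfc : ContinuousOn f (Set.Icc 0 b) := fun t ht => (hf t ht).continuousAt.continuousWithinAt
  have hgc : ContinuousOn g (Set.Icc 0 b) := fun t ht => (hg t ht).continuousAt.continuousWithinAt
  -- A C¹ field is only locally Lipschitz; the two trajectories over [0, b] have compact union, and
  -- there it is Lipschitz.
  have hK : IsCompact (f '' Set.Icc 0 b ∪ g '' Set.Icc 0 b) :=
    (isCompact_Icc.image_of_continuousOn hfc).union (isCompact_Icc.image_of_continuousOn hgc)
  obtain ⟨K, hK⟩ := LocallyLipschitzOn.exists_lipschitzOnWith_of_compact hK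
    hv.locallyLipschitz.locallyLipschitzOn
  refine ODE_solution_unique_of_mem_Icc_right (v := fun _ x => v x)
    (s := fun _ => f '' Set.Icc 0 b ∪ g '' Set.Icc 0 b) (fun t _ => hK) hfc
    (fun t ht => (hf t ⟨ht.1, ht.2.le⟩).hasDerivWithinAt)
    (fun t ht => Or.inl ⟨t, ⟨ht.1, ht.2.le⟩, rfl⟩) hgc
    (fun t ht => (hg t ⟨ht.1, ht.2.le⟩).hasDerivWithinAt)
    (fun t ht => Or.inr ⟨t, ⟨ht.1, ht.2.le⟩, rfl⟩) h0 ⟨hb, le_rfl⟩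

/-! ### The Maurer-Cartan equation and associativity -/

namespace NilBracket

section Real

variable {L : Type*} [NormedAddCommGroup L] [NormedSpace ℝ L] (β : NilBracket ℝ L)

theorem contDiff_mc {n : WithTop ℕ∞} : ContDiff ℝ n β.mc := by
  unfold mc
  exact ContDiff.sum fun k _ => (β.br.contDiff.pow k).const_smul _

theorem contDiff_mcInv {n : WithTop ℕ∞} : ContDiff ℝ n β.mcInv := by
  unfold mcInv
  exact ContDiff.sum fun k _ => (β.br.contDiff.pow k).const_smul _

/-- The polynomial curve `∑ aₖ tᵏ⁺¹ eₖ` with `aₖ` the coefficients of `(1 - exp (-x)) / x`. -/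
def mcCurve (e : ℕ → L) (t : ℝ) : L :=
  ∑ k ∈ Finset.range (β.cls + 1), ((expQuotCoeff k : ℝ) * t ^ (k + 1)) • e k

/-- This is the recursion (k + 2) aₖ₊₁ = −aₖ. It is stated for an arbitrary sequence e so that it
applies both to (ad Z)ᵏ V and to its derivatives in Z. -/
theorem hasDerivAt_mcCurve (e : ℕ → L) (he : e (β.cls + 1) = 0) (t : ℝ) :
    HasDerivAt (β.mcCurve e) (e 0 - β.mcCurve (fun k => e (k + 1)) t) t := by
  have h1 : HasDerivAt (β.mcCurve e)
      (∑ k ∈ Finset.range (β.cls + 1),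
        ((expQuotCoeff k : ℝ) * ((k + 1 : ℕ) * t ^ k)) • e k) t := by
    refine HasDerivAt.fun_sum (u := Finset.range (β.cls + 1)) fun k _ => ?_
    have := ((hasDerivAt_pow (k + 1) t).const_mul (expQuotCoeff k : ℝ)).smul_const (e k)
    simpa using this
  convert h1 using 1
  rw [mcCurve, Finset.sum_range_succ, he, smul_zero, add_zero, Finset.sum_range_succ',
    sub_eq_iff_eq_add, add_right_comm, ← Finset.sum_add_distrib, Finset.sum_eq_zero]
  · simp [expQuotCoeff]
  · intro k _
    rw [← add_smul]
    convert zero_smul ℝ (e (k + 1)) using 2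
    have h2 : ((k : ℝ) + 1 + 1) ≠ 0 := by positivity
    have h3 : ((k + 1).factorial : ℝ) ≠ 0 := by positivity
    simp only [expQuotCoeff, Nat.factorial_succ (k + 1)]
    push_cast
    field_simp
    ring

theorem mcCurve_ad_pow_one (Z V : L) : β.mcCurve (fun k => (β.br Z ^ k) V) 1 = β.mc Z V := by
  simp [mcCurve, mc]

/-- Analytically both sides are ∫₀ᵗ exp(−s ad Z) V ds, the solution of v' = V − [Z, v] with v(0) =
0. -/
theorem mcCurve_ad_pow (Z V : L) (t : ℝ) :
    β.mcCurve (fun k => (β.br Z ^ k) V) t = t • β.mc (t • Z) V := by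
  simp only [mcCurve, mc, sum_apply, smul_apply, Finset.smul_sum, map_smul, smul_pow]
  refine Finset.sum_congr rfl fun k _ => ?_
  rw [smul_smul, smul_smul]
  congr 1
  ring

theorem mcCurve_add (e e' : ℕ → L) (t : ℝ) :
    β.mcCurve (fun k => e k + e' k) t = β.mcCurve e t + β.mcCurve e' t := by
  simp [mcCurve, Finset.sum_add_distrib]

theorem mcCurve_map (B : L →L[ℝ] L) (e : ℕ → L) (t : ℝ) :
    β.mcCurve (fun k => B (e k)) t = B (β.mcCurve e t) := by
  simp [mcCurve]

theorem hasDerivAt_mcCurve_ad_pow (Z V : L) (t : ℝ) :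
    HasDerivAt (β.mcCurve fun k => (β.br Z ^ k) V)
      (V - β.br Z (β.mcCurve (fun k => (β.br Z ^ k) V) t)) t := by
  have h := β.hasDerivAt_mcCurve (fun k => (β.br Z ^ k) V)
    (by rw [β.ad_pow_eq_zero Z (Nat.le_succ _)]; rfl) t
  rw [← mcCurve_map]
  simpa [pow_succ', mul_apply_eq_comp] using h

/-- The derivative of `Z ↦ (ad Z)ᵏ` in the direction `U`. -/
def adPowDeriv (Z U : L) (k : ℕ) : L →L[ℝ] L := fderiv ℝ (fun z => β.br z ^ k) Z U

theorem differentiable_ad_pow (k : ℕ) : Differentiable ℝ fun z => β.br z ^ k :=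
  (β.br.contDiff (n := 1).pow k).differentiable one_ne_zero

theorem adPowDeriv_zero (Z U : L) : β.adPowDeriv Z U 0 = 0 := by
  simp [adPowDeriv]

set_option synthInstance.maxHeartbeats 200000 in
theorem adPowDeriv_succ (Z U : L) (k : ℕ) :
    β.adPowDeriv Z U (k + 1) = β.br U * β.br Z ^ k + β.br Z * β.adPowDeriv Z U k := by
  have h := (β.br.hasFDerivAt (x := Z)).mul' (β.differentiable_ad_pow k Z).hasFDerivAt
  simp only [adPowDeriv, pow_succ']
  rw [HasFDerivAt.fderiv (f := fun z => β.br z * β.br z ^ k) h]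
  simp [add_comm]

theorem adPowDeriv_eq_zero (Z U : L) {k : ℕ} (hk : β.cls ≤ k) : β.adPowDeriv Z U k = 0 := by
  have : (fun z => β.br z ^ k) = fun _ => 0 := by
    ext1 z; exact β.ad_pow_eq_zero z hk
  simp [adPowDeriv, this]

theorem fderiv_mc_apply (Z U V : L) :
    fderiv ℝ β.mc Z U V = β.mcCurve (fun k => β.adPowDeriv Z U k V) 1 := by
  have h : HasFDerivAt β.mc (∑ k ∈ Finset.range (β.cls + 1),
      (expQuotCoeff k : ℝ) • fderiv ℝ (fun z => β.br z ^ k) Z) Z :=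
    HasFDerivAt.fun_sum (u := Finset.range (β.cls + 1)) fun k _ =>
      ((β.differentiable_ad_pow k Z).hasFDerivAt.const_smul (expQuotCoeff k : ℝ))
  rw [h.fderiv]
  simp [mcCurve, adPowDeriv]

theorem hasDerivAt_mcCurve_adPowDeriv (Z U V : L) (t : ℝ) :
    HasDerivAt (β.mcCurve fun k => β.adPowDeriv Z U k V)
      (- β.br U (β.mcCurve (fun k => (β.br Z ^ k) V) t) -
        β.br Z (β.mcCurve (fun k => β.adPowDeriv Z U k V) t)) t := by
  have h := β.hasDerivAt_mcCurve (fun k => β.adPowDeriv Z U k V)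
    (by rw [β.adPowDeriv_eq_zero Z U (Nat.le_succ _)]; rfl) t
  rw [← mcCurve_map, ← mcCurve_map]
  convert h using 1
  simp only [adPowDeriv_succ, add_apply, mul_apply_eq_comp, adPowDeriv_zero, zero_apply,
    mcCurve_add]
  abel

/-- The Maurer-Cartan equation. -/
theorem maurerCartan (Z U V : L) :
    fderiv ℝ β.mc Z U V - fderiv ℝ β.mc Z V U = - β.br (β.mc Z U) (β.mc Z V) := by
  rw [fderiv_mc_apply, fderiv_mc_apply, ← mcCurve_ad_pow_one, ← mcCurve_ad_pow_one,
    ← sub_eq_zero, sub_neg_eq_add]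
  let A : L → ℝ → L := fun V => β.mcCurve fun k => (β.br Z ^ k) V
  let D : L → L → ℝ → L := fun U V => β.mcCurve fun k => β.adPowDeriv Z U k V
  change D U V 1 - D V U 1 + β.br (A U 1) (A V 1) = 0
  -- Inserting the scale t makes the defect of the Maurer-Cartan equation a curve u that starts at
  -- 0. By Jacobi it satisfies u' = −[Z, u], so it vanishes, in particular at t = 1.
  refine eq_zero_of_hasDerivAt_linear (- β.br Z)
    (u := fun t => D U V t - D V U t + β.br (A U t) (A V t)) (fun t => ?_) ?_ 1
  · have hb : HasDerivAt (fun t => β.br (A U t) (A V t))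
        (β.br (A U t) (V - β.br Z (A V t)) + β.br (U - β.br Z (A U t)) (A V t)) t :=
      ((β.br.hasFDerivAt.comp_hasDerivAt t (β.hasDerivAt_mcCurve_ad_pow Z U t)).clm_apply
        (β.hasDerivAt_mcCurve_ad_pow Z V t)).congr_deriv (by simp [A, add_comm])
    refine (((β.hasDerivAt_mcCurve_adPowDeriv Z U V t).sub
      (β.hasDerivAt_mcCurve_adPowDeriv Z V U t)).add hb).congr_deriv ?_
    change _ - (_ - β.br Z (D V U t)) + _ = _
    simp only [neg_apply, map_add, map_sub, sub_apply, β.jacobi Z (A U t) (A V t)]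
    change - β.br U (A V t) - β.br Z (D U V t) - (- β.br V (A U t) - β.br Z (D V U t)) + _ = _
    rw [β.skew (A U t) V]
    abel
  · simp [A, D, mcCurve]

theorem bch_smul_smul_real (X : L) (a b : ℝ) : β.bch (a • X) (b • X) = (a + b) • X := by
  have hd : ∀ t : ℝ, HasDerivAt (fun t : ℝ => (a + t * b) • X)
      (β.mcInv ((a + t * b) • X) (b • X)) t := by
    intro t
    have h : HasDerivAt (fun t : ℝ => (a + t * b) • X) (b • X) t := by
      simpa using (((hasDerivAt_id t).mul_const b).const_add a).smul_const X
    refine h.congr_deriv ?_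
    have h2 := β.mcInv_mc ((a + t * b) • X) X
    rw [mc_self] at h2
    rw [map_smul, h2]
  have h := eq_of_hasDerivAt_of_contDiff (v := fun x => β.mcInv x (b • X))
    (f := fun t : ℝ => β.bch (a • X) (t • (b • X))) (g := fun t : ℝ => (a + t * b) • X)
    (β.contDiff_mcInv.clm_apply contDiff_const) zero_le_one
    (fun t _ => β.hasDerivAt_bch_smul _ _ t) (fun t _ => hd t) (by simp [bch_zero_right])
  simpa using h

section FiniteDimensional

variable [FiniteDimensional ℝ L]

theorem contDiff_bch_left (X : L) {n : WithTop ℕ∞} : ContDiff ℝ n (β.bch X) :=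
  β.contDiff_bch.comp (contDiff_const.prodMk contDiff_id)

/-- In the radial direction, invariance is the differential equation that defines the product, read
at time 1. -/
theorem mc_fderiv_bch_self (X Y : L) : β.mc (β.bch X Y) (fderiv ℝ (β.bch X) Y Y) = Y := by
  have h1 := β.hasDerivAt_bch_smul X Y 1
  have h2 : HasDerivAt (fun s : ℝ => β.bch X (s • Y)) (fderiv ℝ (β.bch X) Y Y) 1 := by
    have h3 : HasFDerivAt (β.bch X) (fderiv ℝ (β.bch X) Y) ((1 : ℝ) • Y) := by
      rw [one_smul]
      exact ((β.contDiff_bch_left X).differentiable one_ne_zero Y).hasFDerivAt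
    have h4 : HasDerivAt (fun s : ℝ => s • Y) Y 1 := by
      simpa using (hasDerivAt_id (1 : ℝ)).smul_const Y
    exact h3.comp_hasDerivAt 1 h4
  rw [h2.unique h1, one_smul, mc_mcInv]

/-- Left translations preserve the Maurer-Cartan form. -/
theorem mc_fderiv_bch (X Y V : L) :
    β.mc (β.bch X Y) (fderiv ℝ (β.bch X) Y V) = β.mc Y V := by
  set f := β.bch X with hf
  have hfd : ∀ z, HasFDerivAt f (fderiv ℝ f z) z := fun z =>
    ((β.contDiff_bch_left X).differentiable one_ne_zero z).hasFDerivAt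
  have hff : ∀ z, HasFDerivAt (fderiv ℝ f) (fderiv ℝ (fderiv ℝ f) z) z := fun z =>
    (((β.contDiff_bch_left X (n := 2)).fderiv_right (m := 1) le_rfl).differentiable
      one_ne_zero z).hasFDerivAt
  have hmc : ∀ z, HasFDerivAt β.mc (fderiv ℝ β.mc z) z := fun z =>
    ((β.contDiff_mc (n := 1)).differentiable one_ne_zero z).hasFDerivAt
  have hsymm : ∀ z u v, fderiv ℝ (fderiv ℝ f) z u v = fderiv ℝ (fderiv ℝ f) z v u := fun z u v =>
    ((β.contDiff_bch_left X (n := 2)).contDiffAt.isSymmSndFDerivAt (by simp)).eq u v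
  let w : L → L := fun z => β.mc (f z) (fderiv ℝ f z V)
  have hw : ∀ z, HasFDerivAt w _ z := fun z =>
    ((hmc (f z)).comp z (hfd z)).clm_apply ((hff z).clm_apply (hasFDerivAt_const V z))
  -- Differentiate the radial identity mc(f z)(Df(z) z) = z in the direction V, and use symmetry of
  -- the second derivative and the Maurer-Cartan equation to exchange the roles of z and V.
  have key : ∀ z, fderiv ℝ w z z = V - w z - β.br z (w z) := by
    intro z
    have h1 : HasFDerivAt (fun z => β.mc (f z) (fderiv ℝ f z z)) _ z :=
      ((hmc (f z)).comp z (hfd z)).clm_apply ((hff z).clm_apply (hasFDerivAt_id z))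
    have h2 : (fun z => β.mc (f z) (fderiv ℝ f z z)) = id := by
      ext1 z; exact β.mc_fderiv_bch_self X z
    have h3 := congrArg (fun A : L →L[ℝ] L => A V) (h1.unique (h2 ▸ hasFDerivAt_id z))
    rw [(hw z).fderiv]
    have hM := β.maurerCartan (f z) (fderiv ℝ f z z) (fderiv ℝ f z V)
    rw [β.mc_fderiv_bch_self X z] at hM
    simp only [add_apply, ContinuousLinearMap.comp_apply, ContinuousLinearMap.flip_apply,
      zero_apply, map_zero, map_add, ContinuousLinearMap.id_apply, hsymm z V z,
      Function.comp_apply, zero_add] at h3 ⊢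
    rw [sub_eq_iff_eq_add] at hM
    rw [hM]
    change _ = V - β.mc (f z) (fderiv ℝ f z V) - β.br z (β.mc (f z) (fderiv ℝ f z V))
    conv_rhs => enter [1, 1]; rw [← h3]
    abel
  -- Along the ray through Y, `key` becomes v' = V − [Y, v], the same equation with the same initial
  -- value as for t • mc(tY) V.
  have hv : ∀ t : ℝ, HasDerivAt (fun t : ℝ => t • w (t • Y))
      (V - β.br Y (t • w (t • Y))) t := by
    intro t
    have h4 : HasDerivAt (fun s : ℝ => s • Y) Y t := by
      simpa using (hasDerivAt_id t).smul_const Y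
    have h5 := (hasDerivAt_id t).smul (((hw (t • Y)).differentiableAt.hasFDerivAt).comp_hasDerivAt t h4)
    refine h5.congr_deriv ?_
    have := key (t • Y)
    simp only [map_smul, smul_apply] at this
    simp only [id_eq, one_smul, Function.comp_apply, this, map_smul]
    abel
  have h6 := eq_zero_of_hasDerivAt_linear (- β.br Y)
    (u := fun t => t • w (t • Y) - β.mcCurve (fun k => (β.br Y ^ k) V) t)
    (fun t => ((hv t).sub (β.hasDerivAt_mcCurve_ad_pow Y V t)).congr_deriv (by simp))
    (by simp [mcCurve]) 1
  rw [mcCurve_ad_pow_one, one_smul, one_smul, sub_eq_zero] at h6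
  exact h6

/-- As functions of t, with tZ for Z, both sides solve γ' = mcInv(γ) Z from the same point: the left
by definition, the right because left translation by X preserves the Maurer-Cartan form. -/
theorem bch_assoc_real (X Y Z : L) : β.bch (β.bch X Y) Z = β.bch X (β.bch Y Z) := by
  have h := eq_of_hasDerivAt_of_contDiff (v := fun x => β.mcInv x Z)
    (f := fun t => β.bch (β.bch X Y) (t • Z)) (g := fun t => β.bch X (β.bch Y (t • Z)))
    (β.contDiff_mcInv.clm_apply contDiff_const) zero_le_one
    (fun t _ => β.hasDerivAt_bch_smul _ Z t) (fun t _ => ?_) (by simp [bch_zero_right])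
  · simpa using h
  · have h1 := ((β.contDiff_bch_left X (n := 1)).differentiable one_ne_zero
      (β.bch Y (t • Z))).hasFDerivAt.comp_hasDerivAt t (β.hasDerivAt_bch_smul Y Z t)
    refine h1.congr_deriv ?_
    rw [← β.mcInv_mc (β.bch X (β.bch Y (t • Z)))
      (fderiv ℝ (β.bch X) (β.bch Y (t • Z)) (β.mcInv (β.bch Y (t • Z)) Z)),
      mc_fderiv_bch, mc_mcInv]

end FiniteDimensional

end Real

/-! #### The group structure -/

section RCLike

variable {𝕜 : Type*} [RCLike 𝕜] {L : Type*} [NormedAddCommGroup L] [NormedSpace 𝕜 L]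
  (β : NilBracket 𝕜 L)

/-- Restriction of scalars of a nilpotent bracket. -/
def restrictReal [NormedSpace ℝ L] [IsScalarTower ℝ 𝕜 L] : NilBracket ℝ L where
  br := ((ContinuousLinearMap.restrictScalarsL 𝕜 L L ℝ ℝ).comp (β.br.restrictScalars ℝ))
  self x := β.self x
  jacobi x y z := β.jacobi x y z
  cls := β.cls
  nil := by
    have h : ∀ k, bracketLCS ((ContinuousLinearMap.restrictScalarsL 𝕜 L L ℝ ℝ).comp
        (β.br.restrictScalars ℝ)) k ≤ (bracketLCS β.br k).restrictScalars ℝ := by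
      intro k
      induction k with
      | zero => exact le_top
      | succ k ih =>
        rw [bracketLCS, Submodule.span_le]
        rintro z ⟨x, y, hy, rfl⟩
        exact Submodule.subset_span ⟨x, y, ih hy, rfl⟩
    have := h β.cls
    rw [β.nil] at this
    exact le_bot_iff.1 this

theorem restrictReal_bch [NormedSpace ℝ L] [IsScalarTower ℝ 𝕜 L] (X Y : L) :
    β.restrictReal.bch X Y = β.bch X Y :=
  β.restrictReal.bch_map β rfl (AddMonoidHom.id L)
    (fun q x => by
      rw [AddMonoidHom.id_apply, AddMonoidHom.id_apply, ← algebraMap_smul 𝕜 ((q : ℝ)) x]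
      simp) (fun _ _ => rfl) X Y

variable [FiniteDimensional 𝕜 L]

theorem bch_assoc (X Y Z : L) : β.bch (β.bch X Y) Z = β.bch X (β.bch Y Z) := by
  let := NormedSpace.restrictScalars ℝ 𝕜 L
  have : IsScalarTower ℝ 𝕜 L := IsScalarTower.of_algebraMap_smul fun _ _ => rfl
  have : FiniteDimensional ℝ L := FiniteDimensional.trans ℝ 𝕜 L
  simpa only [restrictReal_bch] using β.restrictReal.bch_assoc_real X Y Z

theorem bch_smul_smul (X : L) (a b : ℝ) :
    β.bch ((a : 𝕜) • X) ((b : 𝕜) • X) = ((a + b : ℝ) : 𝕜) • X := by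
  let := NormedSpace.restrictScalars ℝ 𝕜 L
  have : IsScalarTower ℝ 𝕜 L := IsScalarTower.of_algebraMap_smul fun _ _ => rfl
  have : FiniteDimensional ℝ L := FiniteDimensional.trans ℝ 𝕜 L
  have := β.restrictReal.bch_smul_smul_real X a b
  simpa only [restrictReal_bch, ← algebraMap_smul 𝕜 (_ : ℝ) X, RCLike.algebraMap_eq_ofReal]
    using this

theorem bch_zero_left (X : L) : β.bch 0 X = X := by
  simpa using β.bch_smul_smul X 0 1

theorem bch_nsmul_self (X : L) (s : ℕ) : β.bch (s • X) X = (s + 1) • X := by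
  have := β.bch_smul_smul X s 1
  simp only [RCLike.ofReal_natCast, RCLike.ofReal_one, one_smul] at this
  rw [← Nat.cast_smul_eq_nsmul 𝕜, this, ← Nat.cast_smul_eq_nsmul 𝕜]
  push_cast
  rfl

theorem bch_neg_left (X : L) : β.bch (-X) X = 0 := by
  simpa using β.bch_smul_smul X (-1) 1

end RCLike

end NilBracket

/-- The simply connected nilpotent group of a nilpotent bracket: the space itself, with the
Baker-Campbell-Hausdorff product. -/
def NilGroup {𝕜 : Type*} [RCLike 𝕜] {L : Type*} [NormedAddCommGroup L] [NormedSpace 𝕜 L]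
    (_ : NilBracket 𝕜 L) : Type _ := L

namespace NilGroup

variable {𝕜 : Type*} [RCLike 𝕜] {L : Type*} [NormedAddCommGroup L] [NormedSpace 𝕜 L]
  (β : NilBracket 𝕜 L)

/-- The exponential map. -/
def of : L ≃ NilGroup β := Equiv.refl L

/-- The logarithm. -/
def log : NilGroup β ≃ L := Equiv.refl L

instance : TopologicalSpace (NilGroup β) := inferInstanceAs (TopologicalSpace L)

instance : T2Space (NilGroup β) := inferInstanceAs (T2Space L)

instance : ChartedSpace L (NilGroup β) := inferInstanceAs (ChartedSpace L L)

theorem continuous_of : Continuous (of β) := continuous_id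

theorem continuous_log : Continuous (log β) := continuous_id

instance [FiniteDimensional 𝕜 L] : Group (NilGroup β) where
  mul X Y := of β (β.bch (log β X) (log β Y))
  one := of β 0
  inv X := of β (-log β X)
  mul_assoc X Y Z := β.bch_assoc X Y Z
  one_mul X := β.bch_zero_left X
  mul_one X := β.bch_zero_right X
  inv_mul_cancel X := β.bch_neg_left X

variable [FiniteDimensional 𝕜 L]

theorem of_mul (X Y : L) : of β X * of β Y = of β (β.bch X Y) := rfl

theorem of_zero : of β 0 = 1 := rfl

theorem of_nsmul (X : L) (m : ℕ) : of β (m • X) = of β X ^ m := by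
  induction m with
  | zero => rw [zero_smul, pow_zero, of_zero]
  | succ m ih => rw [pow_succ, ← ih, of_mul, β.bch_nsmul_self]

instance : IsTopologicalGroup (NilGroup β) where
  continuous_mul := (β.contDiff_bch (n := 0)).continuous
  continuous_inv := continuous_neg (G := L)

end NilGroup

/-! ### Integrating a frame of vector fields with nilpotent structure constants -/

section LocalODE

open Set Metric Filter Topology
open scoped NNReal

variable {E : Type*} [NormedAddCommGroup E] [NormedSpace ℝ E]

/-- A bump function replaces a locally defined frame by one with global bounds, so that integral
curves exist up to time 1 for every parameter. -/
theorem ContDiffOn.exists_contDiff_hasCompactSupport_eqOn_ball [FiniteDimensional ℝ E]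
    {W : Type*} [NormedAddCommGroup W] [NormedSpace ℝ W] {n : ℕ∞} {a : E → W} {U : Set E} {e : E}
    (hU : IsOpen U) (he : e ∈ U) (ha : ContDiffOn ℝ n a U) :
    ∃ r > 0, ball e r ⊆ U ∧ ∃ b : E → W, ContDiff ℝ n b ∧ HasCompactSupport b ∧
      EqOn b a (ball e r) := by
  obtain ⟨R, hR, hRU⟩ := Metric.isOpen_iff.1 hU e he
  let χ : ContDiffBump e := ⟨R / 3, R / 2, by positivity, by linarith⟩
  have hsub : closedBall e (R / 2) ⊆ U := (closedBall_subset_ball (by linarith)).trans hRU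
  refine ⟨R / 3, by positivity, (ball_subset_ball (by linarith)).trans hRU,
    fun x => χ x • a x, ?_, χ.hasCompactSupport.smul_right, fun x hx => ?_⟩
  · rw [contDiff_iff_contDiffAt]
    intro x
    by_cases hx : x ∈ U
    · exact χ.contDiff.contDiffAt.smul (ha.contDiffAt (hU.mem_nhds hx))
    · have hx' : x ∉ tsupport χ := by
        rw [χ.tsupport_eq]
        exact fun h => hx (hsub h)
      refine contDiffAt_const (c := (0 : W)) |>.congr_of_eventuallyEq ?_
      filter_upwards [notMem_tsupport_iff_eventuallyEq.1 hx'] with y hy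
      simp [hy]
  · have : χ x = 1 := χ.one_of_mem_closedBall (ball_subset_closedBall hx)
    simp [this]

theorem ContDiff.exists_taylor_bound {W : Type*} [NormedAddCommGroup W] [NormedSpace ℝ W]
    {b : E → W} (hb : ContDiff ℝ 2 b) (hc : HasCompactSupport b) :
    ∃ K : ℝ≥0, (∀ x, ‖b x‖ ≤ K) ∧ LipschitzWith K b ∧
      ∀ x w, ‖b (x + w) - b x - fderiv ℝ b x w‖ ≤ K * ‖w‖ ^ 2 := by
  obtain ⟨K₀, h₀⟩ := hc.exists_bound_of_continuous hb.continuous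
  obtain ⟨K₁, h₁⟩ := ContDiff.lipschitzWith_of_hasCompactSupport hc (hb.of_le one_le_two)
    one_ne_zero
  obtain ⟨K₂, h₂⟩ := ContDiff.lipschitzWith_of_hasCompactSupport (hc.fderiv ℝ)
    (hb.fderiv_right (m := 1) le_rfl) one_ne_zero
  refine ⟨K₀.toNNReal + K₁ + K₂, fun x => ?_, h₁.weaken ?_, fun x w => ?_⟩
  · refine (h₀ x).trans ((Real.le_coe_toNNReal K₀).trans ?_)
    push_cast
    linarith [K₁.coe_nonneg, K₂.coe_nonneg]
  · rw [add_right_comm]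
    exact le_add_self
  · have h3 : ‖b (x + w) - b x - fderiv ℝ b x ((x + w) - x)‖ ≤ (K₂ * ‖w‖) * ‖(x + w) - x‖ := by
      refine (convex_segment (𝕜 := ℝ) x (x + w)).norm_image_sub_le_of_norm_hasFDerivWithin_le'
        (f' := fderiv ℝ b)
        (fun y _ => ((hb.differentiable two_ne_zero) y).hasFDerivAt.hasFDerivWithinAt) ?_
        (left_mem_segment _ _ _) (right_mem_segment _ _ _)
      intro y hy
      refine (h₂.norm_sub_le y x).trans ?_
      gcongr
      have := norm_sub_le_of_mem_segment hy
      simpa using this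
    rw [add_sub_cancel_left] at h3
    refine h3.trans ?_
    rw [mul_assoc, ← sq]
    gcongr
    exact le_add_self

theorem LipschitzWith.exists_integralCurve_Icc [CompleteSpace E] {v : E → E} {K M : ℝ≥0}
    (hv : LipschitzWith K v) (hM : ∀ x, ‖v x‖ ≤ M) (e : E) :
    ∃ α : ℝ → E, α 0 = e ∧ (∀ t ∈ Icc (0 : ℝ) 1, HasDerivWithinAt α (v (α t)) (Icc 0 1) t) ∧
      ∀ t ∈ Icc (0 : ℝ) 1, ‖α t - e‖ ≤ M := by
  have h : IsPicardLindelof (fun _ x => v x) (tmin := 0) (tmax := 1) ⟨0, by simp⟩ e M 0 M K :=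
    IsPicardLindelof.of_time_independent (fun x _ => hM x) hv.lipschitzOnWith (by simp)
  obtain ⟨α, h0, hα⟩ := h.exists_eq_forall_mem_Icc_hasDerivWithinAt₀
  refine ⟨α, h0, hα, fun t ht => ?_⟩
  have := norm_image_sub_le_of_norm_deriv_le_segment' hα (fun t _ => hM (α t)) t ht
  simp only at h0
  rw [h0, sub_zero] at this
  exact this.trans (mul_le_of_le_one_right M.coe_nonneg ht.2)

theorem norm_le_gronwall_one {v : E → E} {K : ℝ≥0} (hv : LipschitzWith K v) {f f' g : ℝ → E}
    {ε : ℝ} (hf : ∀ t ∈ Icc (0 : ℝ) 1, HasDerivWithinAt f (f' t) (Icc 0 1) t)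
    (hfε : ∀ t ∈ Icc (0 : ℝ) 1, ‖f' t - v (f t)‖ ≤ ε)
    (hg : ∀ t ∈ Icc (0 : ℝ) 1, HasDerivWithinAt g (v (g t)) (Icc 0 1) t) (h0 : f 0 = g 0) :
    ‖f 1 - g 1‖ ≤ ε * Real.exp (K + 1) := by
  have hici : ∀ {u : ℝ → E} {u' : E} {t : ℝ}, t ∈ Ico (0 : ℝ) 1 →
      HasDerivWithinAt u u' (Icc 0 1) t → HasDerivWithinAt u u' (Ici t) t := fun ht h =>
    h.mono_of_mem_nhdsWithin (Icc_mem_nhdsGE_of_mem ht)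
  -- The Lipschitz constant is weakened to K + 1 so that Gronwall's bound can be used in its form
  -- for a nonzero constant.
  have h := dist_le_of_approx_trajectories_ODE (v := fun _ => v) (K := K + 1) (δ := 0) (εf := ε)
    (εg := 0) (f := f) (g := g) (a := 0) (b := 1) (f' := f') (g' := fun t => v (g t))
    (fun _ => hv.weaken le_self_add)
    (fun t ht => (hf t ht).continuousWithinAt)
    (fun t ht => hici ht (hf t (Ico_subset_Icc_self ht)))
    (fun t ht => by rw [dist_eq_norm]; exact hfε t (Ico_subset_Icc_self ht))
    (fun t ht => (hg t ht).continuousWithinAt)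
    (fun t ht => hici ht (hg t (Ico_subset_Icc_self ht)))
    (fun t _ => by simp) (by simp [h0]) 1 (by simp)
  have hε : 0 ≤ ε := (norm_nonneg _).trans (hfε 0 (by simp))
  rw [dist_eq_norm, gronwallBound_of_K_ne_0 (by positivity)] at h
  refine h.trans ?_
  simp only [zero_mul, add_zero, zero_add, sub_zero, mul_one, NNReal.coe_add, NNReal.coe_one]
  have h1 : ε / ((K : ℝ) + 1) ≤ ε := div_le_self hε (by linarith [K.coe_nonneg])
  have h2 : 0 ≤ ε / ((K : ℝ) + 1) := by positivity
  have h3 : 1 ≤ Real.exp ((K : ℝ) + 1) := Real.one_le_exp (by positivity)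
  nlinarith

variable [FiniteDimensional ℝ E] {L : Type*} [NormedAddCommGroup L] [NormedSpace ℝ L]

/-- A frame of vector fields with the structure constants of a nilpotent Lie algebra integrates
locally to a map that pulls back the dual coframe to the Maurer-Cartan form. -/
theorem NilBracket.exists_local_primitive (β : NilBracket ℝ L) {a : E → L →L[ℝ] E} {U : Set E}
    {e : E} (hU : IsOpen U) (he : e ∈ U) (ha : ContDiffOn ℝ ∞ a U)
    (hbr : ∀ x ∈ U, ∀ Y Z, fderiv ℝ a x (a x Y) Z - fderiv ℝ a x (a x Z) Y = a x (β.br Y Z)) :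
    ∃ δ > 0, ∃ F : L → E, F 0 = e ∧ (∀ Z ∈ ball 0 δ, F Z ∈ U) ∧
      (∀ Z ∈ ball 0 δ, HasFDerivAt F (a (F Z) ∘L β.mc Z) Z) ∧ ContDiffOn ℝ ∞ F (ball 0 δ) := by
  have : CompleteSpace E := FiniteDimensional.complete ℝ E
  obtain ⟨r, hr, hrU, b, hb, hbc, hab⟩ := ha.exists_contDiff_hasCompactSupport_eqOn_ball hU he
  have hb2 : ContDiff ℝ 2 b := mod_cast contDiff_infty.1 hb 2
  obtain ⟨K, hK0, hKL, hKT⟩ := hb2.exists_taylor_bound hbc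
  have hlip : ∀ Z : L, LipschitzWith (K * ‖Z‖₊) fun x => b x Z := fun Z =>
    LipschitzWith.of_dist_le_mul fun x y => by
      rw [dist_eq_norm, dist_eq_norm, ← sub_apply]
      refine ((b x - b y).le_opNorm Z).trans ?_
      have := hKL.norm_sub_le x y
      calc ‖b x - b y‖ * ‖Z‖ ≤ K * ‖x - y‖ * ‖Z‖ := by gcongr
        _ = _ := by push_cast; ring
  have hbd : ∀ (Z : L) x, ‖b x Z‖ ≤ (K * ‖Z‖₊ : ℝ≥0) := fun Z x => by
    refine ((b x).le_opNorm Z).trans ?_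
    push_cast
    gcongr
    exact hK0 x
  -- The primitive will be Z ↦ α Z 1, the exponential of the frame: follow the field x ↦ b x Z from
  -- e for unit time.
  choose α hα0 hα hαe using fun Z : L =>
    (hlip Z).exists_integralCurve_Icc (hbd Z) e
  -- A curve with parameter Z travels at most K‖Z‖, so for ‖Z‖ < δ it stays in the ball on which b
  -- agrees with the given frame.
  obtain ⟨δ, hδ, hδr⟩ : ∃ δ > 0, K * δ < r := ⟨r / (K + 1), by positivity, by
    rw [mul_div_assoc', div_lt_iff₀ (by positivity)]; nlinarith⟩
  have hmem : ∀ Z ∈ ball (0 : L) δ, ∀ t ∈ Icc (0 : ℝ) 1, α Z t ∈ ball e r := by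
    intro Z hZ t ht
    rw [mem_ball_zero_iff] at hZ
    rw [mem_ball, dist_eq_norm]
    refine (hαe Z t ht).trans_lt (lt_of_le_of_lt ?_ hδr)
    push_cast
    gcongr
  have hbr' : ∀ x ∈ ball e r, ∀ Y Z,
      fderiv ℝ b x (b x Y) Z - fderiv ℝ b x (b x Z) Y = b x (β.br Y Z) := by
    intro x hx Y Z
    have h1 : b =ᶠ[𝓝 x] a := hab.eventuallyEq_of_mem (isOpen_ball.mem_nhds hx)
    rw [h1.fderiv_eq, hab hx]
    exact hbr x (hrU hx) Y Z
  have h11 : (1 : ℝ) ∈ Icc (0 : ℝ) 1 := ⟨zero_le_one, le_rfl⟩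
  have hderiv : ∀ Z ∈ ball (0 : L) δ,
      HasFDerivAt (fun Z => α Z 1) (a (α Z 1) ∘L β.mc Z) Z := by
    intro Z hZ
    have hcont : Continuous fun t : ℝ => t • β.mc (t • Z) :=
      continuous_id.smul ((β.contDiff_mc (n := 0)).continuous.comp
        (continuous_id.smul continuous_const))
    obtain ⟨C, hC⟩ := isCompact_Icc.exists_bound_of_continuousOn (s := Icc (0 : ℝ) 1)
      hcont.continuousOn
    have hC0 : 0 ≤ C := (norm_nonneg _).trans (hC 1 h11)
    rw [hasFDerivAt_iff_isLittleO_nhds_zero]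
    -- The first variation x + b(x) v, with v = t mc(tZ) V, follows the field of Z + V up to an
    -- error of order ‖V‖². Gronwall compares it with the true curve, and at t = 1 it gives the
    -- claimed derivative.
    have hO : (fun V => α (Z + V) 1 - α Z 1 - (a (α Z 1) ∘L β.mc Z) V)
        =O[𝓝 0] fun V => ‖V‖ ^ 2 := by
      refine Asymptotics.IsBigO.of_bound
        ((K * (K * C) ^ 2 * ‖Z‖ + K * (K * C)) * Real.exp (K * (‖Z‖ + 1) + 1)) ?_
      filter_upwards [ball_mem_nhds (0 : L) one_pos] with V hV
      rw [mem_ball_zero_iff] at hV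
      let v : ℝ → L := β.mcCurve fun k => (β.br Z ^ k) V
      have hv : ∀ t ∈ Icc (0 : ℝ) 1, ‖v t‖ ≤ C * ‖V‖ := by
        intro t ht
        have : v t = (t • β.mc (t • Z)) V := β.mcCurve_ad_pow Z V t
        rw [this]
        exact (ContinuousLinearMap.le_opNorm _ _).trans (by gcongr; exact hC t ht)
      let x : ℝ → E := α Z
      have hw : ∀ t ∈ Icc (0 : ℝ) 1, ‖b (x t) (v t)‖ ≤ K * C * ‖V‖ := fun t ht => by
        refine ((b (x t)).le_opNorm _).trans ?_
        rw [mul_assoc]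
        gcongr
        · exact hK0 _
        · exact hv t ht
      -- The structure equation trades Db(bZ)v for Db(bv)Z + b[Z, v]; the last term cancels the −[Z,
      -- v] in v'. What remains is the linearization at x of the field of Z + V.
      have hy : ∀ t ∈ Icc (0 : ℝ) 1, HasDerivWithinAt (fun t => x t + b (x t) (v t))
          (b (x t) Z + fderiv ℝ b (x t) (b (x t) (v t)) Z + b (x t) V) (Icc 0 1) t := by
        intro t ht
        have h1 := ((hb2.differentiable two_ne_zero (x t)).hasFDerivAt.comp_hasDerivWithinAt t
          (hα Z t ht)).clm_apply (β.hasDerivAt_mcCurve_ad_pow Z V t).hasDerivWithinAt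
        refine ((hα Z t ht).add h1).congr_deriv ?_
        have h2 := hbr' (x t) (hmem Z hZ t ht) Z (v t)
        rw [sub_eq_iff_eq_add] at h2
        change b (x t) Z + (fderiv ℝ b (x t) (b (x t) Z) (v t) + b (x t) (V - β.br Z (v t))) = _
        rw [h2, map_sub]
        abel
      have hε : ∀ t ∈ Icc (0 : ℝ) 1,
          ‖(b (x t) Z + fderiv ℝ b (x t) (b (x t) (v t)) Z + b (x t) V)
            - b (x t + b (x t) (v t)) (Z + V)‖ ≤
          (K * (K * C) ^ 2 * ‖Z‖ + K * (K * C)) * ‖V‖ ^ 2 := by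
        intro t ht
        set w := b (x t) (v t) with hwdef
        have e1 : (b (x t) Z + fderiv ℝ b (x t) w Z + b (x t) V) - b (x t + w) (Z + V) =
            - ((b (x t + w) - b (x t) - fderiv ℝ b (x t) w) Z)
              - (b (x t + w) - b (x t)) V := by
          simp only [sub_apply, map_add]
          abel
        rw [e1]
        refine (norm_sub_le _ _).trans ?_
        rw [norm_neg]
        have e2 := (ContinuousLinearMap.le_opNorm (b (x t + w) - b (x t) - fderiv ℝ b (x t) w) Z)
        have e3 := (ContinuousLinearMap.le_opNorm (b (x t + w) - b (x t)) V)
        have e4 := hKT (x t) w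
        have e5 : ‖b (x t + w) - b (x t)‖ ≤ K * ‖w‖ := by
          simpa using hKL.norm_sub_le (x t + w) (x t)
        have e6 := hw t ht
        calc _ ≤ (K * ‖w‖ ^ 2) * ‖Z‖ + (K * ‖w‖) * ‖V‖ := by
              refine add_le_add (e2.trans ?_) (e3.trans ?_) <;> gcongr
          _ ≤ (K * (K * C * ‖V‖) ^ 2) * ‖Z‖ + (K * (K * C * ‖V‖)) * ‖V‖ := by gcongr
          _ = _ := by ring
      have hKZ : LipschitzWith (K * (‖Z‖₊ + 1)) fun x => b x (Z + V) :=
        (hlip (Z + V)).weaken (by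
          gcongr
          refine (nnnorm_add_le Z V).trans ?_
          gcongr
          exact_mod_cast hV.le)
      have hfin := norm_le_gronwall_one hKZ hy hε (hα (Z + V)) (by
        simp [x, v, hα0, NilBracket.mcCurve])
      have e7 : v 1 = β.mc Z V := β.mcCurve_ad_pow_one Z V
      have e8 : a (α Z 1) = b (α Z 1) := (hab (hmem Z hZ 1 h11)).symm
      have e9 : α (Z + V) 1 - α Z 1 - (a (α Z 1) ∘L β.mc Z) V =
          - (x 1 + b (x 1) (v 1) - α (Z + V) 1) := by
        rw [e7, e8]
        simp only [ContinuousLinearMap.comp_apply, x]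
        abel
      rw [e9, norm_neg, Real.norm_of_nonneg (by positivity)]
      refine hfin.trans (le_of_eq ?_)
      push_cast
      ring
    refine hO.trans_isLittleO ?_
    exact Asymptotics.isLittleO_norm_pow_id one_lt_two
  have hUF : ∀ Z ∈ ball (0 : L) δ, α Z 1 ∈ U := fun Z hZ => hrU (hmem Z hZ 1 h11)
  refine ⟨δ, hδ, fun Z => α Z 1, ?_, hUF, hderiv, ?_⟩
  · have := hαe 0 1 h11
    simp only [nnnorm_zero, mul_zero, NNReal.coe_zero] at this
    exact sub_eq_zero.1 (norm_le_zero_iff.1 this)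
  -- Bootstrap: the derivative is expressed through F, the smooth frame and the smooth form mc, so
  -- each order of regularity yields the next.
  · rw [contDiffOn_infty]
    intro n
    induction n with
    | zero =>
      exact contDiffOn_zero.2 fun Z hZ => (hderiv Z hZ).continuousAt.continuousWithinAt
    | succ n ih =>
      push_cast
      rw [contDiffOn_succ_iff_fderiv_of_isOpen isOpen_ball]
      refine ⟨fun Z hZ => (hderiv Z hZ).differentiableAt.differentiableWithinAt, by simp, ?_⟩
      refine ContDiffOn.congr ?_ fun Z hZ => (hderiv Z hZ).fderiv
      exact ((ha.of_le (by exact_mod_cast le_top)).comp ih hUF).clm_comp β.contDiff_mc.contDiffOn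

end LocalODE

/-! ### Left-invariant fields in the chart at the identity -/

section LeftFieldInChart

open Set Filter Topology VectorField

variable {E : Type*} [NormedAddCommGroup E] [NormedSpace ℝ E]
  {G : Type*} [TopologicalSpace G] [ChartedSpace E G] [Group G]

variable (G) in
/-- The chart of a Lie group at the identity. -/
def chartOne : PartialEquiv G E := extChartAt 𝓘(ℝ, E) (1 : G)

variable (G) in
/-- The product of a Lie group in the chart at the identity. -/
def chartMul (x y : E) : E :=
  chartOne G ((chartOne (E := E) G).symm x * (chartOne (E := E) G).symm y)

variable (G) in
/-- The left-invariant vector fields of a Lie group in the chart at the identity. -/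
def leftFieldInChart (x : E) : E →L[ℝ] E := fderiv ℝ (chartMul G x) (chartOne G 1)

theorem isOpen_chartOne_target : IsOpen (chartOne (E := E) G).target := isOpen_extChartAt_target _

theorem isOpen_chartOne_source : IsOpen (chartOne (E := E) G).source := isOpen_extChartAt_source _

theorem one_mem_chartOne_source : (1 : G) ∈ (chartOne (E := E) G).source :=
  mem_extChartAt_source _

theorem chartOne_one_mem_target : chartOne G (1 : G) ∈ (chartOne (E := E) G).target :=
  mem_extChartAt_target _

theorem chartOne_symm_one : (chartOne (E := E) G).symm (chartOne G 1) = 1 :=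
  (chartOne G).left_inv one_mem_chartOne_source

variable [LieGroup 𝓘(ℝ, E) ∞ G]

theorem contMDiffAt_chartOne {g : G} (hg : g ∈ (chartOne (E := E) G).source) :
    ContMDiffAt 𝓘(ℝ, E) 𝓘(ℝ, E) ∞ (chartOne (E := E) G) g :=
  contMDiffAt_extChartAt' (by rwa [chartOne, extChartAt_source] at hg)

theorem contMDiffAt_chartOne_symm {x : E} (hx : x ∈ (chartOne G).target) :
    ContMDiffAt 𝓘(ℝ, E) 𝓘(ℝ, E) ∞ (chartOne (E := E) G).symm x :=
  (contMDiffOn_extChartAt_symm (1 : G)).contMDiffAt (isOpen_chartOne_target.mem_nhds hx)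

theorem contDiffAt_chartMul {x y : E} (hx : x ∈ (chartOne G).target) (hy : y ∈ (chartOne G).target)
    (hxy : (chartOne (E := E) G).symm x * (chartOne (E := E) G).symm y ∈
      (chartOne (E := E) G).source) :
    ContDiffAt ℝ ∞ (fun p : E × E => chartMul G p.1 p.2) (x, y) := by
  rw [← contMDiffAt_iff_contDiffAt]
  have h1 : ContMDiffAt 𝓘(ℝ, E × E) 𝓘(ℝ, E) ∞
      (fun p : E × E => (chartOne (E := E) G).symm p.1) (x, y) :=
    (contMDiffAt_chartOne_symm hx).comp (x, y) contDiff_fst.contMDiff.contMDiffAt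
  have h2 : ContMDiffAt 𝓘(ℝ, E × E) 𝓘(ℝ, E) ∞
      (fun p : E × E => (chartOne (E := E) G).symm p.2) (x, y) :=
    (contMDiffAt_chartOne_symm hy).comp (x, y) contDiff_snd.contMDiff.contMDiffAt
  exact (contMDiffAt_chartOne hxy).comp (x, y) (h1.mul h2)

theorem contDiffOn_leftFieldInChart :
    ContDiffOn ℝ ∞ (leftFieldInChart (E := E) G) (chartOne G).target := by
  intro x hx
  have h : ContDiffAt ℝ ∞ (Function.uncurry fun x y : E => chartMul G x y) (x, chartOne G 1) := by
    refine contDiffAt_chartMul hx chartOne_one_mem_target ?_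
    rw [chartOne_symm_one, mul_one]
    exact (chartOne G).map_target hx
  exact (h.fderiv (g := fun _ => chartOne G 1) contDiffAt_const le_rfl).contDiffWithinAt

theorem mdifferentiableAt_left_mul (g h : G) :
    MDifferentiableAt 𝓘(ℝ, E) 𝓘(ℝ, E) (fun b => g * b) h :=
  (contMDiff_mul_left (I := 𝓘(ℝ, E)) (n := ∞)).mdifferentiableAt (by simp)

/-- This is the chain rule at the identity for left translation by g followed by the chart. -/
theorem mfderiv_chartOne_mulInvariantVectorField {x : E} (hx : x ∈ (chartOne G).target) (Y : E) :
    mfderiv 𝓘(ℝ, E) 𝓘(ℝ, E) (chartOne (E := E) G) ((chartOne (E := E) G).symm x)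
      (mulInvariantVectorField (I := 𝓘(ℝ, E)) (Y : GroupLieAlgebra 𝓘(ℝ, E) G)
        ((chartOne (E := E) G).symm x)) = leftFieldInChart G x Y := by
  set g := (chartOne (E := E) G).symm x with hg
  have hgs : g * 1 ∈ (chartOne (E := E) G).source := by
    rw [mul_one]; exact (chartOne G).map_target hx
  have h1 : MDifferentiableAt 𝓘(ℝ, E) 𝓘(ℝ, E) (chartOne (E := E) G) (g * 1) :=
    (contMDiffAt_chartOne hgs).mdifferentiableAt (by simp)
  have h2 := mfderiv_comp (1 : G) h1 (mdifferentiableAt_left_mul (E := E) g 1)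
  have h3 : mfderiv 𝓘(ℝ, E) 𝓘(ℝ, E) (chartOne (E := E) G ∘ fun b => g * b) (1 : G) =
      leftFieldInChart G x := by
    rw [(h1.comp (1 : G) (mdifferentiableAt_left_mul (E := E) g 1)).mfderiv]
    simp only [writtenInExtChartAt, extChartAt_model_space_eq_id, modelWithCornersSelf_coe, range_id,
      fderivWithin_univ]
    rfl
  have h4 : ∀ h : G, h = g → mfderiv 𝓘(ℝ, E) 𝓘(ℝ, E) (chartOne (E := E) G) g
      (mfderiv 𝓘(ℝ, E) 𝓘(ℝ, E) (fun b => g * b) (1 : G) Y : E) =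
      (mfderiv 𝓘(ℝ, E) 𝓘(ℝ, E) (chartOne (E := E) G) h
        (mfderiv 𝓘(ℝ, E) 𝓘(ℝ, E) (fun b => g * b) (1 : G) Y : E) : E) := by
    rintro _ rfl; rfl
  exact (h4 _ (mul_one g)).trans (DFunLike.congr_fun (h2.symm.trans h3) Y)

theorem mfderiv_chartOne_symm_comp {x : E} (hx : x ∈ (chartOne G).target) :
    (mfderiv 𝓘(ℝ, E) 𝓘(ℝ, E) (chartOne (E := E) G).symm x) ∘L
      (mfderiv 𝓘(ℝ, E) 𝓘(ℝ, E) (chartOne (E := E) G) ((chartOne (E := E) G).symm x)) =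
      ContinuousLinearMap.id ℝ _ := by
  have := mfderivWithin_extChartAt_symm_comp_mfderiv_extChartAt (I := 𝓘(ℝ, E)) (x := (1 : G)) hx
  rwa [modelWithCornersSelf_coe, range_id, mfderivWithin_univ] at this

theorem mfderiv_chartOne_comp_symm {x : E} (hx : x ∈ (chartOne G).target) :
    (mfderiv 𝓘(ℝ, E) 𝓘(ℝ, E) (chartOne (E := E) G) ((chartOne (E := E) G).symm x)) ∘L
      (mfderiv 𝓘(ℝ, E) 𝓘(ℝ, E) (chartOne (E := E) G).symm x) = ContinuousLinearMap.id ℝ _ := by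
  have := mfderiv_extChartAt_comp_mfderivWithin_extChartAt_symm (I := 𝓘(ℝ, E)) (x := (1 : G)) hx
  rwa [modelWithCornersSelf_coe, range_id, mfderivWithin_univ] at this

theorem mfderiv_chartOne_symm_leftFieldInChart {x : E} (hx : x ∈ (chartOne G).target) (Y : E) :
    mfderiv 𝓘(ℝ, E) 𝓘(ℝ, E) (chartOne (E := E) G).symm x (leftFieldInChart G x Y) =
      mulInvariantVectorField (I := 𝓘(ℝ, E)) (Y : GroupLieAlgebra 𝓘(ℝ, E) G)
        ((chartOne (E := E) G).symm x) := by
  rw [← mfderiv_chartOne_mulInvariantVectorField hx]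
  exact DFunLike.congr_fun (mfderiv_chartOne_symm_comp hx) _

theorem mpullback_mulInvariantVectorField_chartOne {x : E} (hx : x ∈ (chartOne G).target)
    (Y : GroupLieAlgebra 𝓘(ℝ, E) G) :
    mpullback 𝓘(ℝ, E) 𝓘(ℝ, E) (chartOne (E := E) G).symm
      (mulInvariantVectorField Y) x = leftFieldInChart G x Y := by
  rw [mpullback_apply,
    ContinuousLinearMap.inverse_eq (mfderiv_chartOne_symm_comp hx) (mfderiv_chartOne_comp_symm hx)]
  exact mfderiv_chartOne_mulInvariantVectorField hx Y

/-- The left side is the coordinate Lie bracket of two left-invariant fields read in the chart.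
Pullback by the inverse chart respects brackets, and the bracket of left-invariant fields is again
left-invariant. This is the hypothesis of `NilBracket.exists_local_primitive`. -/
theorem leftFieldInChart_bracket [CompleteSpace E] {x : E} (hx : x ∈ (chartOne G).target)
    (Y Z : GroupLieAlgebra 𝓘(ℝ, E) G) :
    fderiv ℝ (leftFieldInChart (E := E) G) x (leftFieldInChart G x Y) Z -
      fderiv ℝ (leftFieldInChart (E := E) G) x (leftFieldInChart G x Z) Y =
      leftFieldInChart G x (⁅Y, Z⁆ : GroupLieAlgebra 𝓘(ℝ, E) G) := by
  have hev : ∀ Y : GroupLieAlgebra 𝓘(ℝ, E) G,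
      mpullback 𝓘(ℝ, E) 𝓘(ℝ, E) (chartOne (E := E) G).symm (mulInvariantVectorField Y) =ᶠ[𝓝 x]
      fun x => leftFieldInChart G x Y := fun Y => by
    filter_upwards [isOpen_chartOne_target.mem_nhds hx] with y hy
    exact mpullback_mulInvariantVectorField_chartOne hy Y
  have hd : DifferentiableAt ℝ (leftFieldInChart (E := E) G) x :=
    (contDiffOn_leftFieldInChart.contDiffAt (isOpen_chartOne_target.mem_nhds hx)).differentiableAt
      (by simp)
  have hfd : ∀ Y V : E, fderiv ℝ (fun x => leftFieldInChart (E := E) G x Y) x V =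
      fderiv ℝ (leftFieldInChart (E := E) G) x V Y := fun Y V => by
    rw [fderiv_clm_apply hd (differentiableAt_const Y)]
    simp
  have h := mpullback_mlieBracket (n := ∞) (I := 𝓘(ℝ, E)) (I' := 𝓘(ℝ, E))
    (f := (chartOne (E := E) G).symm) (x₀ := x)
    (mdifferentiableAt_mulInvariantVectorField Y) (mdifferentiableAt_mulInvariantVectorField Z)
    (contMDiffAt_chartOne_symm hx) (by
      rw [minSmoothness_of_isRCLikeNormedField]; exact WithTop.coe_le_coe.2 (le_top : (2 : ℕ∞) ≤ ⊤))
  rw [← mulInvariantVector_mlieBracket, ← GroupLieAlgebra.bracket_def,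
    mpullback_mulInvariantVectorField_chartOne hx, (hev Y).mlieBracket_vectorField_eq (hev Z)] at h
  have hb : ∀ V W : (y : E) → TangentSpace 𝓘(ℝ, E) y,
      mlieBracket 𝓘(ℝ, E) V W x = lieBracket ℝ V W x := fun V W => by
    rw [← mlieBracketWithin_univ, mlieBracketWithin_eq_lieBracketWithin]
    exact congrFun lieBracketWithin_univ x
  refine Eq.trans ?_ ((hb _ _).symm.trans h.symm)
  exact congrArg₂ (· - ·) (hfd _ _).symm (hfd _ _).symm

end LeftFieldInChart

/-- The nilpotent bracket on a normed space that a linear isomorphism with a nilpotent Lie algebra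
induces. -/
def NilBracket.ofLie {𝕜 : Type*} [RCLike 𝕜] {𝔤 : Type*} [LieRing 𝔤] [LieAlgebra 𝕜 𝔤]
    {L : Type*} [NormedAddCommGroup L] [NormedSpace 𝕜 L] [FiniteDimensional 𝕜 L]
    (e : 𝔤 ≃ₗ[𝕜] L) (c : ℕ) (hc : LieModule.lowerCentralSeries 𝕜 𝔤 𝔤 c = ⊥) :
    NilBracket 𝕜 L where
  br := ((((LieModule.toEnd 𝕜 𝔤 𝔤 : 𝔤 →ₗ[𝕜] Module.End 𝕜 𝔤).compl₁₂ e.symm.toLinearMap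
    e.symm.toLinearMap).compr₂ e.toLinearMap)).toContinuousBilinearMap
  self x := by
    change e ⁅e.symm x, e.symm x⁆ = 0
    rw [lie_self, map_zero]
  jacobi x y z := by
    change e ⁅e.symm x, e.symm (e ⁅e.symm y, e.symm z⁆)⁆ =
      e ⁅e.symm (e ⁅e.symm x, e.symm y⁆), e.symm z⁆ + e ⁅e.symm y, e.symm (e ⁅e.symm x, e.symm z⁆)⁆
    simp only [e.symm_apply_apply, ← map_add, leibniz_lie (e.symm x)]
  cls := c
  nil := by
    have h : ∀ k, bracketLCS ((((LieModule.toEnd 𝕜 𝔤 𝔤 : 𝔤 →ₗ[𝕜] Module.End 𝕜 𝔤).compl₁₂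
        e.symm.toLinearMap e.symm.toLinearMap).compr₂ e.toLinearMap)).toContinuousBilinearMap k ≤
        (LieModule.lowerCentralSeries 𝕜 𝔤 𝔤 k).toSubmodule.map e.toLinearMap := by
      intro k
      induction k with
      | zero =>
        intro x _
        exact ⟨e.symm x, by simp, by simp⟩
      | succ k ih =>
        rw [bracketLCS, Submodule.span_le]
        rintro z ⟨x, y, hy, rfl⟩
        obtain ⟨y, hy', rfl⟩ := ih hy
        refine ⟨⁅e.symm x, y⁆, ?_, ?_⟩
        · rw [LieModule.lowerCentralSeries_succ]
          exact LieSubmodule.lie_mem_lie (LieSubmodule.mem_top _) hy'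
        · change e ⁅e.symm x, y⁆ = e ⁅e.symm x, e.symm (e y)⁆
          rw [e.symm_apply_apply]
    have := h c
    rw [hc] at this
    simpa using this

theorem NilBracket.ofLie_br {𝕜 : Type*} [RCLike 𝕜] {𝔤 : Type*} [LieRing 𝔤] [LieAlgebra 𝕜 𝔤]
    {L : Type*} [NormedAddCommGroup L] [NormedSpace 𝕜 L] [FiniteDimensional 𝕜 L]
    (e : 𝔤 ≃ₗ[𝕜] L) (c : ℕ) (hc : LieModule.lowerCentralSeries 𝕜 𝔤 𝔤 c = ⊥) (x y : L) :
    (NilBracket.ofLie e c hc).br x y = e ⁅e.symm x, e.symm y⁆ := rfl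

theorem NilBracket.mc_zero {𝕜 : Type*} [RCLike 𝕜] {L : Type*} [NormedAddCommGroup L]
    [NormedSpace 𝕜 L] (β : NilBracket 𝕜 L) : β.mc 0 = ContinuousLinearMap.id 𝕜 L := by
  ext V
  rw [mc, sum_apply, Finset.sum_eq_single 0]
  · simp [expQuotCoeff]
  · intro k _ hk
    simp [zero_pow hk]
  · simp

theorem ContinuousLinearMap.comp_smulRight_one {E F : Type*} [NormedAddCommGroup E]
    [NormedSpace ℝ E] [NormedAddCommGroup F] [NormedSpace ℝ F] (A : E →L[ℝ] F) {v : E} {w : F}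
    (h : A v = w) : A ∘L (1 : ℝ →L[ℝ] ℝ).smulRight v = (1 : ℝ →L[ℝ] ℝ).smulRight w := by
  ext; simp [h]

/-! ### The exponential map near the identity -/

section LocalExp

open Set Filter Topology Metric

variable {E : Type*} [NormedAddCommGroup E] [NormedSpace ℝ E]
  {G : Type*} [TopologicalSpace G] [ChartedSpace E G] [Group G]

variable (E G) in
/-- The Lie algebra of a Lie group, identified with the model space. -/
def lieModel : GroupLieAlgebra 𝓘(ℝ, E) G ≃ₗ[ℝ] E where
  toFun X := X
  invFun X := X
  map_add' _ _ := rfl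
  map_smul' _ _ := rfl

/-- The left-invariant vector field of an element of the model space. -/
def leftField (Y : E) (g : G) : TangentSpace 𝓘(ℝ, E) g :=
  mulInvariantVectorField ((lieModel E G).symm Y) g

theorem leftField_smul (c : ℝ) (Y : E) : (leftField (c • Y) : (g : G) → TangentSpace 𝓘(ℝ, E) g) =
    c • leftField Y :=
  mulInvariantVectorField_smul (I := 𝓘(ℝ, E)) c ((lieModel E G).symm Y)

theorem leftFieldInChart_one : leftFieldInChart G (chartOne G 1) = ContinuousLinearMap.id ℝ E := by
  have h : chartMul G (chartOne (E := E) G 1) =ᶠ[𝓝 (chartOne (E := E) G 1)] id := by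
    filter_upwards [isOpen_chartOne_target.mem_nhds chartOne_one_mem_target] with y hy
    rw [chartMul, chartOne_symm_one, one_mul, (chartOne G).right_inv hy, id]
  rw [leftFieldInChart, h.fderiv_eq, fderiv_id]

variable [LieGroup 𝓘(ℝ, E) ∞ G]

/-- A Lie algebra structure on the model space of a Lie group that is the one of the group. -/
def IsBracketOf [CompleteSpace E] (β : NilBracket ℝ E) (G : Type*) [TopologicalSpace G]
    [ChartedSpace E G] [Group G] [LieGroup 𝓘(ℝ, E) ∞ G] : Prop :=
  ∀ X Y : E, β.br X Y = lieModel E G ⁅(lieModel E G).symm X, (lieModel E G).symm Y⁆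

theorem contMDiff_leftField (Y : E) :
    ContMDiff 𝓘(ℝ, E) 𝓘(ℝ, E).tangent 1
      (fun g : G => (⟨g, leftField Y g⟩ : TangentBundle 𝓘(ℝ, E) G)) :=
  (contMDiff_mulInvariantVectorField (I := 𝓘(ℝ, E)) (G := G) ((lieModel E G).symm Y)).of_le
    (by rw [minSmoothness_of_isRCLikeNormedField]; exact one_le_two)

theorem leftField_mul (Y : E) (g h : G) :
    leftField Y (g * h) = mfderiv 𝓘(ℝ, E) 𝓘(ℝ, E) (fun b => g * b) h (leftField Y h) := by
  have h1 : (fun b => g * h * b) = (fun b => g * b) ∘ fun b => h * b := by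
    ext b; simp [mul_assoc]
  have h2 := mfderiv_comp_of_eq (I := 𝓘(ℝ, E)) (I' := 𝓘(ℝ, E)) (I'' := 𝓘(ℝ, E))
    (x := (1 : G)) (mdifferentiableAt_left_mul (E := E) g h) (mdifferentiableAt_left_mul (E := E) h 1)
    (mul_one h)
  rw [← h1] at h2
  have h3 : ∀ h' : G, h' = h → (mfderiv 𝓘(ℝ, E) 𝓘(ℝ, E) (fun b => g * b) h'
      (mfderiv 𝓘(ℝ, E) 𝓘(ℝ, E) (fun b => h * b) (1 : G) Y : E) : E) =
      mfderiv 𝓘(ℝ, E) 𝓘(ℝ, E) (fun b => g * b) h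
        (mfderiv 𝓘(ℝ, E) 𝓘(ℝ, E) (fun b => h * b) (1 : G) Y : E) := by
    rintro _ rfl; rfl
  exact (DFunLike.congr_fun h2 ((lieModel E G).symm Y)).trans (h3 _ (mul_one h))

/-- Left translates of tangent vectors to left-invariant fields. -/
theorem HasMFDerivAt.left_mul {γ : ℝ → G} {t : ℝ} {Y : E} (g : G)
    (h : HasMFDerivAt 𝓘(ℝ, ℝ) 𝓘(ℝ, E) γ t ((1 : ℝ →L[ℝ] ℝ).smulRight (leftField Y (γ t)))) :
    HasMFDerivAt 𝓘(ℝ, ℝ) 𝓘(ℝ, E) (fun t => g * γ t) t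
      ((1 : ℝ →L[ℝ] ℝ).smulRight (leftField Y (g * γ t))) := by
  have h1 := (mdifferentiableAt_left_mul (E := E) g (γ t)).hasMFDerivAt.comp t h
  exact h1.congr_mfderiv (ContinuousLinearMap.comp_smulRight_one (E := E) (F := E) _
    (leftField_mul Y g (γ t)).symm)

variable [FiniteDimensional ℝ E] [CompleteSpace E] {β : NilBracket ℝ E}

/-- The local primitive of the left-invariant frame is a candidate for the exponential. Its
differential is recorded along curves c in the Lie algebra: the velocity is the left-invariant field
of mc(c) c', so solutions of γ' = mcInv(γ) Y go to integral curves. -/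
theorem IsBracketOf.exists_local_exp (hβ : IsBracketOf β G) :
    ∃ δ > 0, ∃ f : E → G, f 0 = 1 ∧ (∀ Z ∈ ball (0 : E) δ, f Z ∈ (chartOne (E := E) G).source) ∧
      ContDiffOn ℝ ∞ (chartOne (E := E) G ∘ f) (ball 0 δ) ∧
      (HasFDerivAt (chartOne (E := E) G ∘ f) (ContinuousLinearMap.id ℝ E) 0) ∧
      ∀ Z ∈ ball (0 : E) δ, ∀ V : E, ∀ c : ℝ → E, ∀ t, c t = Z → HasDerivAt c V t →
        HasMFDerivAt 𝓘(ℝ, ℝ) 𝓘(ℝ, E) (f ∘ c) t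
          ((1 : ℝ →L[ℝ] ℝ).smulRight (leftField (β.mc Z V) (f (c t)))) := by
  obtain ⟨δ, hδ, F, h0, hU, hd, hs⟩ := β.exists_local_primitive (L := E)
    (a := leftFieldInChart (E := E) G) isOpen_chartOne_target chartOne_one_mem_target
    contDiffOn_leftFieldInChart (fun x hx Y Z => by
      rw [hβ]
      exact leftFieldInChart_bracket hx _ _)
  refine ⟨δ, hδ, fun Z => (chartOne (E := E) G).symm (F Z), ?_, fun Z hZ => ?_, ?_, ?_, ?_⟩
  · simp only [h0, chartOne_symm_one]
  · exact (chartOne G).map_target (hU Z hZ)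
  · exact hs.congr fun Z hZ => (chartOne G).right_inv (hU Z hZ)
  · have h1 := hd 0 (mem_ball_self hδ)
    rw [h0, leftFieldInChart_one, β.mc_zero, ContinuousLinearMap.id_comp] at h1
    refine h1.congr_of_eventuallyEq ?_
    filter_upwards [ball_mem_nhds 0 hδ] with Z hZ
    exact (chartOne G).right_inv (hU Z hZ)
  · rintro Z hZ V c t rfl hc
    have h1 : HasMFDerivAt 𝓘(ℝ, ℝ) 𝓘(ℝ, E) (F ∘ c) t _ :=
      ((hd _ hZ).comp_hasDerivAt t hc).hasFDerivAt.hasMFDerivAt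
    rw [← ContinuousLinearMap.smulRight_one_eq_toSpanSingleton] at h1
    have h2 := ((contMDiffAt_chartOne_symm (G := G) (hU _ hZ)).mdifferentiableAt
      (by simp)).hasMFDerivAt.comp t h1
    exact h2.congr_mfderiv (ContinuousLinearMap.comp_smulRight_one (E := E) (F := E) _
      (mfderiv_chartOne_symm_leftFieldInChart (hU _ hZ) _))

end LocalExp

/-! ### From local to global homomorphisms -/

section Globalize

open Filter Topology

theorem NilGroup.of_log {𝕜 : Type*} [RCLike 𝕜] {L : Type*} [NormedAddCommGroup L]
    [NormedSpace 𝕜 L] {β : NilBracket 𝕜 L} (x : NilGroup β) :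
    NilGroup.of β (NilGroup.log β x) = x := rfl

variable {L : Type*} [NormedAddCommGroup L] [NormedSpace ℝ L] [FiniteDimensional ℝ L]
  {β : NilBracket ℝ L} {H : Type*} [Group H] {ψ : NilGroup β → H}

/-- A map that is multiplicative near the identity and compatible with powers is multiplicative for
a right factor near the identity. -/
theorem NilGroup.eventually_mul_of_pow (hpow : ∀ x (m : ℕ), ψ (x ^ m) = ψ x ^ m)
    {B : Set (NilGroup β)} (hB : B ∈ 𝓝 1) (hmul : ∀ x ∈ B, ∀ y ∈ B, ψ (x * y) = ψ x * ψ y)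
    (x : NilGroup β) : ∀ᶠ w in 𝓝 1, ψ (x * w) = ψ x * ψ w := by
  -- Choose m so large that the m-th root a of x lies in the interior of B; for w near 1 the m-th
  -- root of x * w then lies in B as well.
  obtain ⟨m, hm, hm0⟩ : ∃ m : ℕ, of β ((m : ℝ)⁻¹ • log β x) ∈ interior B ∧ m ≠ 0 := by
    have h1 : Tendsto (fun m : ℕ => of β ((m : ℝ)⁻¹ • log β x)) atTop (𝓝 1) := by
      have : Tendsto (fun m : ℕ => (m : ℝ)⁻¹ • log β x) atTop (𝓝 ((0 : ℝ) • log β x)) :=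
        (tendsto_inv_atTop_nhds_zero_nat (𝕜 := ℝ)).smul_const _
      rw [zero_smul] at this
      exact ((continuous_of β).tendsto 0).comp this
    exact ((h1.eventually (interior_mem_nhds.2 hB)).and (eventually_ne_atTop 0)).exists
  set a := of β ((m : ℝ)⁻¹ • log β x) with ha
  have hmr : (m : ℝ) ≠ 0 := by exact_mod_cast hm0
  have hpow_root : ∀ y : NilGroup β, of β ((m : ℝ)⁻¹ • log β y) ^ m = y := fun y => by
    rw [← of_nsmul, ← Nat.cast_smul_eq_nsmul ℝ, smul_smul, mul_inv_cancel₀ hmr, one_smul, of_log]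
  have ham : a ^ m = x := hpow_root x
  let y : NilGroup β → NilGroup β := fun w => of β ((m : ℝ)⁻¹ • log β (x * w))
  have hyc : Continuous y := (continuous_of β).comp
    (((continuous_log β).comp (continuous_const.mul continuous_id)).const_smul _)
  have hy1 : y 1 = a := by simp [y, ha]
  have hym : ∀ w, y w ^ m = x * w := fun w => hpow_root _
  -- The quotients a⁻ʲ yʲ all equal 1 at w = 1, so for finitely many j they remain in B; the one
  -- with j = m is w itself.
  let u : ℕ → NilGroup β → NilGroup β := fun j w => (a ^ j)⁻¹ * y w ^ j
  have hu : ∀ j, Continuous (u j) := fun j => continuous_const.mul (hyc.pow j)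
  have h1 : ∀ᶠ w in 𝓝 1, y w ∈ B := by
    refine (hyc.tendsto 1).eventually ?_
    rw [hy1]
    exact mem_interior_iff_mem_nhds.1 hm
  have h2 : ∀ᶠ w in 𝓝 1, ∀ j ∈ Set.Iic m, u j w ∈ B := by
    refine (eventually_all_finite (Set.finite_Iic m)).2 fun j _ => ((hu j).tendsto 1).eventually ?_
    simp only [u, hy1, inv_mul_cancel]
    exact hB
  filter_upwards [h1, h2] with w hw1 hw2
  -- The relation u_j y = a u_{j+1} involves only elements of B, so ψ may be applied factor by
  -- factor. At j = m, compatibility with powers gives the claim.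
  have key : ∀ j ≤ m, ψ (y w) ^ j = ψ a ^ j * ψ (u j w) := by
    intro j
    induction j with
    | zero =>
      intro _
      simpa [u] using (hpow 1 0).symm
    | succ j ih =>
      intro hj
      have h3 : u j w * y w = a * u (j + 1) w := by
        simp only [u, pow_succ]
        group
      rw [pow_succ, ih (by omega), mul_assoc, ← hmul _ (hw2 j (by simp; omega)) _ hw1, h3,
        hmul _ (interior_subset hm) _ (hw2 (j + 1) hj), pow_succ, mul_assoc]
  have h4 := key m le_rfl
  rw [← hpow, ← hpow, hym, ham] at h4
  simpa [u, hym, ham] using h4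

/-- A map of a simply connected nilpotent group that is multiplicative near the identity and
compatible with powers is a homomorphism. -/
theorem NilGroup.map_mul_of_pow (hpow : ∀ x (m : ℕ), ψ (x ^ m) = ψ x ^ m)
    {B : Set (NilGroup β)} (hB : B ∈ 𝓝 1) (hmul : ∀ x ∈ B, ∀ y ∈ B, ψ (x * y) = ψ x * ψ y)
    (x y : NilGroup β) : ψ (x * y) = ψ x * ψ y := by
  let p : ℝ → NilGroup β := fun t => of β (t • log β y)
  have hp : ∀ s t, p (s + t) = p s * p t := fun s t => by
    simp only [p, of_mul]
    exact congrArg (of β) (β.bch_smul_smul (log β y) s t).symm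
  have hpc : Continuous p := (continuous_of β).comp (continuous_id.smul continuous_const)
  have hp0 : p 0 = 1 := by simp [p, of_zero]
  have hp1 : p 1 = y := by simp [p, of_log]
  -- Move y to 1 along its one-parameter group. The local statement makes h locally constant, hence
  -- constant on ℝ.
  let h : ℝ → H := fun t => ψ (x * p t) * (ψ (p t))⁻¹
  have hloc : IsLocallyConstant h := by
    refine (IsLocallyConstant.iff_eventually_eq h).2 fun t => ?_
    have hc : Tendsto (fun s => p (s - t)) (𝓝 t) (𝓝 1) := by
      have : Continuous fun s => p (s - t) := hpc.comp (continuous_id.sub continuous_const)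
      simpa [hp0] using this.tendsto t
    filter_upwards [hc.eventually (eventually_mul_of_pow hpow hB hmul (x * p t)),
      hc.eventually (eventually_mul_of_pow hpow hB hmul (p t))] with s h1 h2
    have h3 : p s = p t * p (s - t) := by rw [← hp]; congr 1; ring
    simp only [h]
    rw [h3, h2, ← mul_assoc, h1]
    group
  have h01 := hloc.apply_eq_of_isPreconnected isPreconnected_univ (Set.mem_univ 1) (Set.mem_univ 0)
  simp only [h, hp0, hp1, mul_one] at h01
  have h1 : ψ 1 = 1 := by simpa using hpow 1 0
  rw [h1, inv_one, mul_one] at h01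
  rw [← h01]
  group

end Globalize

/-! ### Homomorphisms onto simply connected groups -/

section CoveringHom

open Topology

/-- A surjective open homomorphism with discrete kernel onto a simply connected group is
injective. -/
theorem MonoidHom.injective_of_isDiscrete_ker {N G : Type*} [Group N] [TopologicalSpace N]
    [IsTopologicalGroup N] [T2Space N] [PreconnectedSpace N] [Group G] [TopologicalSpace G]
    [SimplyConnectedSpace G] [LocallyPathConnectedSpace G]
    (f : N →* G) (hc : Continuous f) (ho : IsOpenMap f) (hs : Function.Surjective f)
    (hd : IsDiscrete (f.ker : Set N)) : Function.Injective f := by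
  have hcov := ((ho.isQuotientMap hc hs).isQuotientCoveringMap_of_isDiscrete_ker_monoidHom
    hd).isCoveringMap
  obtain ⟨F, ⟨hF1, hF⟩, -⟩ := hcov.existsUnique_continuousMap_lifts (ContinuousMap.id G) 1 1
    (by simp)
  -- Both sides lift f through the covering f and agree at 1; as the source is connected, the lift F
  -- of the identity is a left inverse of f.
  have h2 : (fun x => F (f x)) = _root_.id := by
    refine hcov.eq_of_comp_eq (F.continuous.comp hc) continuous_id ?_ 1 ?_
    · ext x
      exact congrFun hF (f x)
    · simp [hF1]
  exact Function.LeftInverse.injective (g := F) fun x => congrFun h2 x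

end CoveringHom

/-! ### The exponential map and the product near the identity -/

section LieExp

open Set Filter Topology Metric

variable {E : Type*} [NormedAddCommGroup E] [NormedSpace ℝ E]
  {G : Type*} [TopologicalSpace G] [ChartedSpace E G] [Group G] [LieGroup 𝓘(ℝ, E) ∞ G]
  [T2Space G]

variable (G) in
/-- The exponential map of a Lie group on the model space. -/
def modelExp (Y : E) : G := lieExp ((lieModel E G).symm Y)

theorem modelExp_eq_of_isMIntegralCurve [CompleteSpace E] {Y : E} {γ : ℝ → G} (h0 : γ 0 = 1)
    (hγ : IsMIntegralCurve (I := 𝓘(ℝ, E)) γ (leftField Y)) : modelExp G Y = γ 1 := by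
  have h : ∃ γ : ℝ → G, γ 0 = 1 ∧ IsMIntegralCurve (I := 𝓘(ℝ, E)) γ
      (mulInvariantVectorField ((lieModel E G).symm Y)) := ⟨γ, h0, hγ⟩
  rw [modelExp, lieExp, dif_pos h]
  refine congrFun (isMIntegralCurve_Ioo_eq_of_contMDiff_boundaryless (I := 𝓘(ℝ, E)) (t₀ := 0)
    (contMDiff_leftField Y) h.choose_spec.2 hγ ?_) 1
  rw [h0, h.choose_spec.1]

variable [FiniteDimensional ℝ E] [CompleteSpace E] {β : NilBracket ℝ E}

theorem IsBracketOf.exists_isMIntegralCurve (hβ : IsBracketOf β G) (Y : E) (g : G) :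
    ∃ γ : ℝ → G, γ 0 = g ∧ IsMIntegralCurve (I := 𝓘(ℝ, E)) γ (leftField Y) := by
  obtain ⟨δ, hδ, f, hf0, -, -, -, hf⟩ := hβ.exists_local_exp
  have hε : 0 < δ / (‖Y‖ + 1) := by positivity
  -- Left translates of one local curve serve every starting point with the same existence time, so
  -- integral curves extend to all of ℝ.
  refine exists_isMIntegralCurve_of_isMIntegralCurveOn (contMDiff_leftField Y) hε
    (fun g => ⟨fun t => g * f (t • Y), by simp [hf0], fun t ht => ?_⟩) g
  refine (HasMFDerivAt.left_mul g (γ := fun t => f (t • Y)) ?_).hasMFDerivWithinAt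
  have hc : HasDerivAt (fun t : ℝ => t • Y) Y t := by
    simpa using (hasDerivAt_id t).smul_const Y
  have hmem : t • Y ∈ ball (0 : E) δ := by
    rw [mem_ball_zero_iff, norm_smul, Real.norm_eq_abs]
    have h1 := abs_lt.2 ht
    rw [lt_div_iff₀ (by positivity)] at h1
    nlinarith [abs_nonneg t, norm_nonneg Y]
  have h1 := hf _ hmem Y (fun t : ℝ => t • Y) t rfl hc
  rwa [β.mc_self] at h1

theorem IsBracketOf.isMIntegralCurve_modelExp (hβ : IsBracketOf β G) (Y : E) :
    IsMIntegralCurve (I := 𝓘(ℝ, E)) (fun t : ℝ => modelExp G (t • Y)) (leftField Y) := by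
  obtain ⟨γ, h0, hγ⟩ := hβ.exists_isMIntegralCurve Y 1
  have h : (fun t : ℝ => modelExp G (t • Y)) = γ := by
    ext t
    have h1 := hγ.comp_mul t
    rw [← leftField_smul] at h1
    rw [modelExp_eq_of_isMIntegralCurve (by simp [h0]) h1]
    simp
  rwa [h]

theorem IsBracketOf.modelExp_zero (hβ : IsBracketOf β G) : modelExp G (0 : E) = 1 := by
  obtain ⟨γ, h0, hγ⟩ := hβ.exists_isMIntegralCurve (0 : E) 1
  have h1 := hγ.comp_mul 0
  rw [← leftField_smul, zero_smul] at h1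
  rw [modelExp_eq_of_isMIntegralCurve (by simp [h0]) h1]
  simp [h0]

theorem IsBracketOf.isMIntegralCurve_mul_modelExp (hβ : IsBracketOf β G) (g : G) (Y : E) :
    IsMIntegralCurve (I := 𝓘(ℝ, E)) (fun t : ℝ => g * modelExp G (t • Y)) (leftField Y) :=
  fun t => (hβ.isMIntegralCurve_modelExp Y t).left_mul g

theorem IsBracketOf.modelExp_add (hβ : IsBracketOf β G) (s t : ℝ) (Y : E) :
    modelExp G ((s + t) • Y) = modelExp G (s • Y) * modelExp G (t • Y) := by
  have h1 := (hβ.isMIntegralCurve_modelExp Y).comp_add s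
  have h2 := hβ.isMIntegralCurve_mul_modelExp (modelExp G (s • Y)) Y
  have h3 := congrFun (isMIntegralCurve_Ioo_eq_of_contMDiff_boundaryless (I := 𝓘(ℝ, E)) (t₀ := 0)
    (contMDiff_leftField Y) h1 h2 (by simp [hβ.modelExp_zero])) t
  simpa [add_comm] using h3

theorem IsBracketOf.modelExp_nsmul (hβ : IsBracketOf β G) (Y : E) (m : ℕ) :
    modelExp G (m • Y) = modelExp G Y ^ m := by
  induction m with
  | zero => rw [zero_smul, pow_zero, hβ.modelExp_zero]
  | succ m ih =>
    have := hβ.modelExp_add m 1 Y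
    rw [one_smul, Nat.cast_smul_eq_nsmul, ih, ← pow_succ] at this
    rw [← this, ← Nat.cast_smul_eq_nsmul ℝ]
    push_cast
    rfl

/-- Near the identity, the exponential map is smooth, invertible, and multiplicative for the
Baker-Campbell-Hausdorff product. -/
theorem IsBracketOf.modelExp_local (hβ : IsBracketOf β G) :
    (∀ᶠ Z in 𝓝 (0 : E), modelExp G Z ∈ (chartOne (E := E) G).source) ∧
    ContDiffAt ℝ ∞ (chartOne (E := E) G ∘ modelExp G) (0 : E) ∧
    HasFDerivAt (chartOne (E := E) G ∘ modelExp G) (ContinuousLinearMap.id ℝ E) (0 : E) ∧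
    ∃ r > 0, ∀ X ∈ ball (0 : E) r, ∀ Y ∈ ball (0 : E) r,
      modelExp G (β.bch X Y) = modelExp G X * modelExp G Y := by
  obtain ⟨δ, hδ, f, hf0, hfs, hfd, hf1, hf⟩ := hβ.exists_local_exp
  have heq : ∀ Z ∈ ball (0 : E) δ, modelExp G Z = f Z := by
    intro Z hZ
    rw [mem_ball_zero_iff] at hZ
    -- The number a is chosen with a > 1 and a‖Z‖ < δ: the ray tZ stays in the ball on an open
    -- interval that contains t = 1.
    have ha : 1 < 1 + (δ - ‖Z‖) / (‖Z‖ + 1) := by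
      have : 0 < (δ - ‖Z‖) / (‖Z‖ + 1) := div_pos (by linarith) (by positivity)
      linarith
    set a := 1 + (δ - ‖Z‖) / (‖Z‖ + 1) with ha'
    have haZ : a * (‖Z‖ + 1) = 1 + δ := by
      rw [ha']; field_simp; ring
    have h1 : IsMIntegralCurveOn (I := 𝓘(ℝ, E)) (fun t : ℝ => f (t • Z)) (leftField Z)
        (Ioo (-a) a) := by
      intro t ht
      have hc : HasDerivAt (fun t : ℝ => t • Z) Z t := by
        simpa using (hasDerivAt_id t).smul_const Z
      have hmem : t • Z ∈ ball (0 : E) δ := by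
        rw [mem_ball_zero_iff, norm_smul, Real.norm_eq_abs]
        have h2 := abs_lt.2 ht
        nlinarith [abs_nonneg t, norm_nonneg Z]
      have h2 := hf _ hmem Z (fun t : ℝ => t • Z) t rfl hc
      rw [β.mc_self] at h2
      exact h2.hasMFDerivWithinAt
    have h2 := isMIntegralCurveOn_Ioo_eqOn_of_contMDiff_boundaryless (I := 𝓘(ℝ, E)) (t₀ := 0)
      (by constructor <;> linarith) (contMDiff_leftField Z)
      ((hβ.isMIntegralCurve_modelExp Z).isMIntegralCurveOn _) h1 (by simp [hf0, hβ.modelExp_zero])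
      (show (1 : ℝ) ∈ Ioo (-a) a by constructor <;> linarith)
    simpa using h2
  have hev : chartOne (E := E) G ∘ modelExp G =ᶠ[𝓝 0] chartOne (E := E) G ∘ f := by
    filter_upwards [ball_mem_nhds 0 hδ] with Z hZ
    simp [heq Z hZ]
  refine ⟨?_, ?_, ?_, ?_⟩
  · filter_upwards [ball_mem_nhds 0 hδ] with Z hZ
    rw [heq Z hZ]
    exact hfs Z hZ
  · exact (hfd.contDiffAt (ball_mem_nhds 0 hδ)).congr_of_eventuallyEq hev
  · exact hf1.congr_of_eventuallyEq hev
  · have hcont : ContinuousAt (fun p : E × E => β.bch p.1 p.2) (0, 0) :=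
      (β.contDiff_bch (n := 0)).continuous.continuousAt
    have h0 : β.bch (0 : E) 0 = 0 := β.bch_zero_right 0
    have h1 : ∀ᶠ p : E × E in 𝓝 (0, 0), β.bch p.1 p.2 ∈ ball (0 : E) δ :=
      hcont.preimage_mem_nhds (by
        change ball 0 δ ∈ 𝓝 (β.bch 0 0)
        rw [h0]
        exact ball_mem_nhds 0 hδ)
    obtain ⟨r, hr, hball⟩ := Metric.eventually_nhds_iff_ball.1 h1
    -- Half the radius leaves room for |t| < 2, so that t = 1 is interior to the interval on which
    -- curves are compared.
    refine ⟨r / 2, by positivity, fun X hX Y hY => ?_⟩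
    have hmem : ∀ t ∈ Ioo (-2 : ℝ) 2, β.bch X (t • Y) ∈ ball (0 : E) δ := by
      intro t ht
      refine hball (X, t • Y) ?_
      rw [mem_ball_zero_iff] at hX hY
      rw [← Prod.zero_eq_mk, mem_ball_zero_iff, Prod.norm_def, max_lt_iff, norm_smul,
        Real.norm_eq_abs]
      have := abs_lt.2 ht
      exact ⟨by linarith, by nlinarith [abs_nonneg t, norm_nonneg Y]⟩
    have h2 : IsMIntegralCurveOn (I := 𝓘(ℝ, E)) (fun t : ℝ => f (β.bch X (t • Y))) (leftField Y)
        (Ioo (-2) 2) := by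
      intro t ht
      have h3 := hf _ (hmem t ht) _ (fun t : ℝ => β.bch X (t • Y)) t rfl
        (β.hasDerivAt_bch_smul X Y t)
      -- The curve t ↦ X · tY has velocity mcInv(·) Y, so f carries it to an integral curve of the
      -- left-invariant field of Y, like t ↦ exp X · exp tY.
      rw [β.mc_mcInv] at h3
      exact h3.hasMFDerivWithinAt
    have hX0 : f X = modelExp G X := by
      refine (heq X ?_).symm
      simpa [β.bch_zero_right] using hmem 0 (by constructor <;> norm_num)
    have h3 := isMIntegralCurveOn_Ioo_eqOn_of_contMDiff_boundaryless (I := 𝓘(ℝ, E)) (t₀ := 0)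
      (by constructor <;> norm_num) (contMDiff_leftField Y) h2
      ((hβ.isMIntegralCurve_mul_modelExp (modelExp G X) Y).isMIntegralCurveOn _)
      (by simp [hβ.modelExp_zero, β.bch_zero_right, hX0])
      (show (1 : ℝ) ∈ Ioo (-2 : ℝ) 2 by constructor <;> norm_num)
    have h4 := hmem 1 (by constructor <;> norm_num)
    rw [one_smul] at h4
    rw [heq _ h4]
    simpa using h3

end LieExp

theorem leftField_one {E : Type*} [NormedAddCommGroup E] [NormedSpace ℝ E]
    {G : Type*} [TopologicalSpace G] [ChartedSpace E G] [Group G] (Y : E) :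
    leftField Y (1 : G) = (lieModel E G).symm Y := by
  have h : (fun b : G => 1 * b) = id := by ext; simp
  rw [leftField, mulInvariantVectorField, h, mfderiv_id]
  rfl

/-! ### The exponential map as a global diffeomorphism -/

section ExpEquiv

open Set Filter Topology Metric NilGroup

variable {E : Type*} [NormedAddCommGroup E] [NormedSpace ℝ E]
  {G : Type*} [TopologicalSpace G] [ChartedSpace E G] [Group G] [LieGroup 𝓘(ℝ, E) ∞ G]
  [T2Space G] [FiniteDimensional ℝ E] [CompleteSpace E] {β : NilBracket ℝ E}

theorem NilGroup.log_pow {𝕜 : Type*} [RCLike 𝕜] {L : Type*} [NormedAddCommGroup L]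
    [NormedSpace 𝕜 L] [FiniteDimensional 𝕜 L] {β : NilBracket 𝕜 L} (x : NilGroup β) (m : ℕ) :
    log β (x ^ m) = m • log β x := by
  rw [← of_log x, ← of_nsmul]
  rfl

/-- The exponential map of a nilpotent Lie group as a homomorphism from the group of its Lie
algebra. -/
def IsBracketOf.expHom (hβ : IsBracketOf β G) : NilGroup β →* G :=
  MonoidHom.mk' (fun x => modelExp G (log β x)) <| by
    obtain ⟨-, -, -, r, hr, h⟩ := hβ.modelExp_local
    refine NilGroup.map_mul_of_pow (B := log β ⁻¹' ball 0 r) (fun x m => ?_) ?_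
      fun x hx y hy => h _ hx _ hy
    · exact (congrArg (modelExp G) (log_pow x m)).trans (hβ.modelExp_nsmul _ m)
    · exact (continuous_log β).continuousAt.preimage_mem_nhds (ball_mem_nhds (0 : E) hr)

theorem IsBracketOf.modelExp_bch (hβ : IsBracketOf β G) (X Y : E) :
    modelExp G (β.bch X Y) = modelExp G X * modelExp G Y :=
  hβ.expHom.map_mul (of β X) (of β Y)

theorem IsBracketOf.contMDiffAt_modelExp_zero (hβ : IsBracketOf β G) :
    ContMDiffAt 𝓘(ℝ, E) 𝓘(ℝ, E) ∞ (modelExp G) (0 : E) := by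
  obtain ⟨hs, hc, -, -⟩ := hβ.modelExp_local
  have h1 : ContMDiffAt 𝓘(ℝ, E) 𝓘(ℝ, E) ∞
      ((chartOne (E := E) G).symm ∘ (chartOne (E := E) G ∘ modelExp G)) (0 : E) := by
    refine ContMDiffAt.comp (0 : E) (contMDiffAt_chartOne_symm ?_) hc.contMDiffAt
    exact (chartOne G).map_source hs.self_of_nhds
  refine h1.congr_of_eventuallyEq ?_
  filter_upwards [hs] with Z hZ
  exact ((chartOne G).left_inv hZ).symm

/-- Smoothness at 0 is transported to X by exp Y = exp X · exp((−X) · Y), where (−X) · Y is close to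
0 for Y close to X. -/
theorem IsBracketOf.contMDiff_modelExp (hβ : IsBracketOf β G) :
    ContMDiff 𝓘(ℝ, E) 𝓘(ℝ, E) ∞ (modelExp G : E → G) := by
  intro X
  have h1 : (modelExp G : E → G) = (fun g => modelExp G X * g) ∘ modelExp G ∘ β.bch (-X) := by
    ext Y
    rw [Function.comp_apply, Function.comp_apply, ← hβ.modelExp_bch, ← β.bch_assoc]
    have : β.bch X (-X) = 0 := by simpa using β.bch_neg_left (-X)
    rw [this, β.bch_zero_left]
  have h2 : β.bch (-X) X = 0 := β.bch_neg_left X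
  rw [h1]
  refine (contMDiff_mul_left (I := 𝓘(ℝ, E)) (n := ∞)).contMDiffAt.comp X ?_
  refine ContMDiffAt.comp X ?_ (β.contDiff_bch_left (-X)).contMDiff.contMDiffAt
  rw [h2]
  exact hβ.contMDiffAt_modelExp_zero

theorem IsBracketOf.map_modelExp_nhds (hβ : IsBracketOf β G) :
    map (modelExp G) (𝓝 (0 : E)) = 𝓝 1 := by
  obtain ⟨hs, hc, hd, -⟩ := hβ.modelExp_local
  apply le_antisymm
  · have := hβ.contMDiffAt_modelExp_zero.continuousAt
    rwa [ContinuousAt, hβ.modelExp_zero] at this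
  · intro s hs'
    have hst : HasStrictFDerivAt (chartOne (E := E) G ∘ modelExp G)
        (ContinuousLinearEquiv.refl ℝ E : E →L[ℝ] E) (0 : E) :=
      hc.hasStrictFDerivAt' hd (by simp)
    have h1 := hst.map_nhds_eq_of_equiv
    rw [Function.comp_apply, hβ.modelExp_zero] at h1
    have h2 : (chartOne (E := E) G ∘ modelExp G : E → E) '' (modelExp G ⁻¹' s ∩
        {Z : E | modelExp G Z ∈ (chartOne (E := E) G).source}) ∈ 𝓝 (chartOne (E := E) G 1) := by
      rw [← h1]
      exact image_mem_map (inter_mem hs' hs)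
    have h3 := (contMDiffAt_chartOne (E := E) (G := G)
      one_mem_chartOne_source).continuousAt.preimage_mem_nhds h2
    filter_upwards [h3, (isOpen_chartOne_source (E := E) (G := G)).mem_nhds one_mem_chartOne_source]
      with g hg hgs
    obtain ⟨Z, ⟨hZ, hZs⟩, hZg⟩ := hg
    rw [← (chartOne (E := E) G).injOn hZs hgs hZg]
    exact hZ

variable [SimplyConnectedSpace G]

/-- The homomorphism is a local homeomorphism at 1, hence open; its image is an open and closed
subgroup of the connected G. The invertible derivative of exp at 0 isolates 1 in the kernel, and
simple connectedness gives injectivity. -/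
theorem IsBracketOf.bijective_expHom (hβ : IsBracketOf β G) : Function.Bijective hβ.expHom := by
  have : IsTopologicalGroup G := topologicalGroup_of_lieGroup 𝓘(ℝ, E) ∞
  have : LocallyPathConnectedSpace G := ChartedSpace.locallyPathConnectedSpace E G
  have hmap : map hβ.expHom (𝓝 1) = 𝓝 1 := hβ.map_modelExp_nhds
  have hc : Continuous hβ.expHom := by
    refine continuous_of_continuousAt_one _ ?_
    rw [ContinuousAt, Tendsto, hmap, map_one]
  have ho : IsOpenMap hβ.expHom := by
    refine IsOpenMap.of_nhds_le fun x => ?_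
    have h1 : hβ.expHom ∘ (fun y => x * y) = (fun y => hβ.expHom x * y) ∘ hβ.expHom := by
      ext y; simp
    rw [← map_mul_left_nhds_one x, Filter.map_map, h1, ← Filter.map_map, hmap,
      map_mul_left_nhds_one]
  have hs : Function.Surjective hβ.expHom := by
    rw [← MonoidHom.range_eq_top, ← Subgroup.coe_eq_univ]
    have hop : IsOpen (hβ.expHom.range : Set G) := ho.isOpen_range
    exact IsClopen.eq_univ ⟨Subgroup.isClosed_of_isOpen _ hop, hop⟩ ⟨1, one_mem _⟩
  have : PreconnectedSpace (NilGroup β) := inferInstanceAs (PreconnectedSpace E)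
  refine ⟨hβ.expHom.injective_of_isDiscrete_ker hc ho hs ?_, hs⟩
  obtain ⟨-, -, hd, -⟩ := hβ.modelExp_local
  have h1 := hd.eventually_ne (c := chartOne (E := E) G 1) ⟨1, fun z => by simp⟩
  rw [eventually_nhdsWithin_iff] at h1
  obtain ⟨U, hU, hUo, h0⟩ := _root_.eventually_nhds_iff.1 h1
  refine ⟨?_⟩
  change DiscreteTopology hβ.expHom.ker
  refine discreteTopology_of_isOpen_singleton_one ?_
  refine ⟨log β ⁻¹' U, hUo.preimage (continuous_log β), ?_⟩
  ext ⟨x, hx⟩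
  simp only [mem_preimage, mem_singleton_iff]
  constructor
  · intro hxU
    by_contra hne
    refine hU _ hxU (fun h => hne ?_) (congrArg (chartOne (E := E) G) hx)
    exact Subtype.ext h
  · intro h
    have : x = 1 := congrArg Subtype.val h
    rw [this]
    exact h0

/-- The exponential map of a simply connected nilpotent Lie group as an isomorphism. -/
def IsBracketOf.expEquiv (hβ : IsBracketOf β G) : NilGroup β ≃* G :=
  MulEquiv.ofBijective hβ.expHom hβ.bijective_expHom

/-- The logarithm of a simply connected nilpotent Lie group. -/
def IsBracketOf.modelLog (hβ : IsBracketOf β G) (g : G) : E := log β (hβ.expEquiv.symm g)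

theorem IsBracketOf.modelExp_modelLog (hβ : IsBracketOf β G) (g : G) :
    modelExp G (hβ.modelLog g) = g :=
  hβ.expEquiv.apply_symm_apply g

theorem IsBracketOf.modelLog_modelExp (hβ : IsBracketOf β G) (X : E) :
    hβ.modelLog (modelExp G X) = X :=
  hβ.expEquiv.symm_apply_apply (of β X)

theorem IsBracketOf.modelLog_mul (hβ : IsBracketOf β G) (g h : G) :
    hβ.modelLog (g * h) = β.bch (hβ.modelLog g) (hβ.modelLog h) := by
  rw [modelLog, map_mul]
  rfl

theorem IsBracketOf.contMDiff_modelLog (hβ : IsBracketOf β G) :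
    ContMDiff 𝓘(ℝ, E) 𝓘(ℝ, E) ∞ hβ.modelLog := by
  have h1 : ContMDiffAt 𝓘(ℝ, E) 𝓘(ℝ, E) ∞ hβ.modelLog (1 : G) := by
    obtain ⟨-, hc, hd, -⟩ := hβ.modelExp_local
    have hd' : HasFDerivAt (chartOne (E := E) G ∘ modelExp G)
        (ContinuousLinearEquiv.refl ℝ E : E →L[ℝ] E) (0 : E) := hd
    have h2 := hc.to_localInverse hd' (by simp)
    rw [Function.comp_apply, hβ.modelExp_zero] at h2
    have h3 := h2.contMDiffAt.comp (1 : G) (contMDiffAt_chartOne (E := E) one_mem_chartOne_source)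
    refine h3.congr_of_eventuallyEq ?_
    rw [← hβ.map_modelExp_nhds]
    change ∀ᶠ Z in 𝓝 (0 : E), _
    filter_upwards [(hc.hasStrictFDerivAt' hd' (by simp)).eventually_left_inverse] with Z hZ
    rw [hβ.modelLog_modelExp]
    exact hZ.symm
  intro g
  have h2 : hβ.modelLog = β.bch (hβ.modelLog g) ∘ hβ.modelLog ∘ fun h => g⁻¹ * h := by
    ext h
    simp only [Function.comp_apply, ← hβ.modelLog_mul, mul_inv_cancel_left]
  rw [h2]
  refine (β.contDiff_bch_left _).contMDiff.contMDiffAt.comp g ?_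
  refine ContMDiffAt.comp g ?_ (contMDiff_mul_left (I := 𝓘(ℝ, E)) (n := ∞)).contMDiffAt
  rwa [inv_mul_cancel]

/-- Differentiate log(g exp tY) = log g · tY at t = 0; the right side is the curve that defines the
product. -/
theorem IsBracketOf.mfderiv_modelLog (hβ : IsBracketOf β G) (g : G) (Y : E) :
    mfderiv 𝓘(ℝ, E) 𝓘(ℝ, E) hβ.modelLog g (leftField Y g) = β.mcInv (hβ.modelLog g) Y := by
  have h1 := ((hβ.contMDiff_modelLog (g * modelExp G ((0 : ℝ) • Y))).mdifferentiableAt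
    (by simp)).hasMFDerivAt.comp (0 : ℝ) (hβ.isMIntegralCurve_mul_modelExp g Y 0)
  have h2 : hβ.modelLog ∘ (fun t : ℝ => g * modelExp G (t • Y)) =
      fun t : ℝ => β.bch (hβ.modelLog g) (t • Y) := by
    ext t
    rw [Function.comp_apply, hβ.modelLog_mul, hβ.modelLog_modelExp]
  have h3 := (β.hasDerivAt_bch_smul (hβ.modelLog g) Y (0 : ℝ)).hasFDerivAt
  rw [h2] at h1
  let A : E →L[ℝ] E := mfderiv 𝓘(ℝ, E) 𝓘(ℝ, E) hβ.modelLog (g * modelExp G ((0 : ℝ) • Y))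
  let v : E := leftField Y (g * modelExp G ((0 : ℝ) • Y))
  have h6 : HasFDerivAt (fun t : ℝ => β.bch (hβ.modelLog g) (t • Y))
    (A ∘L (1 : ℝ →L[ℝ] ℝ).smulRight v) (0 : ℝ) := hasMFDerivAt_iff_hasFDerivAt.1 h1
  have h4 := DFunLike.congr_fun (h6.unique h3) (1 : ℝ)
  have h5 : ∀ g' : G, g' = g →
      (mfderiv 𝓘(ℝ, E) 𝓘(ℝ, E) hβ.modelLog g' ((1 : ℝ) • leftField Y g') : E) =
      mfderiv 𝓘(ℝ, E) 𝓘(ℝ, E) hβ.modelLog g (leftField Y g) := by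
    rintro _ rfl
    rw [one_smul]
  refine (h5 (g * modelExp G ((0 : ℝ) • Y)) (by simp [hβ.modelExp_zero])).symm.trans
    (h4.trans ?_)
  simp [β.bch_zero_right]

end ExpEquiv

/-! ### Polynomial factorizations of nilpotent groups -/

namespace NilBracket

open NilGroup

variable {𝕜 : Type*} [RCLike 𝕜] {L : Type*} [NormedAddCommGroup L] [NormedSpace 𝕜 L]
  (β : NilBracket 𝕜 L)

/-- A subspace that is closed under the bracket. -/
def IsClosed (D : Submodule 𝕜 L) : Prop := ∀ x ∈ D, ∀ y ∈ D, β.br x y ∈ D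

variable {β}

/-- A proper subalgebra of a nilpotent Lie algebra is properly contained in an ideal that is mapped
into the subalgebra by all brackets. -/
theorem exists_notMem_forall_br_mem {B : Submodule 𝕜 L} (hB : B ≠ ⊤) :
    ∃ x ∉ B, ∀ y, β.br y x ∈ B := by
  have h : ∃ k, bracketLCS β.br k ≤ B := ⟨β.cls, by rw [β.nil]; exact bot_le⟩
  classical
  obtain ⟨k, hk⟩ : ∃ k, Nat.find h = k + 1 := by
    refine Nat.exists_eq_succ_of_ne_zero fun h0 => hB ?_
    have := Nat.find_spec h
    rw [h0] at this
    exact top_le_iff.1 this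
  -- Take x in the last term of the lower central series not contained in B; bracketing it moves it
  -- into the next term, which lies in B.
  obtain ⟨x, hx, hxB⟩ := SetLike.not_le_iff_exists.1 (Nat.find_min h (m := k) (by omega))
  refine ⟨x, hxB, fun y => ?_⟩
  have := Nat.find_spec h
  rw [hk] at this
  exact this (β.br_mem_lcs y hx)

variable [FiniteDimensional 𝕜 L]

theorem neg_bch (X Y : L) : -β.bch X Y = β.bch (-Y) (-X) :=
  mul_inv_rev (of β X) (of β Y)

end NilBracket

open NilBracket in
/-- If a nilpotent Lie algebra is the sum of two subalgebras then its group is the product of the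
corresponding subgroups, with a polynomial choice of the factors. -/
theorem NilBracket.exists_factorization.{u, v} {𝕜 : Type v} [RCLike 𝕜] {L : Type u}
    [NormedAddCommGroup L] [NormedSpace 𝕜 L] {β : NilBracket 𝕜 L} [FiniteDimensional 𝕜 L]
    {A B : Submodule 𝕜 L} (hA : β.IsClosed A) (hB : β.IsClosed B) (hAB : A ⊔ B = ⊤) :
    ∃ π : L → L, (∀ g, π g ∈ A) ∧ (∀ g, β.bch (-π g) g ∈ B) ∧
      ∀ (S σ : Type u) (c : S → σ → 𝕜) (f : S → L), f ∈ polyMaps c L →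
        (fun s => π (f s)) ∈ polyMaps c L := by
  induction hd : Module.finrank 𝕜 L - Module.finrank 𝕜 B using Nat.strong_induction_on
    generalizing B with
  | _ d ih =>
  by_cases hBt : B = ⊤
  · refine ⟨fun _ => 0, fun _ => A.zero_mem, fun g => ?_, fun S σ c f _ => zero_mem _⟩
    rw [hBt]
    trivial
  obtain ⟨x, hxB, hx⟩ := exists_notMem_forall_br_mem (β := β) hBt
  -- The element x that normalizes B may be replaced by its A-component a, since the B-component
  -- normalizes B anyway. Thus B can be enlarged by a vector of A.
  obtain ⟨a, haA, b, hbB, rfl⟩ := Submodule.mem_sup.1 (hAB ▸ Submodule.mem_top (x := x))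
  have haB : a ∉ B := fun h => hxB (B.add_mem h hbB)
  have hbr : ∀ y ∈ B, β.br y a ∈ B := fun y hy => by
    have := B.sub_mem (hx y) (hB y hy b hbB)
    rwa [map_add, add_sub_cancel_right] at this
  obtain ⟨ℓ, hℓa, hℓB⟩ : ∃ ℓ : L →ₗ[𝕜] 𝕜, ℓ a = 1 ∧ ∀ y ∈ B, ℓ y = 0 := by
    obtain ⟨ℓ, h1, h2⟩ := Submodule.exists_le_ker_of_notMem haB
    refine ⟨(ℓ a)⁻¹ • ℓ, by simp [h1], fun y hy => ?_⟩
    have : ℓ y = 0 := h2 hy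
    simp [this]
  let B' := B ⊔ Submodule.span 𝕜 {a}
  have hmem : ∀ y ∈ B', y - ℓ y • a ∈ B := by
    intro y hy
    obtain ⟨b, hb, z, hz, rfl⟩ := Submodule.mem_sup.1 hy
    obtain ⟨c, rfl⟩ := Submodule.mem_span_singleton.1 hz
    simpa [hℓB b hb, hℓa] using hb
  have haB' : a ∈ B' := Submodule.mem_sup_right (Submodule.mem_span_singleton_self a)
  have hBB' : B ≤ B' := le_sup_left
  -- B is an ideal of B' with one-dimensional quotient, on which ℓ is the coordinate.
  have hV : ∀ y ∈ B', ∀ z ∈ B', β.br y z ∈ B := by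
    intro y hy z hz
    have h1 : β.br y z = β.br (y - ℓ y • a) (z - ℓ z • a) + ℓ z • β.br (y - ℓ y • a) a
        - ℓ y • β.br (z - ℓ z • a) a := by
      rw [β.skew (z - ℓ z • a) a]
      simp only [map_sub, map_smul, sub_apply, smul_apply, β.self]
      module
    rw [h1]
    exact B.sub_mem (B.add_mem (hB _ (hmem y hy) _ (hmem z hz))
      (B.smul_mem _ (hbr _ (hmem y hy)))) (B.smul_mem _ (hbr _ (hmem z hz)))
  have hB' : β.IsClosed B' := fun y hy z hz => hBB' (hV y hy z hz)
  have hlt : B < B' := lt_of_le_of_ne hBB' fun h => haB (h ▸ haB')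
  obtain ⟨π, hπA, hπB, hπ⟩ := ih (Module.finrank 𝕜 L - Module.finrank 𝕜 B') (by
    have h1 := Submodule.finrank_lt_finrank_of_lt hlt
    have h2 := Submodule.finrank_le B'
    omega) hB' (eq_top_iff.2 (hAB ▸ sup_le_sup_left hBB' A)) rfl
  -- Correct the factorization along B': with h = π(g)⁻¹ g in exp B', the element exp(ℓ(h) a) of exp
  -- A is split off from h. What is left has ℓ equal to 0, because the product of B' is addition
  -- modulo B, so it lies in exp B.
  refine ⟨fun g => β.bch (π g) (ℓ (β.bch (-π g) g) • a), fun g => ?_, fun g => ?_, ?_⟩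
  · exact β.bch_mem A hA (hπA g) (A.smul_mem _ haA)
  · rw [neg_bch, β.bch_assoc, ← neg_smul]
    set h := β.bch (-π g) g
    have h1 := β.bch_sub_add_mem B' B hB' hV (B'.smul_mem (-ℓ h) haB') (hπB g)
    have h2 := B.add_mem h1 (hmem h (hπB g))
    convert! h2 using 1
    module
  · intro S σ c f hf
    have h1 := hπ S σ c f hf
    have h2 := bch_mem_polyMaps β (neg_mem h1) hf
    exact bch_mem_polyMaps β h1 (linear_mem_polyMaps (ℓ.smulRight a) h2)

namespace NilGroup

variable {𝕜 : Type*} [RCLike 𝕜] {L : Type*} [NormedAddCommGroup L] [NormedSpace 𝕜 L]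
  {β : NilBracket 𝕜 L} [FiniteDimensional 𝕜 L]

/-- The subgroup that corresponds to a subalgebra. -/
def expSubgroup (B : Submodule 𝕜 L) (hB : β.IsClosed B) : Subgroup (NilGroup β) where
  carrier := {x | log β x ∈ B}
  mul_mem' hx hy := β.bch_mem B hB hx hy
  one_mem' := B.zero_mem
  inv_mem' hx := B.neg_mem hx

end NilGroup

namespace NilBracket

open NilGroup

variable {𝕜 : Type*} [RCLike 𝕜] {L : Type*} [NormedAddCommGroup L] [NormedSpace 𝕜 L]
  {β : NilBracket 𝕜 L} [FiniteDimensional 𝕜 L] {A B : Submodule 𝕜 L} {π : L → L}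

theorem bch_neg_bch (X Y : L) : β.bch (-X) (β.bch X Y) = Y :=
  inv_mul_cancel_left (of β X) (of β Y)

theorem bch_bch_neg (X Y : L) : β.bch X (β.bch (-X) Y) = Y :=
  mul_inv_cancel_left (of β X) (of β Y)

theorem eq_of_bch_neg_eq_zero {X Y : L} (h : β.bch (-X) Y = 0) : X = Y :=
  (inv_mul_eq_one (a := of β X) (b := of β Y)).1 h

/-- The factor in `A` is unique if the two subalgebras are complementary. -/
theorem eq_iff_bch_neg_mem (hA : β.IsClosed A) (hB : β.IsClosed B) (hd : Disjoint A B)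
    (hπA : ∀ g, π g ∈ A) (hπB : ∀ g, β.bch (-π g) g ∈ B) (g g' : L) :
    π g = π g' ↔ β.bch (-g) g' ∈ B := by
  have h1 : ((of β (π g))⁻¹ * of β g) * ((of β g)⁻¹ * of β g') * ((of β (π g'))⁻¹ * of β g')⁻¹ =
      (of β (π g))⁻¹ * of β (π g') := by group
  have hg : (of β (π g))⁻¹ * of β g ∈ expSubgroup B hB := hπB g
  have hg' : (of β (π g'))⁻¹ * of β g' ∈ expSubgroup B hB := hπB g'
  constructor
  · intro h
    rw [h, inv_mul_cancel, ← h] at h1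
    have h2 : (of β g)⁻¹ * of β g' =
        ((of β (π g))⁻¹ * of β g)⁻¹ * ((of β (π g'))⁻¹ * of β g') := by
      rw [← h]; group
    have : (of β g)⁻¹ * of β g' ∈ expSubgroup B hB := by
      rw [h2]
      exact mul_mem (inv_mem hg) hg'
    exact this
  · intro h
    have h2 : (of β (π g))⁻¹ * of β (π g') ∈ expSubgroup B hB := by
      rw [← h1]
      exact mul_mem (mul_mem hg h) (inv_mem hg')
    have h3 : β.bch (-π g) (π g') ∈ A := β.bch_mem A hA (A.neg_mem (hπA g)) (hπA g')
    exact eq_of_bch_neg_eq_zero (Submodule.disjoint_def.1 hd _ h3 h2)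

theorem factor_eq_of_mem (hA : β.IsClosed A) (hd : Disjoint A B)
    (hπA : ∀ g, π g ∈ A) (hπB : ∀ g, β.bch (-π g) g ∈ B) {a : L} (ha : a ∈ A) : π a = a :=
  eq_of_bch_neg_eq_zero (Submodule.disjoint_def.1 hd _
    (β.bch_mem A hA (A.neg_mem (hπA a)) ha) (hπB a))

/-- The factor in `A` does not change modulo an ideal in `A` if the argument does not. -/
theorem factor_sub_factor_mem (hA : β.IsClosed A) (hB : β.IsClosed B) (hd : Disjoint A B)
    (hπA : ∀ g, π g ∈ A) (hπB : ∀ g, β.bch (-π g) g ∈ B) {N : Submodule 𝕜 L} (hN : N ≤ A)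
    (hNi : ∀ x, ∀ y ∈ N, β.br x y ∈ N) {g g' : L} (h : g' - g ∈ N) : π g' - π g ∈ N := by
  set b := β.bch (-π g) g with hb
  set b' := β.bch (-π g') g' with hb'
  have h0 : ∀ X Y : L, X - Y ∈ N → ∀ Z, β.bch Z X - β.bch Z Y ∈ N := fun X Y h Z =>
    β.bch_sub_bch_mem N hNi (by simp) h
  have h0' : ∀ X Y : L, X - Y ∈ N → ∀ Z, β.bch X Z - β.bch Y Z ∈ N := fun X Y h Z =>
    β.bch_sub_bch_mem N hNi h (by simp)
  have h1 : β.bch (-π g) (π g') = β.bch (β.bch (-π g) g') (-b') := by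
    have : (of β (π g))⁻¹ * of β (π g') =
        (of β (π g))⁻¹ * of β g' * ((of β (π g'))⁻¹ * of β g')⁻¹ := by group
    exact this
  -- Modulo N the argument g' may be replaced by g, so π(g)⁻¹ π(g') is congruent to b b'⁻¹. The
  -- latter is in B, and also in A since N ≤ A; hence it is 0.
  have h2 : β.bch (-π g) (π g') - β.bch b (-b') ∈ N := by
    rw [h1]
    exact h0' _ _ (h0 _ _ h _) _
  have h3 : β.bch b (-b') ∈ B := β.bch_mem B hB (hπB g) (B.neg_mem (hπB g'))
  have h4 : β.bch b (-b') ∈ A := by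
    have := A.sub_mem (β.bch_mem A hA (A.neg_mem (hπA g)) (hπA g')) (hN h2)
    rwa [sub_sub_cancel] at this
  rw [Submodule.disjoint_def.1 hd _ h4 h3] at h2
  have h5 := h0 _ _ h2 (π g)
  rwa [bch_bch_neg, β.bch_zero_right] at h5

end NilBracket

/-! ### Smooth embeddings with a smooth left inverse -/

/-- A smooth map with injective derivative at a point is locally the restriction of a local
diffeomorphism of a product to the first factor. -/
theorem exists_openPartialHomeomorph_prod_of_injective_fderiv {E W : Type*} [NormedAddCommGroup E]
    [NormedSpace ℝ E] [FiniteDimensional ℝ E] [CompleteSpace E] [NormedAddCommGroup W]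
    [NormedSpace ℝ W] [FiniteDimensional ℝ W] {F : Type*} [NormedAddCommGroup F] [NormedSpace ℝ F]
    [FiniteDimensional ℝ F]
    (hF : Module.finrank ℝ E + Module.finrank ℝ F = Module.finrank ℝ W) {g : E → W}
    (hg : ContDiff ℝ ∞ g) (a : E) (ha : Function.Injective (fderiv ℝ g a)) :
    ∃ (_ : (E × F) ≃L[ℝ] W) (e : OpenPartialHomeomorph (E × F) W), (a, 0) ∈ e.source ∧
      ContDiffOn ℝ ∞ e e.source ∧ ContDiffOn ℝ ∞ e.symm e.target ∧ ∀ u, e (u, 0) = g u := by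
  let D := fderiv ℝ g a
  obtain ⟨Q, hQ⟩ := Submodule.exists_isCompl (LinearMap.range D.toLinearMap)
  have hr : Module.finrank ℝ (LinearMap.range D.toLinearMap) = Module.finrank ℝ E :=
    LinearMap.finrank_range_of_inj ha
  have hs := Submodule.finrank_add_eq_of_isCompl hQ
  let ψ : F ≃ₗ[ℝ] Q := LinearEquiv.ofFinrankEq F Q (by omega)
  let ℓ : F →L[ℝ] W := LinearMap.toContinuousLinearMap (Q.subtype ∘ₗ ψ.toLinearMap)
  have hinj : Function.Injective (D.coprod ℓ) := by
    rw [injective_iff_map_eq_zero]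
    rintro ⟨u, v⟩ h
    have h1 : D u = -ℓ v := eq_neg_of_add_eq_zero_left (by simpa using h)
    have h2 : D u = 0 := by
      have := Submodule.disjoint_def.1 hQ.disjoint (D u) ⟨u, rfl⟩
        (by rw [h1]; exact Q.neg_mem (ψ v).2)
      exact this
    have hu : u = 0 := ha (h2.trans (map_zero _).symm)
    have hv : (ψ v : W) = 0 := by
      have : ℓ v = 0 := by rw [← neg_eq_zero, ← h1, h2]
      exact this
    have hv' : v = 0 := by simpa using hv
    rw [hu, hv']; rfl
  have : CompleteSpace F := FiniteDimensional.complete ℝ F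
  let Ψ : (E × F) ≃L[ℝ] W := (LinearEquiv.ofInjectiveOfFinrankEq
    (D.coprod ℓ).toLinearMap hinj (by rw [Module.finrank_prod, hF])).toContinuousLinearEquiv
  have hΨ : (Ψ : E × F →L[ℝ] W) = D.coprod ℓ := by ext <;> rfl
  let P : E × F → W := fun p => g p.1 + ℓ p.2
  have hP : ContDiff ℝ ∞ P := (hg.comp contDiff_fst).add (ℓ.contDiff.comp contDiff_snd)
  have hPd : HasFDerivAt P (Ψ : E × F →L[ℝ] W) (a, 0) := by
    rw [hΨ]
    have h1 : HasFDerivAt g D ((a, (0 : F)).1) :=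
      (hg.differentiable (by simp) a).hasFDerivAt
    have h2 := (h1.comp (a, (0 : F)) hasFDerivAt_fst).add (ℓ.hasFDerivAt.comp (a, (0 : F)) hasFDerivAt_snd)
    convert! h2 using 1
  let e₀ := hP.contDiffAt.toOpenPartialHomeomorph P hPd (by simp)
  -- The chart is restricted to the open set where the derivative is invertible, so that the inverse
  -- is smooth on the whole target and not just at one point.
  let s : Set (E × F) := {p | fderiv ℝ P p ∈ Set.range ((↑) : ((E × F) ≃L[ℝ] W) → _)}
  have hso : IsOpen s :=
    (ContinuousLinearEquiv.isOpen (E := E × F) (F := W)).preimage (hP.continuous_fderiv (by simp))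
  let e := e₀.restrOpen s hso
  have hcoe : ∀ p, e p = P p := fun p => rfl
  refine ⟨Ψ, e, ⟨hP.contDiffAt.mem_toOpenPartialHomeomorph_source hPd (by simp), ?_⟩,
    hP.contDiffOn, fun w hw => ?_, fun u => ?_⟩
  · exact ⟨Ψ, hPd.fderiv.symm⟩
  · obtain ⟨Ψ', h⟩ := (e.map_target hw).2
    refine (e.contDiffAt_symm hw (f₀' := Ψ') ?_ hP.contDiffAt).contDiffWithinAt
    rw [h]
    exact (hP.differentiable (by simp) _).hasFDerivAt
  · rw [hcoe]
    simp [P]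

/-- A smooth map from a manifold that is diffeomorphic to a vector space to another vector space is
a smooth embedding if it has a smooth left inverse. -/
theorem isSmoothEmbedding_of_leftInverse {E W : Type*} [NormedAddCommGroup E]
    [NormedSpace ℝ E] [FiniteDimensional ℝ E] [CompleteSpace E] [NormedAddCommGroup W]
    [NormedSpace ℝ W] [FiniteDimensional ℝ W] {G : Type*} [TopologicalSpace G] [ChartedSpace E G]
    [IsManifold 𝓘(ℝ, E) ∞ G] (φ : G ≃ₜ E) (hφ : ContMDiff 𝓘(ℝ, E) 𝓘(ℝ, E) ∞ φ)
    (hφ' : ContMDiff 𝓘(ℝ, E) 𝓘(ℝ, E) ∞ φ.symm) {g : E → W} {R : W → E} (hg : ContDiff ℝ ∞ g)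
    (hR : ContDiff ℝ ∞ R) (hRg : ∀ u, R (g u) = u) :
    Manifold.IsSmoothEmbedding 𝓘(ℝ, E) 𝓘(ℝ, W) ∞ fun x => g (φ x) := by
  have hinj : ∀ a, Function.Injective (fderiv ℝ g a) := fun a => by
    have h1 : HasFDerivAt (fun u => R (g u)) ((fderiv ℝ R (g a)).comp (fderiv ℝ g a)) a :=
      (hR.differentiable (by simp) _).hasFDerivAt.comp a
        (hg.differentiable (by simp) a).hasFDerivAt
    have h2 : (fderiv ℝ R (g a)).comp (fderiv ℝ g a) = ContinuousLinearMap.id ℝ E := by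
      refine h1.unique ?_
      simp only [hRg]
      exact hasFDerivAt_id a
    intro u v huv
    have := congrArg (fderiv ℝ R (g a)) huv
    simpa using (DFunLike.congr_fun h2 u).symm.trans (this.trans (DFunLike.congr_fun h2 v))
  have hc : Continuous fun x => g (φ x) := hg.continuous.comp φ.continuous
  refine ⟨?_, ?_⟩
  · have hle : Module.finrank ℝ E ≤ Module.finrank ℝ W :=
      LinearMap.finrank_le_finrank_of_injective (f := (fderiv ℝ g 0).toLinearMap) (hinj 0)
    let F := Fin (Module.finrank ℝ W - Module.finrank ℝ E) → ℝ
    have hF : Module.finrank ℝ E + Module.finrank ℝ F = Module.finrank ℝ W := by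
      simp only [F, Module.finrank_fin_fun]; omega
    refine Manifold.IsImmersionOfComplement.isImmersion (F := F) fun x => ?_
    obtain ⟨Ψ, e, hae, he, he', heg⟩ :=
      exists_openPartialHomeomorph_prod_of_injective_fderiv (F := F) hF hg (φ x) (hinj (φ x))
    -- In these charts g is u ↦ Ψ (u, 0), the normal form of an immersion.
    let cod : OpenPartialHomeomorph W W := e.symm.transHomeomorph Ψ.toHomeomorph
    have hio : IsOpen {u : E | (u, (0 : F)) ∈ e.source} :=
      e.open_source.preimage (by fun_prop)
    let dom : OpenPartialHomeomorph G E :=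
      φ.toOpenPartialHomeomorph.trans (OpenPartialHomeomorph.ofSet _ hio)
    have hgt : ∀ u, (u, (0 : F)) ∈ e.source → g u ∈ e.target := fun u hu => by
      rw [← heg]; exact e.map_source hu
    refine Manifold.IsImmersionAtOfComplement.mk_of_continuousAt hc.continuousAt Ψ dom cod
      ?_ ?_ ?_ ?_ ?_
    · simpa [dom] using hae
    · exact hgt _ hae
    · refine OpenPartialHomeomorph.mem_maximalAtlas_of_contMDiffOn _ ?_ ?_
      · exact hφ.contMDiffOn
      · exact hφ'.contMDiffOn
    · refine OpenPartialHomeomorph.mem_maximalAtlas_of_contMDiffOn _ ?_ ?_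
      · exact (Ψ.contDiff.comp_contDiffOn he').contMDiffOn
      · refine ContDiffOn.contMDiffOn ?_
        exact he.comp Ψ.symm.contDiff.contDiffOn fun w hw => by simpa [cod] using hw
    · intro u hu
      have hu' : (u, (0 : F)) ∈ e.source := by simpa [dom] using hu
      have h1 : φ (φ.symm u) = u := φ.apply_symm_apply u
      change Ψ (e.symm (g (φ (φ.symm u)))) = Ψ (u, 0)
      rw [h1, ← heg, e.left_inv hu']
  · refine Topology.IsEmbedding.of_leftInverse (f := fun w => φ.symm (R w)) (fun x => ?_)
      (φ.symm.continuous.comp hR.continuous) hc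
    change φ.symm (R (g (φ x))) = x
    rw [hRg, φ.symm_apply_apply]

/-! ### Linear algebra of horizontal CR structures -/

/-- Complex conjugation on the complexification of a real vector space. -/
def tensorConj (𝔤 : Type*) [AddCommGroup 𝔤] [Module ℝ 𝔤] : ℂ ⊗[ℝ] 𝔤 →ₗ[ℝ] ℂ ⊗[ℝ] 𝔤 :=
  LinearMap.rTensor 𝔤 Complex.conjAe.toLinearMap

@[simp]
theorem tensorConj_tmul {𝔤 : Type*} [AddCommGroup 𝔤] [Module ℝ 𝔤] (c : ℂ) (x : 𝔤) :
    tensorConj 𝔤 (c ⊗ₜ[ℝ] x) = (starRingEnd ℂ c) ⊗ₜ[ℝ] x := rfl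

theorem tensorLie_add {𝔤 : Type*} [LieRing 𝔤] [LieAlgebra ℝ 𝔤] (u v w : ℂ ⊗[ℝ] 𝔤) :
    ⁅u, v + w⁆ = ⁅u, v⁆ + ⁅u, w⁆ :=
  LieRing.lie_add u v w

theorem tensorLie_zero {𝔤 : Type*} [LieRing 𝔤] [LieAlgebra ℝ 𝔤] (u : ℂ ⊗[ℝ] 𝔤) :
    ⁅u, (0 : ℂ ⊗[ℝ] 𝔤)⁆ = 0 := by
  simpa using tensorLie_add u 0 0

theorem tensorConj_lie {𝔤 : Type*} [LieRing 𝔤] [LieAlgebra ℝ 𝔤] (u v : ℂ ⊗[ℝ] 𝔤) :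
    tensorConj 𝔤 ⁅u, v⁆ = ⁅tensorConj 𝔤 u, tensorConj 𝔤 v⁆ := by
  induction u with
  | zero => simp
  | add u u' hu hu' => simp [add_lie, hu, hu']
  | tmul c x =>
    induction v with
    | zero => simp [tensorLie_zero]
    | add v v' hv hv' => simp only [tensorLie_add, map_add, hv, hv']
    | tmul d y => simp [LieAlgebra.ExtendScalars.bracket_tmul]

/-- The real part of an element of the complexification of a real vector space. -/
def tensorRe (𝔤 : Type*) [AddCommGroup 𝔤] [Module ℝ 𝔤] : ℂ ⊗[ℝ] 𝔤 →ₗ[ℝ] 𝔤 :=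
  (TensorProduct.lid ℝ 𝔤).toLinearMap ∘ₗ LinearMap.rTensor 𝔤 Complex.reLm

@[simp]
theorem tensorRe_tmul {𝔤 : Type*} [AddCommGroup 𝔤] [Module ℝ 𝔤] (c : ℂ) (x : 𝔤) :
    tensorRe 𝔤 (c ⊗ₜ[ℝ] x) = c.re • x := by
  simp [tensorRe]

namespace HorizontalCR

variable {𝔤 : Type*} [LieRing 𝔤] [LieAlgebra ℝ 𝔤] {n k : ℕ} (S : HorizontalCR 𝔤 n k)

/-- `X ↦ X + i J X` as a linear map. -/
def lin01 : S.𝔥 →ₗ[ℝ] ℂ ⊗[ℝ] 𝔤 :=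
  TensorProduct.mk ℝ ℂ 𝔤 1 ∘ₗ S.𝔥.subtype +
    TensorProduct.mk ℝ ℂ 𝔤 Complex.I ∘ₗ S.𝔥.subtype ∘ₗ S.J

/-- `X ↦ X - i J X` as a linear map. -/
def lin10 : S.𝔥 →ₗ[ℝ] ℂ ⊗[ℝ] 𝔤 :=
  TensorProduct.mk ℝ ℂ 𝔤 1 ∘ₗ S.𝔥.subtype -
    TensorProduct.mk ℝ ℂ 𝔤 Complex.I ∘ₗ S.𝔥.subtype ∘ₗ S.J

/-- The case c = i is i(X + iJX) = −JX + iX, which is the vector of −JX because J² = −1. So 𝔥⁰¹ is a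
complex subspace. -/
theorem smul_vec01 (c : ℂ) (X : S.𝔥) :
    c • vec01 S.J X = vec01 S.J (c.re • X - c.im • S.J X) := by
  have h1 : c • vec01 S.J X = c ⊗ₜ[ℝ] (X : 𝔤) + (c * Complex.I) ⊗ₜ[ℝ] ((S.J X : S.𝔥) : 𝔤) := by
    simp [vec01, TensorProduct.smul_tmul']
  have h2 : c = c.re • (1 : ℂ) + c.im • Complex.I := by
    simp [Complex.re_add_im]
  have h3 : c * Complex.I = c.re • Complex.I - c.im • (1 : ℂ) := by
    apply Complex.ext <;> simp
  rw [h1, h3]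
  nth_rewrite 1 [h2]
  simp only [vec01, map_sub, map_smul, S.J_sq, TensorProduct.add_tmul, TensorProduct.sub_tmul,
    TensorProduct.smul_tmul, TensorProduct.tmul_sub, Submodule.coe_sub, Submodule.coe_add,
    Submodule.coe_smul, smul_neg, sub_neg_eq_add, TensorProduct.tmul_add]
  abel

theorem smul_vec10 (c : ℂ) (X : S.𝔥) :
    c • vec10 S.J X = vec10 S.J (c.re • X + c.im • S.J X) := by
  have h1 : c • vec10 S.J X = c ⊗ₜ[ℝ] (X : 𝔤) - (c * Complex.I) ⊗ₜ[ℝ] ((S.J X : S.𝔥) : 𝔤) := by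
    simp [vec10, TensorProduct.smul_tmul', smul_sub]
  have h2 : c = c.re • (1 : ℂ) + c.im • Complex.I := by
    simp [Complex.re_add_im]
  have h3 : c * Complex.I = c.re • Complex.I - c.im • (1 : ℂ) := by
    apply Complex.ext <;> simp
  rw [h1, h3]
  nth_rewrite 1 [h2]
  simp only [vec10, map_add, map_smul, S.J_sq, TensorProduct.add_tmul, TensorProduct.sub_tmul,
    TensorProduct.smul_tmul, TensorProduct.tmul_add, TensorProduct.tmul_neg, Submodule.coe_add,
    Submodule.coe_smul, smul_neg, Submodule.coe_neg]
  abel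

/-- The complex subspace `𝔥⁰¹`. -/
def sub01 : Submodule ℂ (ℂ ⊗[ℝ] 𝔤) where
  carrier := S.h01
  add_mem' := by
    rintro _ _ ⟨X, rfl⟩ ⟨Y, rfl⟩
    exact ⟨X + Y, map_add S.lin01 X Y⟩
  zero_mem' := ⟨0, map_zero S.lin01⟩
  smul_mem' := by
    rintro c _ ⟨X, rfl⟩
    exact ⟨_, (S.smul_vec01 c X).symm⟩

/-- The complex subspace `𝔥¹⁰`. -/
def sub10 : Submodule ℂ (ℂ ⊗[ℝ] 𝔤) where
  carrier := S.h10
  add_mem' := by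
    rintro _ _ ⟨X, rfl⟩ ⟨Y, rfl⟩
    exact ⟨X + Y, map_add S.lin10 X Y⟩
  zero_mem' := ⟨0, map_zero S.lin10⟩
  smul_mem' := by
    rintro c _ ⟨X, rfl⟩
    exact ⟨_, (S.smul_vec10 c X).symm⟩

/-- The complexification of `𝔫`. -/
def subN : Submodule ℂ (ℂ ⊗[ℝ] 𝔤) := S.𝔫.toSubmodule.baseChange ℂ

theorem coe_sub10_sup_subN : ((S.sub10 ⊔ S.subN : Submodule ℂ _) : Set (ℂ ⊗[ℝ] 𝔤)) = S.m := by
  ext z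
  simp only [SetLike.mem_coe, Submodule.mem_sup, m, Set.mem_ofPred_eq]
  constructor
  · rintro ⟨a, ha, b, hb, rfl⟩; exact ⟨a, ha, b, hb, rfl⟩
  · rintro ⟨a, ha, b, hb, rfl⟩; exact ⟨a, ha, b, hb, rfl⟩

theorem lie_mem_sub01 {u v : ℂ ⊗[ℝ] 𝔤} (hu : u ∈ S.sub01) (hv : v ∈ S.sub01) :
    ⁅u, v⁆ ∈ S.sub01 := by
  obtain ⟨X, rfl⟩ := hu
  obtain ⟨Y, rfl⟩ := hv
  obtain ⟨Z, hZ⟩ := S.integrable X Y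
  exact ⟨Z, hZ.symm⟩

theorem tensorConj_vec01 (X : S.𝔥) : tensorConj 𝔤 (vec01 S.J X) = vec10 S.J X := by
  simp [vec01, vec10, TensorProduct.neg_tmul, sub_eq_add_neg]

/-- Conjugation is a real Lie automorphism that takes 𝔥⁰¹ to 𝔥¹⁰, so integrability carries over. -/
theorem lie_mem_sub10 {u v : ℂ ⊗[ℝ] 𝔤} (hu : u ∈ S.sub10) (hv : v ∈ S.sub10) :
    ⁅u, v⁆ ∈ S.sub10 := by
  obtain ⟨X, rfl⟩ := hu
  obtain ⟨Y, rfl⟩ := hv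
  obtain ⟨Z, hZ⟩ := S.integrable X Y
  refine ⟨Z, ?_⟩
  rw [← tensorConj_vec01, ← tensorConj_vec01, ← tensorConj_vec01, ← hZ, tensorConj_lie]

theorem lie_mem_subN (u : ℂ ⊗[ℝ] 𝔤) {v : ℂ ⊗[ℝ] 𝔤} (hv : v ∈ S.subN) : ⁅u, v⁆ ∈ S.subN :=
  (LieSubmodule.baseChange ℂ S.𝔫).lie_mem hv

theorem lie_mem_subN' {u : ℂ ⊗[ℝ] 𝔤} (v : ℂ ⊗[ℝ] 𝔤) (hu : u ∈ S.subN) : ⁅u, v⁆ ∈ S.subN := by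
  rw [← lie_skew]
  exact S.subN.neg_mem (S.lie_mem_subN v hu)

theorem lie_mem_sub10_sup_subN {u v : ℂ ⊗[ℝ] 𝔤} (hu : u ∈ S.sub10 ⊔ S.subN)
    (hv : v ∈ S.sub10 ⊔ S.subN) : ⁅u, v⁆ ∈ S.sub10 ⊔ S.subN := by
  obtain ⟨a, ha, b, hb, rfl⟩ := Submodule.mem_sup.1 hu
  obtain ⟨a', ha', b', hb', rfl⟩ := Submodule.mem_sup.1 hv
  rw [add_lie, tensorLie_add]
  exact add_mem (add_mem (Submodule.mem_sup_left (S.lie_mem_sub10 ha ha'))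
    (Submodule.mem_sup_right (S.lie_mem_subN _ hb'))) (Submodule.mem_sup_right (S.lie_mem_subN' _ hb))

theorem lie_mem_sub01_sup_subN {u v : ℂ ⊗[ℝ] 𝔤} (hu : u ∈ S.sub01 ⊔ S.subN)
    (hv : v ∈ S.sub01 ⊔ S.subN) : ⁅u, v⁆ ∈ S.sub01 ⊔ S.subN := by
  obtain ⟨a, ha, b, hb, rfl⟩ := Submodule.mem_sup.1 hu
  obtain ⟨a', ha', b', hb', rfl⟩ := Submodule.mem_sup.1 hv
  rw [add_lie, tensorLie_add]
  exact add_mem (add_mem (Submodule.mem_sup_left (S.lie_mem_sub01 ha ha'))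
    (Submodule.mem_sup_right (S.lie_mem_subN _ hb'))) (Submodule.mem_sup_right (S.lie_mem_subN' _ hb))

theorem tmul_mem_subN (c : ℂ) {T : 𝔤} (hT : T ∈ S.𝔫) : c ⊗ₜ[ℝ] T ∈ S.subN := by
  exact Submodule.tmul_mem_baseChange_of_mem c hT

/-- Real elements together with `𝔥⁰¹` and `𝔫_ℂ` span the complexification. -/
theorem exists_eq_tmul_add (u : ℂ ⊗[ℝ] 𝔤) :
    ∃ X : 𝔤, ∃ v ∈ S.sub01 ⊔ S.subN, u = (1 : ℂ) ⊗ₜ[ℝ] X + v := by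
  induction u with
  | zero => exact ⟨0, 0, zero_mem _, by simp⟩
  | add u u' hu hu' =>
    obtain ⟨X, v, hv, rfl⟩ := hu
    obtain ⟨X', v', hv', rfl⟩ := hu'
    exact ⟨X + X', v + v', add_mem hv hv', by rw [TensorProduct.tmul_add]; abel⟩
  | tmul c x =>
    obtain ⟨X, hX, T, hT, rfl⟩ := Submodule.mem_sup.1
      (S.isCompl.sup_eq_top ▸ Submodule.mem_top (x := x))
    let X' : S.𝔥 := ⟨X, hX⟩
    -- Modulo 𝔥⁰¹ multiplication by i acts on 𝔥 as J, since iX − JX = vec01(−JX).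
    refine ⟨((c.re • X' + c.im • S.J X' : S.𝔥) : 𝔤), vec01 S.J (-(c.im • S.J X')) + c ⊗ₜ[ℝ] T,
      add_mem (Submodule.mem_sup_left ⟨_, rfl⟩)
        (Submodule.mem_sup_right (S.tmul_mem_subN c hT)), ?_⟩
    have h2 : c = c.re • (1 : ℂ) + c.im • Complex.I := by
      simp [Complex.re_add_im]
    have h3 : c ⊗ₜ[ℝ] X = (1 : ℂ) ⊗ₜ[ℝ] (c.re • X) + Complex.I ⊗ₜ[ℝ] (c.im • X) := by
      conv_lhs => rw [h2]
      rw [TensorProduct.add_tmul, TensorProduct.smul_tmul, TensorProduct.smul_tmul]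
    rw [TensorProduct.tmul_add, h3]
    simp only [vec01, map_neg, map_smul, S.J_sq, smul_neg, neg_neg, Submodule.coe_add,
      Submodule.coe_smul, Submodule.coe_neg, TensorProduct.tmul_add, TensorProduct.tmul_neg, X']
    abel

/-- Every complex structure is given by a basis `X₁, …, Xₙ, J X₁, …, J Xₙ`. -/
theorem nonempty_adaptedBasis [FiniteDimensional ℝ 𝔤] : Nonempty S.AdaptedBasis := by
  -- J makes 𝔥 a complex vector space of dimension n; a complex basis, together with its multiples
  -- by i, is the real basis wanted.
  let α : ℂ →ₐ[ℝ] Module.End ℝ S.𝔥 := Complex.lift ⟨S.J, by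
    ext X
    simp [S.J_sq]⟩
  let : Module ℂ S.𝔥 := Module.compHom S.𝔥 α.toRingHom
  have hsmul : ∀ (c : ℂ) (X : S.𝔥), c • X = c.re • X + c.im • S.J X := fun c X => by
    change α c X = _
    simp [α, Complex.liftAux_apply]
  have : IsScalarTower ℝ ℂ S.𝔥 := ⟨fun r c X => by
    rw [hsmul, hsmul]
    simp [smul_add, smul_smul]⟩
  have : FiniteDimensional ℂ S.𝔥 := FiniteDimensional.right ℝ ℂ S.𝔥
  have hfr : Module.finrank ℂ S.𝔥 = n := by
    have h1 := Module.finrank_mul_finrank ℝ ℂ S.𝔥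
    rw [Complex.finrank_real_complex, S.finrank_𝔥] at h1
    omega
  let c : Module.Basis (Fin n) ℂ S.𝔥 := Module.finBasisOfFinrankEq ℂ S.𝔥 hfr
  let e : Fin 2 × Fin n ≃ Fin n ⊕ Fin n :=
    (finTwoEquiv.prodCongr (Equiv.refl _)).trans (Equiv.boolProdEquivSum _)
  refine ⟨⟨(Complex.basisOneI.smulTower c).reindex e, fun j => ?_,
    Module.finBasisOfFinrankEq ℝ S.𝔫 S.finrank_𝔫⟩⟩
  rw [Module.Basis.reindex_apply, Module.Basis.reindex_apply]
  have h1 : e.symm (Sum.inr j) = (1, j) := rfl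
  have h0 : e.symm (Sum.inl j) = (0, j) := rfl
  rw [h1, h0, Module.Basis.smulTower_apply, Module.Basis.smulTower_apply]
  simp [hsmul]

end HorizontalCR

/-! ### Coordinates that are adapted to a horizontal CR structure -/

namespace HorizontalCR.AdaptedBasis

variable {𝔤 : Type*} [LieRing 𝔤] [LieAlgebra ℝ 𝔤] {n k : ℕ} {S : HorizontalCR 𝔤 n k}
  (b : S.AdaptedBasis)

/-- The basis `X₁, …, Xₙ, J X₁, …, J Xₙ, T₁, …, Tₖ`. -/
def basis : Module.Basis ((Fin n ⊕ Fin n) ⊕ Fin k) ℝ 𝔤 :=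
  (b.basis𝔥.prod b.basis𝔫).map (Submodule.prodEquivOfIsCompl _ _ S.isCompl)

@[simp]
theorem basis_inl (i : Fin n ⊕ Fin n) : b.basis (Sum.inl i) = (b.basis𝔥 i : 𝔤) := by
  have h : b.basis (Sum.inl i) = ((b.basis𝔥.prod b.basis𝔫 (Sum.inl i)).1 : 𝔤) +
    (b.basis𝔥.prod b.basis𝔫 (Sum.inl i)).2 := by
    rw [basis, Module.Basis.map_apply]; rfl
  simpa using h

@[simp]
theorem basis_inr (l : Fin k) : b.basis (Sum.inr l) = (b.basis𝔫 l : 𝔤) := by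
  have h : b.basis (Sum.inr l) = ((b.basis𝔥.prod b.basis𝔫 (Sum.inr l)).1 : 𝔤) +
    (b.basis𝔥.prod b.basis𝔫 (Sum.inr l)).2 := by
    rw [basis, Module.Basis.map_apply]; rfl
  simpa using h

theorem mem_of_mem_𝔫 {P : Submodule ℝ 𝔤} (hP : ∀ l, (b.basis𝔫 l : 𝔤) ∈ P) {T : 𝔤}
    (hT : T ∈ S.𝔫) : T ∈ P := by
  have h : Submodule.span ℝ (Set.range b.basis𝔫) ≤ P.comap S.𝔫.toSubmodule.subtype := by
    refine Submodule.span_le.2 ?_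
    rintro _ ⟨l, rfl⟩
    exact hP l
  rw [b.basis𝔫.span_eq] at h
  exact h (x := ⟨T, hT⟩) trivial

theorem realVec_eq (v : (Fin n → ℝ) × (Fin n → ℝ) × (Fin k → ℝ)) :
    b.realVec v = b.basis.equivFun.symm (Sum.elim (Sum.elim v.1 v.2.1) v.2.2) := by
  simp [Module.Basis.equivFun_symm_apply, Fintype.sum_sum_type, realVec]

theorem bijective_realVec : Function.Bijective b.realVec := by
  have h : b.realVec = b.basis.equivFun.symm ∘ fun v => Sum.elim (Sum.elim v.1 v.2.1) v.2.2 :=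
    funext b.realVec_eq
  rw [h]
  refine b.basis.equivFun.symm.bijective.comp ⟨fun v w hvw => ?_, fun f => ?_⟩
  · refine Prod.ext (funext fun j => congrFun hvw (.inl (.inl j)))
      (Prod.ext (funext fun j => congrFun hvw (.inl (.inr j))) (funext fun l => congrFun hvw (.inr l)))
  · refine ⟨(fun j => f (.inl (.inl j)), fun j => f (.inl (.inr j)), fun l => f (.inr l)), ?_⟩
    ext ((i | i) | i) <;> rfl

/-- The inverse of the exponential coordinates as a real linear map to `ℂⁿ⁺ᵏ`. -/
def coord : 𝔤 →ₗ[ℝ] (Fin n → ℂ) × (Fin k → ℂ) :=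
  b.basis.constr ℝ (Sum.elim (Sum.elim (fun j => (Pi.single j 1, 0))
    (fun j => (Pi.single j Complex.I, 0))) fun l => (0, Pi.single l 1))

theorem coord_X (j : Fin n) : b.coord (b.basis𝔥 (.inl j)) = (Pi.single j 1, 0) := by
  rw [← basis_inl, coord, Module.Basis.constr_basis]; rfl

theorem coord_JX (j : Fin n) : b.coord (b.basis𝔥 (.inr j)) = (Pi.single j Complex.I, 0) := by
  rw [← basis_inl, coord, Module.Basis.constr_basis]; rfl

theorem coord_T (l : Fin k) : b.coord (b.basis𝔫 l) = (0, Pi.single l 1) := by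
  rw [← basis_inr, coord, Module.Basis.constr_basis]; rfl

theorem coord_realVec (x y : Fin n → ℝ) (t : Fin k → ℝ) :
    b.coord (b.realVec (x, y, t)) =
      (fun j => (x j : ℂ) + Complex.I * (y j : ℂ), fun l => (t l : ℂ)) := by
  simp only [realVec, map_add, map_sum, map_smul, coord_X, coord_JX, coord_T]
  ext j
  · simp [Prod.fst_sum, Finset.sum_apply, Pi.single_apply, mul_comm]
  · simp [Prod.snd_sum, Finset.sum_apply, Pi.single_apply]

theorem coord_J (X : S.𝔥) : b.coord (S.J X : S.𝔥) = Complex.I • b.coord X := by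
  have h : b.coord ∘ₗ S.𝔥.subtype ∘ₗ S.J = Complex.I • (b.coord ∘ₗ S.𝔥.subtype) := by
    refine b.basis𝔥.ext fun i => ?_
    simp only [LinearMap.comp_apply, Submodule.subtype_apply, LinearMap.smul_apply]
    rcases i with j | j
    · rw [← b.basis𝔥_inr, coord_X, coord_JX]
      ext <;> simp [Pi.single_apply]
    · rw [b.basis𝔥_inr, S.J_sq, Submodule.coe_neg, map_neg, ← b.basis𝔥_inr, coord_X, coord_JX]
      ext <;> simp [Pi.single_apply, apply_ite]
  exact DFunLike.congr_fun h X

theorem coord_mem_𝔫 {T : 𝔤} (hT : T ∈ S.𝔫) : (b.coord T).1 = 0 := by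
  refine b.mem_of_mem_𝔫 (P := LinearMap.ker
    (LinearMap.fst ℝ (Fin n → ℂ) (Fin k → ℂ) ∘ₗ b.coord)) (fun l => ?_) hT
  rw [LinearMap.mem_ker, LinearMap.comp_apply, coord_T]
  rfl

/-- The complex linear extension of `coord`. -/
def complexCoord : ℂ ⊗[ℝ] 𝔤 →ₗ[ℂ] (Fin n → ℂ) × (Fin k → ℂ) :=
  LinearMap.liftBaseChange ℂ b.coord

@[simp]
theorem complexCoord_tmul (c : ℂ) (x : 𝔤) : b.complexCoord (c ⊗ₜ[ℝ] x) = c • b.coord x := by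
  simp [complexCoord]

/-- `complexVec` as a linear map. -/
def complexVecLin : ((Fin n → ℂ) × (Fin k → ℂ)) →ₗ[ℂ] ℂ ⊗[ℝ] 𝔤 where
  toFun := b.complexVec
  map_add' v w := by
    simp only [complexVec, Prod.fst_add, Prod.snd_add, Pi.add_apply, add_div, add_smul,
      Finset.sum_add_distrib]
    abel
  map_smul' c v := by
    simp only [complexVec, Prod.smul_fst, Prod.smul_snd, Pi.smul_apply, smul_add, Finset.smul_sum,
      smul_smul, smul_eq_mul, mul_div_assoc, RingHom.id_apply]

theorem complexVecLin_apply (v : (Fin n → ℂ) × (Fin k → ℂ)) :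
    b.complexVecLin v = b.complexVec v := rfl

theorem complexCoord_vec01 (X : S.𝔥) : b.complexCoord (vec01 S.J X) = 0 := by
  rw [vec01, map_add, complexCoord_tmul, complexCoord_tmul, coord_J, smul_smul, Complex.I_mul_I,
    ← add_smul]
  simp

theorem complexCoord_vec10 (X : S.𝔥) :
    b.complexCoord (vec10 S.J X) = (2 : ℂ) • b.coord X := by
  rw [vec10, map_sub, complexCoord_tmul, complexCoord_tmul, coord_J, smul_smul, Complex.I_mul_I,
    ← sub_smul]
  norm_num

theorem complexCoord_complexVec (v : (Fin n → ℂ) × (Fin k → ℂ)) :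
    b.complexCoord (b.complexVec v) = v := by
  simp only [complexVec, map_add, map_sum, map_smul, complexCoord_vec10, complexCoord_tmul, coord_X,
    coord_T]
  ext j
  · simp [Prod.fst_sum, Finset.sum_apply, Pi.single_apply]
  · simp [Prod.snd_sum, Finset.sum_apply, Pi.single_apply]

theorem complexCoord_subN {u : ℂ ⊗[ℝ] 𝔤} (hu : u ∈ S.subN) : (b.complexCoord u).1 = 0 := by
  have h : S.subN ≤ LinearMap.ker
      (LinearMap.fst ℂ (Fin n → ℂ) (Fin k → ℂ) ∘ₗ b.complexCoord) := by
    rw [subN, Submodule.baseChange_eq_span]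
    refine Submodule.span_le.2 ?_
    rintro _ ⟨T, hT, rfl⟩
    simp [b.coord_mem_𝔫 hT]
  exact h hu

theorem complexVec_coord_𝔥 (X : S.𝔥) : b.complexVec (b.coord X) = (2⁻¹ : ℂ) • vec10 S.J X := by
  have h0 : ∀ j, b.complexVec (b.coord (b.basis𝔥 (.inl j))) =
      (2⁻¹ : ℂ) • vec10 S.J (b.basis𝔥 (.inl j)) := fun j => by
    rw [coord_X]
    simp [complexVec, Pi.single_apply, ite_div]
  have h : (b.complexVecLin.restrictScalars ℝ ∘ₗ b.coord) ∘ₗ S.𝔥.subtype =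
      (2⁻¹ : ℂ) • S.lin10 := by
    refine b.basis𝔥.ext fun i => ?_
    rcases i with j | j
    · exact h0 j
    · have h1 : vec10 S.J (S.J (b.basis𝔥 (.inl j))) =
          Complex.I • vec10 S.J (b.basis𝔥 (.inl j)) := by
        rw [S.smul_vec10]; simp
      change b.complexVecLin (b.coord (b.basis𝔥 (.inr j))) = (2⁻¹ : ℂ) • vec10 S.J _
      rw [b.basis𝔥_inr, coord_J, map_smul, complexVecLin_apply, h0, h1, smul_comm]
  exact DFunLike.congr_fun h X

theorem complexVec_coord_𝔫 {T : 𝔤} (hT : T ∈ S.𝔫) :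
    b.complexVec (b.coord T) = (1 : ℂ) ⊗ₜ[ℝ] T := by
  refine b.mem_of_mem_𝔫 (P := LinearMap.eqLocus (b.complexVecLin.restrictScalars ℝ ∘ₗ b.coord)
    (TensorProduct.mk ℝ ℂ 𝔤 1)) (fun l => ?_) hT
  rw [LinearMap.mem_eqLocus, LinearMap.comp_apply, coord_T]
  simp [complexVecLin_apply, complexVec, Pi.single_apply]

/-- So u ↦ complexVec (complexCoord u) is the projection to 𝔪 along 𝔥⁰¹. On 𝔥 it is X = ½(X − iJX) +
½(X + iJX), which accounts for the halves in `complexVec`. -/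
theorem sub_complexVec_mem (u : ℂ ⊗[ℝ] 𝔤) :
    u - b.complexVec (b.complexCoord u) ∈ S.sub01 := by
  have h : ∀ x : 𝔤, (1 : ℂ) ⊗ₜ[ℝ] x - b.complexVec (b.coord x) ∈ S.sub01 := fun x => by
    obtain ⟨X, hX, T, hT, rfl⟩ := Submodule.mem_sup.1
      (S.isCompl.sup_eq_top ▸ Submodule.mem_top (x := x))
    rw [map_add, ← complexVecLin_apply, map_add, complexVecLin_apply, complexVecLin_apply,
      b.complexVec_coord_𝔫 hT, b.complexVec_coord_𝔥 ⟨X, hX⟩, TensorProduct.tmul_add,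
      add_sub_add_right_eq_sub]
    have h1 : (1 : ℂ) ⊗ₜ[ℝ] X - (2⁻¹ : ℂ) • vec10 S.J ⟨X, hX⟩ =
        (2⁻¹ : ℂ) • vec01 S.J ⟨X, hX⟩ := by
      simp only [vec10, vec01]
      module
    rw [h1]
    exact S.sub01.smul_mem _ ⟨_, rfl⟩
  induction u with
  | zero =>
    have := S.sub01.zero_mem
    rwa [map_zero, ← complexVecLin_apply, map_zero, sub_zero]
  | add u v hu hv =>
    rw [map_add, ← complexVecLin_apply, map_add, add_sub_add_comm]
    exact add_mem hu hv
  | tmul c x =>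
    have h1 : c ⊗ₜ[ℝ] x = c • ((1 : ℂ) ⊗ₜ[ℝ] x) := by simp [TensorProduct.smul_tmul']
    rw [complexCoord_tmul, ← complexVecLin_apply, map_smul, h1, ← smul_sub]
    exact S.sub01.smul_mem _ (h x)

theorem ker_complexCoord : LinearMap.ker b.complexCoord = S.sub01 := by
  refine le_antisymm (fun u hu => ?_) ?_
  · have := b.sub_complexVec_mem u
    rwa [LinearMap.mem_ker.1 hu, ← complexVecLin_apply, map_zero, sub_zero] at this
  · rintro _ ⟨X, rfl⟩
    exact b.complexCoord_vec01 X

theorem range_complexVecLin : LinearMap.range b.complexVecLin = S.sub10 ⊔ S.subN := by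
  refine le_antisymm ?_ (sup_le ?_ ?_)
  · rintro _ ⟨v, rfl⟩
    refine add_mem (Submodule.mem_sup_left ?_) (Submodule.mem_sup_right ?_)
    · exact sum_mem fun j _ => S.sub10.smul_mem _ ⟨_, rfl⟩
    · exact sum_mem fun l _ => S.subN.smul_mem _ (S.tmul_mem_subN 1 (b.basis𝔫 l).2)
  · rintro _ ⟨X, rfl⟩
    refine ⟨(2 : ℂ) • b.coord X, ?_⟩
    rw [map_smul, complexVecLin_apply, b.complexVec_coord_𝔥, smul_smul]
    norm_num
  · rw [subN, Submodule.baseChange_eq_span]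
    refine Submodule.span_le.2 ?_
    rintro _ ⟨T, hT, rfl⟩
    exact ⟨b.coord T, b.complexVec_coord_𝔫 hT⟩

end HorizontalCR.AdaptedBasis

/-! ### The projection to a complementary subgroup -/

namespace NilBracket

/-- A map that preserves polynomial maps is smooth. -/
theorem contDiff_of_forall_mem_polyMaps.{u, v} {𝕜 : Type v} [RCLike 𝕜] {L : Type u}
    [NormedAddCommGroup L] [NormedSpace 𝕜 L] [FiniteDimensional 𝕜 L] {π : L → L}
    (hπ : ∀ (S σ : Type u) (c : S → σ → 𝕜) (f : S → L), f ∈ polyMaps c L →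
      (fun s => π (f s)) ∈ polyMaps c L) {n : WithTop ℕ∞} : ContDiff 𝕜 n π := by
  let b := Module.finBasis 𝕜 L
  let c : L → ULift (Fin _) → 𝕜 := fun x i => b.repr x i.down
  refine contDiff_of_mem_polyMaps (c := c) (fun i => ?_)
    (hπ L _ c id (mem_polyMaps_of_basis b fun i => coord_mem_polyMaps (c := c) ⟨i⟩))
  exact (LinearMap.toContinuousLinearMap (b.coord i.down)).contDiff

variable {V : Type} [NormedAddCommGroup V] [NormedSpace ℂ V] [FiniteDimensional ℂ V]
  {γ : NilBracket ℂ V} {A B : Submodule ℂ V} {π : V → V}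

/-- A real subgroup that meets the product of `B` and an ideal `N` of `A` in the ideal can be
recovered smoothly from its projection to `A`. -/
theorem exists_contDiff_leftInverse_factor [NormedSpace ℝ V] [IsScalarTower ℝ ℂ V]
    (hA : γ.IsClosed A) (hB : γ.IsClosed B) (hd : Disjoint A B)
    (hπA : ∀ g, π g ∈ A) (hπB : ∀ g, γ.bch (-π g) g ∈ B) (hπ : ContDiff ℂ ∞ π)
    {N : Submodule ℂ V} (hN : N ≤ A) (hBN : γ.IsClosed (B ⊔ N)) {D : Submodule ℝ V}
    (hD : γ.restrictReal.IsClosed D) (hDtop : D ⊔ (B ⊔ N).restrictScalars ℝ = ⊤)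
    (hDN : ∀ x ∈ D, x ∈ B ⊔ N → x ∈ N) :
    ∃ r : V → V, ContDiff ℝ ∞ r ∧ ∀ x ∈ D, r (π x) = x := by
  have : FiniteDimensional ℝ V := FiniteDimensional.trans ℝ ℂ V
  obtain ⟨ρ, hρD, hρB, hρ⟩ := exists_factorization (β := γ.restrictReal) hD
    (B := (B ⊔ N).restrictScalars ℝ) hBN hDtop
  have hρc : ContDiff ℝ ∞ ρ := contDiff_of_forall_mem_polyMaps hρ
  have hb : ContDiff ℝ ∞ fun p : V × V => γ.bch p.1 p.2 := by
    have := γ.restrictReal.contDiff_bch (n := ∞)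
    simpa only [restrictReal_bch] using this
  -- Here ρ is the D-factor for the factorization into exp D and exp(B + N). For x in D with m =
  -- π(x), the rest ρ(m)⁻¹ x lies in D and in B + N, so in N, where π is the identity. As m and x
  -- differ by B on the right, π(ρ(m)⁻¹ m) is that rest, and multiplying by ρ(m) returns x.
  refine ⟨fun m => γ.bch (ρ m) (π (γ.bch (-ρ m) m)), ?_, fun x hx => ?_⟩
  · exact hb.comp (hρc.prodMk ((hπ.restrict_scalars ℝ).comp
      (hb.comp (hρc.neg.prodMk contDiff_id))))
  · set m := π x
    have hDb : ∀ {X Y : V}, X ∈ D → Y ∈ D → γ.bch X Y ∈ D := fun hX hY => by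
      rw [← restrictReal_bch]
      exact γ.restrictReal.bch_mem D hD hX hY
    have h1 : γ.bch (-ρ m) m ∈ B ⊔ N := by
      have := hρB m
      rwa [restrictReal_bch] at this
    have h2 : γ.bch (-ρ m) x = γ.bch (γ.bch (-ρ m) m) (γ.bch (-m) x) := by
      rw [γ.bch_assoc, bch_bch_neg]
    have h3 : γ.bch (-ρ m) x ∈ N := by
      refine hDN _ (hDb (D.neg_mem (hρD m)) hx) ?_
      rw [h2]
      exact γ.bch_mem _ hBN h1 (Submodule.mem_sup_left (hπB x))
    have h4 : π (γ.bch (-ρ m) m) = π (γ.bch (-ρ m) x) := by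
      rw [eq_iff_bch_neg_mem hA hB hd hπA hπB, neg_bch, neg_neg, γ.bch_assoc, bch_bch_neg]
      exact hπB x
    change γ.bch (ρ m) (π (γ.bch (-ρ m) m)) = x
    rw [h4, factor_eq_of_mem hA hd hπA hπB (hN h3), bch_bch_neg]

/-- The differential of a function on left cosets vanishes on the subgroup. -/
theorem fderiv_comp_bch_eq_zero {W : Type*} [NormedAddCommGroup W] [NormedSpace ℂ W] {Φ : V → W}
    (hΦ : ContDiff ℂ ∞ Φ) (hΦB : ∀ g, ∀ y ∈ B, Φ (γ.bch g y) = Φ g) (g : V) {y : V} (hy : y ∈ B) :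
    fderiv ℂ (fun v => Φ (γ.bch g v)) 0 y = 0 := by
  have h1 : DifferentiableAt ℂ (fun v => Φ (γ.bch g v)) ((0 : ℂ) • y) :=
    (hΦ.comp (γ.contDiff_bch.comp (contDiff_const.prodMk contDiff_id))).differentiable
      (by simp) _
  have h2 : HasDerivAt (fun t : ℂ => t • y) y 0 := by
    simpa using (hasDerivAt_id (0 : ℂ)).smul_const y
  have h3 := h1.hasFDerivAt.comp_hasDerivAt (0 : ℂ) h2
  have h4 : (fun v => Φ (γ.bch g v)) ∘ (fun t : ℂ => t • y) = fun _ => Φ g :=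
    funext fun t => hΦB g _ (B.smul_mem t hy)
  rw [h4, zero_smul] at h3
  exact h3.unique (hasDerivAt_const _ _)

/-- The differential of a function on a complex group along a real subgroup. -/
theorem fderiv_comp_apply_mcInv {E : Type*} [NormedAddCommGroup E] [NormedSpace ℝ E]
    [FiniteDimensional ℝ E] [CompleteSpace E] {β : NilBracket ℝ E} [NormedSpace ℝ V]
    [IsScalarTower ℝ ℂ V] {W : Type*}
    [NormedAddCommGroup W] [NormedSpace ℂ W] [NormedSpace ℝ W] [IsScalarTower ℝ ℂ W] {Φ : V → W}
    (hΦ : ContDiff ℂ ∞ Φ) (j : E →L[ℝ] V) (hj : ∀ X Y, j (β.bch X Y) = γ.bch (j X) (j Y))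
    (X Y : E) :
    fderiv ℝ (fun v => Φ (j v)) X (β.mcInv X Y) = fderiv ℂ (fun v => Φ (γ.bch (j X) v)) 0 (j Y) := by
  have h1 : DifferentiableAt ℂ (fun v => Φ (γ.bch (j X) v)) (j ((0 : ℝ) • Y)) :=
    (hΦ.comp (γ.contDiff_bch.comp (contDiff_const.prodMk contDiff_id))).differentiable
      (by simp) _
  have h2 : HasDerivAt (fun t : ℝ => t • Y) Y 0 := by
    simpa using (hasDerivAt_id (0 : ℝ)).smul_const Y
  have h1' : HasFDerivAt (fun v => Φ (γ.bch (j X) v))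
      ((fderiv ℂ (fun v => Φ (γ.bch (j X) v)) (j ((0 : ℝ) • Y))).restrictScalars ℝ)
      (j ((0 : ℝ) • Y)) := h1.hasFDerivAt.restrictScalars ℝ
  have h3 : HasDerivAt (fun t : ℝ => Φ (γ.bch (j X) (j (t • Y))))
      (fderiv ℂ (fun v => Φ (γ.bch (j X) v)) (j ((0 : ℝ) • Y)) (j Y)) 0 :=
    HasFDerivAt.comp_hasDerivAt (f := fun t : ℝ => j (t • Y)) (0 : ℝ) h1'
      (j.hasFDerivAt.comp_hasDerivAt (0 : ℝ) h2)
  have h4 : DifferentiableAt ℝ (fun v => Φ (j v)) (β.bch X ((0 : ℝ) • Y)) :=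
    ((hΦ.restrict_scalars ℝ).comp j.contDiff).differentiable (by simp) _
  have h5 := h4.hasFDerivAt.comp_hasDerivAt (0 : ℝ) (β.hasDerivAt_bch_smul X Y 0)
  have h6 : (fun t : ℝ => Φ (γ.bch (j X) (j (t • Y)))) =
      (fun v => Φ (j v)) ∘ fun t : ℝ => β.bch X (t • Y) :=
    funext fun t => congrArg Φ (hj X (t • Y)).symm
  rw [h6] at h3
  have h7 := h5.unique h3
  rwa [zero_smul, map_zero, β.bch_zero_right] at h7

end NilBracket

/-! ### The Lie group of a nilpotent bracket -/

namespace NilGroup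

section

variable {𝕜 : Type*} [RCLike 𝕜] {L : Type*} [NormedAddCommGroup L] [NormedSpace 𝕜 L]
  (γ : NilBracket 𝕜 L) [FiniteDimensional 𝕜 L]

theorem lieGroup_of_contDiff {𝕂 : Type*} [NontriviallyNormedField 𝕂] [NormedSpace 𝕂 L]
    {n : WithTop ℕ∞} (h : ContDiff 𝕂 n fun p : L × L => γ.bch p.1 p.2) :
    LieGroup 𝓘(𝕂, L) n (NilGroup γ) := by
  have hM : IsManifold 𝓘(𝕂, L) n (NilGroup γ) := inferInstanceAs (IsManifold 𝓘(𝕂, L) n L)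
  have hmul : ContMDiff (𝓘(𝕂, L).prod 𝓘(𝕂, L)) 𝓘(𝕂, L) n fun p : L × L => γ.bch p.1 p.2 := by
    rw [← modelWithCornersSelf_prod, chartedSpaceSelf_prod]
    exact h.contMDiff
  have hinv : ContMDiff 𝓘(𝕂, L) 𝓘(𝕂, L) n fun x : L => -x := contDiff_neg.contMDiff
  exact { hM with
    contMDiff_mul := hmul
    contMDiff_inv := hinv }

instance (n : WithTop ℕ∞) : LieGroup 𝓘(𝕜, L) n (NilGroup γ) :=
  lieGroup_of_contDiff γ γ.contDiff_bch

theorem lieGroup_real [NormedSpace ℝ L] [IsScalarTower ℝ 𝕜 L] (n : WithTop ℕ∞) :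
    LieGroup 𝓘(ℝ, L) n (NilGroup γ) :=
  have := FiniteDimensional.trans ℝ 𝕜 L
  lieGroup_of_contDiff γ <| by
    simpa only [NilBracket.restrictReal_bch] using γ.restrictReal.contDiff_bch (n := n)

instance : SimplyConnectedSpace (NilGroup γ) := by
  let := NormedSpace.restrictScalars ℝ 𝕜 L
  have : ContractibleSpace L := inferInstance
  have : ContractibleSpace (NilGroup γ) := this
  infer_instance

/-- In exponential coordinates t ↦ tY is a one-parameter group, and translating its initial velocity
along it gives Y again, so it is the integral curve of the left-invariant field. -/
theorem modelExp_eq_of [NormedSpace ℝ L] [IsScalarTower ℝ 𝕜 L] (Y : L) :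
    modelExp (NilGroup γ) Y = of γ Y := by
  have := FiniteDimensional.trans ℝ 𝕜 L
  have := lieGroup_real γ ∞
  have : CompleteSpace L := FiniteDimensional.complete ℝ L
  have hd : ∀ a t : ℝ, HasMFDerivAt 𝓘(ℝ, ℝ) 𝓘(ℝ, L) (fun s : ℝ => of γ ((a + s) • Y)) t
      ((1 : ℝ →L[ℝ] ℝ).smulRight Y) := fun a t => by
    have h1 : HasDerivAt (fun s : ℝ => (a + s) • Y) Y t := by
      simpa using ((hasDerivAt_id t).const_add a).smul_const Y
    exact h1.hasFDerivAt.hasMFDerivAt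
  have h1 : modelExp (NilGroup γ) Y = of γ ((0 + 1 : ℝ) • Y) := by
    refine modelExp_eq_of_isMIntegralCurve (γ := fun s : ℝ => of γ ((0 + s) • Y))
      (by rw [add_zero, zero_smul]; rfl) fun t => ?_
    have h0 : of γ (((0 : ℝ) + 0) • Y) = 1 := by rw [add_zero, zero_smul]; rfl
    have hl : ∀ g : NilGroup γ, g = 1 → (leftField Y g : L) = Y := by
      rintro _ rfl
      exact leftField_one Y
    have h3 : HasMFDerivAt 𝓘(ℝ, ℝ) 𝓘(ℝ, L) (fun s : ℝ => of γ ((0 + s) • Y)) 0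
        ((1 : ℝ →L[ℝ] ℝ).smulRight (leftField Y (of γ (((0 : ℝ) + 0) • Y)))) :=
      (hd 0 0).congr_mfderiv
        (congrArg (fun v : L => (1 : ℝ →L[ℝ] ℝ).smulRight v) (hl _ h0).symm)
    have h4 := h3.left_mul (of γ (t • Y))
    have h5 : (fun s : ℝ => of γ (t • Y) * of γ ((0 + s) • Y)) =
        fun s : ℝ => of γ ((t + s) • Y) := by
      ext s
      have := γ.bch_smul_smul Y t (0 + s)
      simp only [← RCLike.algebraMap_eq_ofReal, algebraMap_smul] at this
      rw [of_mul, this, zero_add]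
    rw [h5] at h4
    have h6 := DFunLike.congr_fun (hasMFDerivAt_unique h4 (hd t 0)) (1 : ℝ)
    have h7 : ∀ g : NilGroup γ, g = of γ (t • Y) * of γ (((0 : ℝ) + 0) • Y) →
        (leftField Y g : L) = Y := by
      rintro _ rfl
      refine Eq.trans (one_smul ℝ _).symm (h6.trans (one_smul ℝ Y))
    exact (hd 0 t).congr_mfderiv
      (congrArg (fun v : L => (1 : ℝ →L[ℝ] ℝ).smulRight v)
        (h7 _ (by beta_reduce; rw [h0, mul_one, zero_add])).symm)
  rw [h1, zero_add, one_smul]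

end

end NilGroup

/-! ### The complexification of a simply connected nilpotent Lie group -/

namespace IsBracketOf

open NilGroup

variable {E : Type*} [NormedAddCommGroup E] [NormedSpace ℝ E]
  {G : Type*} [TopologicalSpace G] [ChartedSpace E G] [Group G] [LieGroup 𝓘(ℝ, E) ∞ G]
  [T2Space G] [FiniteDimensional ℝ E] [CompleteSpace E] [SimplyConnectedSpace G]
  {β : NilBracket ℝ E} {d : ℕ} {γ : NilBracket ℂ (Fin d → ℂ)}

theorem modelLog_one (hβ : IsBracketOf β G) : hβ.modelLog 1 = 0 := by
  rw [← hβ.modelExp_zero, hβ.modelLog_modelExp]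

variable (hβ : IsBracketOf β G)

/-- The homomorphism of groups that is induced by a homomorphism of Lie algebras. -/
def inducedHom (j : E →L[ℝ] (Fin d → ℂ))
    (hj : ∀ X Y, j (β.bch X Y) = γ.bch (j X) (j Y)) : G →* NilGroup γ :=
  MonoidHom.mk' (fun g => of γ (j (hβ.modelLog g))) fun g h => by
    rw [hβ.modelLog_mul, hj, of_mul]

theorem contMDiff_inducedHom (j : E →L[ℝ] (Fin d → ℂ))
    (hj : ∀ X Y, j (β.bch X Y) = γ.bch (j X) (j Y)) :
    ContMDiff 𝓘(ℝ, E) 𝓘(ℝ, Fin d → ℂ) ∞ (hβ.inducedHom j hj) := by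
  have h : ContMDiff 𝓘(ℝ, E) 𝓘(ℝ, Fin d → ℂ) ∞ fun g => j (hβ.modelLog g) :=
    j.contMDiff.comp hβ.contMDiff_modelLog
  exact h

theorem derivOne_inducedHom (j : E →L[ℝ] (Fin d → ℂ))
    (hj : ∀ X Y, j (β.bch X Y) = γ.bch (j X) (j Y)) (X : GroupLieAlgebra 𝓘(ℝ, E) G) :
    derivOne (E := E) (d := d) (hβ.inducedHom j hj) X = j (lieModel E G X) := by
  have h1 : HasMFDerivAt 𝓘(ℝ, E) 𝓘(ℝ, E) hβ.modelLog 1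
      (mfderiv 𝓘(ℝ, E) 𝓘(ℝ, E) hβ.modelLog 1) :=
    ((hβ.contMDiff_modelLog 1).mdifferentiableAt (by simp)).hasMFDerivAt
  have h2 : HasMFDerivAt 𝓘(ℝ, E) 𝓘(ℝ, Fin d → ℂ) (fun g => j (hβ.modelLog g)) 1
      (j.comp (mfderiv 𝓘(ℝ, E) 𝓘(ℝ, E) hβ.modelLog 1 : E →L[ℝ] E)) :=
    (j.hasMFDerivAt (x := hβ.modelLog 1)).comp 1 h1
  have h3 : mfderiv 𝓘(ℝ, E) 𝓘(ℝ, Fin d → ℂ) (hβ.inducedHom j hj) 1 =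
      j.comp (mfderiv 𝓘(ℝ, E) 𝓘(ℝ, E) hβ.modelLog 1 : E →L[ℝ] E) := HasMFDerivAt.mfderiv h2
  have h4 : (mfderiv 𝓘(ℝ, E) 𝓘(ℝ, E) hβ.modelLog 1 : E →L[ℝ] E) (lieModel E G X) =
      lieModel E G X := by
    have h5 := hβ.mfderiv_modelLog 1 (lieModel E G X)
    have h6 : leftField (lieModel E G X) (1 : G) = lieModel E G X := leftField_one _
    have h7 : β.mcInv (hβ.modelLog 1) (lieModel E G X) = lieModel E G X := by
      rw [hβ.modelLog_one]
      have := β.mcInv_mc 0 (lieModel E G X)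
      rwa [β.mc_zero] at this
    exact (congrArg (mfderiv 𝓘(ℝ, E) 𝓘(ℝ, E) hβ.modelLog 1 : E →L[ℝ] E) h6).symm.trans
      (h5.trans h7)
  exact (DFunLike.congr_fun h3 X).trans (congrArg j h4)

theorem complexDerivOne_inducedHom (Θ : ℂ ⊗[ℝ] GroupLieAlgebra 𝓘(ℝ, E) G ≃ₗ[ℂ] (Fin d → ℂ))
    (j : E →L[ℝ] (Fin d → ℂ)) (hjΘ : ∀ X, j (lieModel E G X) = Θ (1 ⊗ₜ X))
    (hj : ∀ X Y, j (β.bch X Y) = γ.bch (j X) (j Y)) (z : ℂ ⊗[ℝ] GroupLieAlgebra 𝓘(ℝ, E) G) :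
    complexDerivOne (E := E) (d := d) (hβ.inducedHom j hj) z = Θ z := by
  induction z with
  | zero => rw [map_zero, map_zero]
  | add u v hu hv => rw [map_add, map_add, hu, hv]
  | tmul c X =>
    rw [complexDerivOne, LinearMap.liftBaseChange_tmul, derivOne_inducedHom, hjΘ, ← map_smul,
      TensorProduct.smul_tmul', smul_eq_mul, mul_one]

/-- The complexification of a simply connected nilpotent Lie group. -/
def complexification (Θ : ℂ ⊗[ℝ] GroupLieAlgebra 𝓘(ℝ, E) G ≃ₗ[ℂ] (Fin d → ℂ))
    (j : E →L[ℝ] (Fin d → ℂ)) (hjΘ : ∀ X, j (lieModel E G X) = Θ (1 ⊗ₜ X))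
    (hj : ∀ X Y, j (β.bch X Y) = γ.bch (j X) (j Y)) : Complexification (E := E) G where
  dim := d
  carrier := NilGroup γ
  incl := hβ.inducedHom j hj
  incl_smooth := hβ.contMDiff_inducedHom j hj
  bijective := by
    have h := funext (hβ.complexDerivOne_inducedHom Θ j hjΘ hj)
    exact h ▸ Θ.bijective

theorem complexification_exp (Θ : ℂ ⊗[ℝ] GroupLieAlgebra 𝓘(ℝ, E) G ≃ₗ[ℂ] (Fin d → ℂ))
    (j : E →L[ℝ] (Fin d → ℂ)) (hjΘ : ∀ X, j (lieModel E G X) = Θ (1 ⊗ₜ X))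
    (hj : ∀ X Y, j (β.bch X Y) = γ.bch (j X) (j Y)) (z : ℂ ⊗[ℝ] GroupLieAlgebra 𝓘(ℝ, E) G) :
    (hβ.complexification Θ j hjΘ hj).exp z = of γ (Θ z) := by
  have h1 : modelExp (NilGroup γ) (complexDerivOne (E := E) (d := d) (hβ.inducedHom j hj) z) =
      of γ (Θ z) := by
    rw [hβ.complexDerivOne_inducedHom Θ j hjΘ hj, modelExp_eq_of]
  exact h1

end IsBracketOf

/-- A nilpotent Lie group and the complexification of its Lie algebra in coordinates. -/
theorem exists_nilBracket_complexification {E : Type*} [NormedAddCommGroup E] [NormedSpace ℝ E]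
    [FiniteDimensional ℝ E] [CompleteSpace E] (G : Type*) [TopologicalSpace G] [ChartedSpace E G]
    [Group G] [LieGroup 𝓘(ℝ, E) ∞ G] [LieRing.IsNilpotent (GroupLieAlgebra 𝓘(ℝ, E) G)] :
    ∃ (β : NilBracket ℝ E) (d : ℕ) (Θ : ℂ ⊗[ℝ] GroupLieAlgebra 𝓘(ℝ, E) G ≃ₗ[ℂ] (Fin d → ℂ))
      (γ : NilBracket ℂ (Fin d → ℂ)) (j : E →L[ℝ] (Fin d → ℂ)),
      IsBracketOf β G ∧ (∀ u v, γ.br (Θ u) (Θ v) = Θ ⁅u, v⁆) ∧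
      (∀ X, j (lieModel E G X) = Θ (1 ⊗ₜ X)) ∧ ∀ X Y, j (β.bch X Y) = γ.bch (j X) (j Y) := by
  have hfd : FiniteDimensional ℝ (GroupLieAlgebra 𝓘(ℝ, E) G) :=
    inferInstanceAs (FiniteDimensional ℝ E)
  obtain ⟨c, hc⟩ := (LieModule.isNilpotent_iff ℝ (GroupLieAlgebra 𝓘(ℝ, E) G)
    (GroupLieAlgebra 𝓘(ℝ, E) G)).1 inferInstance
  -- The lower central series commutes with base change, so one class c serves for both brackets, as
  -- naturality of the product demands.
  have hc' : LieModule.lowerCentralSeries ℂ (ℂ ⊗[ℝ] GroupLieAlgebra 𝓘(ℝ, E) G)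
      (ℂ ⊗[ℝ] GroupLieAlgebra 𝓘(ℝ, E) G) c = ⊥ := by
    have h := LieSubmodule.lowerCentralSeries_tensor_eq_baseChange (R := ℝ) (A := ℂ)
      (L := GroupLieAlgebra 𝓘(ℝ, E) G) (M := GroupLieAlgebra 𝓘(ℝ, E) G) c
    rw [hc, LieSubmodule.baseChange_bot] at h
    exact h
  let Θ := (Module.finBasis ℂ (ℂ ⊗[ℝ] GroupLieAlgebra 𝓘(ℝ, E) G)).equivFun
  let j : E →L[ℝ] (Fin _ → ℂ) := LinearMap.toContinuousLinearMap
    (Θ.toLinearMap.restrictScalars ℝ ∘ₗ TensorProduct.mk ℝ ℂ _ 1 ∘ₗ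
      (lieModel E G).symm.toLinearMap)
  let β := NilBracket.ofLie (lieModel E G) c hc
  let γ := NilBracket.ofLie Θ c hc'
  have hγ : ∀ u v, γ.br (Θ u) (Θ v) = Θ ⁅u, v⁆ := fun u v => by
    rw [NilBracket.ofLie_br, Θ.symm_apply_apply, Θ.symm_apply_apply]
  have hj : ∀ X, j X = Θ (1 ⊗ₜ (lieModel E G).symm X) := fun X => rfl
  refine ⟨β, _, Θ, γ, j, fun X Y => NilBracket.ofLie_br .., hγ, fun X => rfl, fun X Y => ?_⟩
  refine β.bch_map γ rfl j.toLinearMap.toAddMonoidHom (fun q x => ?_) (fun x y => ?_) X Y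
  · have h1 : ((q : ℂ)) = ((q : ℝ) : ℂ) := by simp
    rw [h1]
    exact (j.map_smul (q : ℝ) x).trans (algebraMap_smul ℂ (q : ℝ) (j x)).symm
  · change j _ = γ.br (j x) (j y)
    rw [hj x, hj y, hγ, LieAlgebra.ExtendScalars.bracket_tmul, mul_one]
    rfl

/-! ### The projection of the complexification along `exp 𝔥⁰¹` -/

namespace HorizontalCR.AdaptedBasis

open NilBracket

variable {𝔤 : Type*} [LieRing 𝔤] [LieAlgebra ℝ 𝔤] {n k : ℕ} {S : HorizontalCR 𝔤 n k}
  (b : S.AdaptedBasis) {V : Type} [NormedAddCommGroup V] [NormedSpace ℂ V]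
  {γ : NilBracket ℂ V} {Θ : ℂ ⊗[ℝ] 𝔤 ≃ₗ[ℂ] V}

theorem isClosed_map (hγ : ∀ u v, γ.br (Θ u) (Θ v) = Θ ⁅u, v⁆) {D : Submodule ℂ (ℂ ⊗[ℝ] 𝔤)}
    (hD : ∀ u ∈ D, ∀ v ∈ D, ⁅u, v⁆ ∈ D) : γ.IsClosed (D.map Θ.toLinearMap) := by
  rintro _ ⟨u, hu, rfl⟩ _ ⟨v, hv, rfl⟩
  exact ⟨_, hD u hu v hv, (hγ u v).symm⟩

theorem disjoint_map (b : S.AdaptedBasis) : Disjoint ((S.sub10 ⊔ S.subN).map Θ.toLinearMap)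
    (S.sub01.map Θ.toLinearMap) := by
  rw [Submodule.disjoint_def]
  rintro _ ⟨u, hu, rfl⟩ ⟨v, hv, hvu⟩
  obtain rfl := Θ.injective hvu
  rw [SetLike.mem_coe, ← b.range_complexVecLin] at hu
  rw [SetLike.mem_coe, ← b.ker_complexCoord, LinearMap.mem_ker] at hv
  obtain ⟨w, rfl⟩ := hu
  rw [complexVecLin_apply, complexCoord_complexVec] at hv
  rw [hv, map_zero, map_zero]

theorem map_sup_map_eq_top (b : S.AdaptedBasis) : (S.sub10 ⊔ S.subN).map Θ.toLinearMap ⊔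
    S.sub01.map Θ.toLinearMap = ⊤ := by
  rw [← Submodule.map_sup, eq_top_iff]
  intro x _
  refine ⟨Θ.symm x, ?_, Θ.apply_symm_apply x⟩
  rw [← add_sub_cancel (b.complexVec (b.complexCoord (Θ.symm x))) (Θ.symm x)]
  refine Submodule.add_mem_sup ?_ (b.sub_complexVec_mem _)
  rw [← b.range_complexVecLin]
  exact ⟨_, rfl⟩

theorem realVec_mem_𝔫 (t : Fin k → ℝ) : b.realVec (0, 0, t) ∈ S.𝔫 := by
  have h : b.realVec (0, 0, t) = ∑ l, t l • (b.basis𝔫 l : 𝔤) := by simp [realVec]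
  rw [h]
  exact sum_mem fun l _ => S.𝔫.smul_mem _ (b.basis𝔫 l).2

theorem mem_𝔫_of_coord_eq_zero {X : 𝔤} (hX : (b.coord X).1 = 0) : X ∈ S.𝔫 := by
  obtain ⟨⟨x, y, t⟩, rfl⟩ := b.bijective_realVec.2 X
  rw [coord_realVec] at hX
  have hx : x = 0 := funext fun j => by simpa using congrArg Complex.re (congrFun hX j)
  have hy : y = 0 := funext fun j => by simpa using congrArg Complex.im (congrFun hX j)
  rw [hx, hy]
  exact b.realVec_mem_𝔫 t

theorem mem_𝔫_of_tmul_mem (b : S.AdaptedBasis) {X : 𝔤} (hX : (1 : ℂ) ⊗ₜ[ℝ] X ∈ S.sub01 ⊔ S.subN) : X ∈ S.𝔫 := by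
  refine b.mem_𝔫_of_coord_eq_zero ?_
  obtain ⟨u, hu, v, hv, h⟩ := Submodule.mem_sup.1 hX
  have h1 := congrArg b.complexCoord h
  rw [map_add, complexCoord_tmul, one_smul] at h1
  rw [← b.ker_complexCoord, LinearMap.mem_ker] at hu
  rw [← h1, hu, zero_add, b.complexCoord_subN hv]

variable (Θ) in
/-- The complexification in exponential coordinates is polynomial. -/
theorem tmul_realVec_mem_polyMaps :
    (fun s => Θ ((1 : ℂ) ⊗ₜ[ℝ] b.realVec s)) ∈ polyMaps (𝕜 := ℂ)
      (fun (s : (Fin n → ℝ) × (Fin n → ℝ) × (Fin k → ℝ)) => (Sum.elim (Sum.elim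
        (fun i => (s.1 i : ℂ)) (fun i => (s.2.1 i : ℂ))) (fun i => (s.2.2 i : ℂ)) :
          (Fin n ⊕ Fin n) ⊕ Fin k → ℂ)) V := by
  set c := fun (s : (Fin n → ℝ) × (Fin n → ℝ) × (Fin k → ℝ)) => (Sum.elim (Sum.elim
        (fun i => (s.1 i : ℂ)) (fun i => (s.2.1 i : ℂ))) (fun i => (s.2.2 i : ℂ)) :
          (Fin n ⊕ Fin n) ⊕ Fin k → ℂ) with hc
  have h : (fun s => Θ ((1 : ℂ) ⊗ₜ[ℝ] b.realVec s)) =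
      ∑ i, fun s => c s i • Θ ((1 : ℂ) ⊗ₜ[ℝ] b.basis i) := by
    ext1 s
    have h1 : ∀ (r : ℝ) (x : 𝔤), (1 : ℂ) ⊗ₜ[ℝ] (r • x) = (r : ℂ) • ((1 : ℂ) ⊗ₜ[ℝ] x) :=
      fun r x => by simp [TensorProduct.smul_tmul']
    simp only [realVec_eq, Module.Basis.equivFun_symm_apply, TensorProduct.tmul_sum, map_sum, h1,
      map_smul, Finset.sum_apply]
    refine Finset.sum_congr rfl fun i _ => ?_
    rcases i with (i | i) | i <;> rfl
  rw [h]
  exact Submodule.sum_mem _ fun i _ =>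
    linear_mem_polyMaps (LinearMap.toSpanSingleton ℂ V _) (coord_mem_polyMaps (c := c) i)

/-- The projection of the complex group along `exp 𝔥⁰¹` in the coordinates of `exp 𝔪`: it is
holomorphic, polynomial of the required form on the real group, and smoothly invertible there. -/
theorem exists_projection [FiniteDimensional ℂ V] [NormedSpace ℝ V] [IsScalarTower ℝ ℂ V]
    (b : S.AdaptedBasis) (hγ : ∀ u v, γ.br (Θ u) (Θ v) = Θ ⁅u, v⁆) :
    ∃ (Φ : V → (Fin n → ℂ) × (Fin k → ℂ)) (p : Fin n → MvPolynomial (Fin n ⊕ Fin n) ℂ)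
      (q : Fin k → MvPolynomial ((Fin n ⊕ Fin n) ⊕ Fin k) ℂ)
      (R : (Fin n → ℂ) × (Fin k → ℂ) → V),
      ContDiff ℂ ∞ Φ ∧
      (∀ g g', Φ g = Φ g' ↔ γ.bch (-g) g' ∈ S.sub01.map Θ.toLinearMap) ∧
      (∀ v, Φ (Θ (b.complexVec v)) = v) ∧
      (∀ (x y : Fin n → ℝ) (t : Fin k → ℝ), Φ (Θ ((1 : ℂ) ⊗ₜ[ℝ] b.realVec (x, y, t))) =
        (fun j => (x j : ℂ) + Complex.I * (y j : ℂ) +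
            MvPolynomial.eval (Sum.elim (fun i => (x i : ℂ)) (fun i => (y i : ℂ))) (p j),
          fun l => (t l : ℂ) +
            MvPolynomial.eval (Sum.elim (Sum.elim (fun i => (x i : ℂ)) (fun i => (y i : ℂ)))
              (fun i => (t i : ℂ))) (q l))) ∧
      ContDiff ℝ ∞ R ∧ ∀ X : 𝔤, R (Φ (Θ ((1 : ℂ) ⊗ₜ[ℝ] X))) = Θ ((1 : ℂ) ⊗ₜ[ℝ] X) := by
  let A := (S.sub10 ⊔ S.subN).map Θ.toLinearMap
  let B := S.sub01.map Θ.toLinearMap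
  let N := S.subN.map Θ.toLinearMap
  have hA : γ.IsClosed A := isClosed_map hγ fun u hu v hv => S.lie_mem_sub10_sup_subN hu hv
  have hB : γ.IsClosed B := isClosed_map hγ fun u hu v hv => S.lie_mem_sub01 hu hv
  have hd : Disjoint A B := b.disjoint_map
  obtain ⟨π, hπA, hπB, hπ⟩ := exists_factorization hA hB b.map_sup_map_eq_top
  have hπc : ContDiff ℂ ∞ π := contDiff_of_forall_mem_polyMaps hπ
  let κ : V →ₗ[ℂ] (Fin n → ℂ) × (Fin k → ℂ) := b.complexCoord ∘ₗ Θ.symm.toLinearMap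
  have hκ : ∀ u, κ (Θ u) = b.complexCoord u := fun u =>
    congrArg b.complexCoord (Θ.symm_apply_apply u)
  have hκA : ∀ a ∈ A, Θ (b.complexVec (κ a)) = a := by
    rintro _ ⟨u, hu, rfl⟩
    rw [SetLike.mem_coe, ← b.range_complexVecLin] at hu
    obtain ⟨w, rfl⟩ := hu
    change Θ (b.complexVec (κ (Θ _))) = Θ _
    rw [hκ, complexVecLin_apply, complexCoord_complexVec]
  let Φ : V → (Fin n → ℂ) × (Fin k → ℂ) := fun g => κ (π g)
  have hN : N ≤ A := Submodule.map_mono le_sup_right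
  have hNi : ∀ x, ∀ y ∈ N, γ.br x y ∈ N := by
    rintro x _ ⟨v, hv, rfl⟩
    refine ⟨_, S.lie_mem_subN (Θ.symm x) hv, ?_⟩
    change Θ _ = γ.br x (Θ v)
    rw [← hγ, Θ.apply_symm_apply]
  have hBN : γ.IsClosed (B ⊔ N) := by
    rw [← Submodule.map_sup]
    exact isClosed_map hγ fun u hu v hv => S.lie_mem_sub01_sup_subN hu hv
  let D : Submodule ℝ V := LinearMap.range
    (Θ.toLinearMap.restrictScalars ℝ ∘ₗ TensorProduct.mk ℝ ℂ 𝔤 1)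
  have hD : γ.restrictReal.IsClosed D := by
    rintro _ ⟨X, rfl⟩ _ ⟨Y, rfl⟩
    refine ⟨⁅X, Y⁆, ?_⟩
    change Θ (1 ⊗ₜ ⁅X, Y⁆) = γ.br (Θ (1 ⊗ₜ X)) (Θ (1 ⊗ₜ Y))
    rw [hγ, LieAlgebra.ExtendScalars.bracket_tmul, mul_one]
  have hDtop : D ⊔ (B ⊔ N).restrictScalars ℝ = ⊤ := by
    rw [eq_top_iff]
    intro x _
    obtain ⟨X, v, hv, h⟩ := S.exists_eq_tmul_add (Θ.symm x)
    rw [← Θ.apply_symm_apply x, h, map_add]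
    refine Submodule.add_mem_sup ⟨X, rfl⟩ ?_
    rw [Submodule.restrictScalars_mem, ← Submodule.map_sup]
    exact ⟨v, hv, rfl⟩
  have hDN : ∀ x ∈ D, x ∈ B ⊔ N → x ∈ N := by
    rintro _ ⟨X, rfl⟩ hX
    rw [← Submodule.map_sup] at hX
    obtain ⟨u, hu, hX⟩ := hX
    obtain rfl := Θ.injective hX
    exact ⟨_, S.tmul_mem_subN 1 (b.mem_𝔫_of_tmul_mem hu), rfl⟩
  obtain ⟨r, hr, hrπ⟩ := exists_contDiff_leftInverse_factor hA hB hd hπA hπB hπc hN hBN hD hDtop hDN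
  -- Changing t moves the argument by 𝔫_ℂ, an ideal contained in 𝔪; the 𝔪-factor then changes by 𝔫_ℂ
  -- only, where the first n coordinates vanish.
  have hz : ∀ (x y : Fin n → ℝ) (t : Fin k → ℝ),
      (Φ (Θ ((1 : ℂ) ⊗ₜ[ℝ] b.realVec (x, y, t)))).1 =
        (Φ (Θ ((1 : ℂ) ⊗ₜ[ℝ] b.realVec (x, y, 0)))).1 := fun x y t => by
    have h1 : b.realVec (x, y, t) = b.realVec (x, y, 0) + b.realVec (0, 0, t) := by
      simp [realVec]
    have h2 := factor_sub_factor_mem hA hB hd hπA hπB hN hNi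
      (g := Θ ((1 : ℂ) ⊗ₜ[ℝ] b.realVec (x, y, 0))) (g' := Θ ((1 : ℂ) ⊗ₜ[ℝ] b.realVec (x, y, t))) (by
        rw [h1, TensorProduct.tmul_add, map_add, add_sub_cancel_left]
        exact ⟨_, S.tmul_mem_subN 1 (b.realVec_mem_𝔫 t), rfl⟩)
    obtain ⟨u, hu, h3⟩ := h2
    have h4 := congrArg κ h3
    rw [map_sub] at h4
    have h5 : (κ (Θ u)).1 = 0 := by rw [hκ, b.complexCoord_subN hu]
    have h6 := (congrArg Prod.fst h4).symm.trans h5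
    exact sub_eq_zero.1 h6
  have hW := linear_mem_polyMaps κ (hπ _ _ _ _ (b.tmul_realVec_mem_polyMaps Θ))
  have hp : ∀ j : Fin n, ∃ P : MvPolynomial (Fin n ⊕ Fin n) ℂ, ∀ x y : Fin n → ℝ,
      (Φ (Θ ((1 : ℂ) ⊗ₜ[ℝ] b.realVec (x, y, 0)))).1 j = (x j : ℂ) + Complex.I * (y j : ℂ) +
        MvPolynomial.eval (Sum.elim (fun i => (x i : ℂ)) (fun i => (y i : ℂ))) P := by
    intro j
    obtain ⟨Q, hQ⟩ := exists_eval_of_mem_polyMaps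
      (linear_mem_polyMaps (LinearMap.proj j ∘ₗ LinearMap.fst ℂ (Fin n → ℂ) (Fin k → ℂ)) hW)
    -- By independence of t, the polynomial is taken at t = 0, and the linear part x + iy is split
    -- off.
    refine ⟨MvPolynomial.bind₁ (Sum.elim MvPolynomial.X fun _ => 0) Q - MvPolynomial.X (.inl j) -
      MvPolynomial.C Complex.I * MvPolynomial.X (.inr j), fun x y => ?_⟩
    refine (hQ (x, y, 0)).trans ?_
    have h1 : MvPolynomial.eval (Sum.elim (fun i => (x i : ℂ)) (fun i => (y i : ℂ)))
        (MvPolynomial.bind₁ (Sum.elim MvPolynomial.X fun _ => 0) Q) = MvPolynomial.eval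
          (Sum.elim (Sum.elim (fun i => (x i : ℂ)) (fun i => (y i : ℂ)))
            (fun i : Fin k => (((0 : Fin k → ℝ) i : ℝ) : ℂ))) Q := by
      rw [← MvPolynomial.coe_aeval_eq_eval, ← MvPolynomial.coe_aeval_eq_eval]
      refine (MvPolynomial.aeval_bind₁ _ _ Q).trans ?_
      refine congrArg (fun f => MvPolynomial.aeval f Q) (funext fun i => ?_)
      rcases i with i | i <;> simp
    rw [map_sub, map_sub, h1]
    simp
  have hq : ∀ l : Fin k, ∃ P : MvPolynomial ((Fin n ⊕ Fin n) ⊕ Fin k) ℂ,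
      ∀ (x y : Fin n → ℝ) (t : Fin k → ℝ),
      (Φ (Θ ((1 : ℂ) ⊗ₜ[ℝ] b.realVec (x, y, t)))).2 l = (t l : ℂ) +
        MvPolynomial.eval (Sum.elim (Sum.elim (fun i => (x i : ℂ)) (fun i => (y i : ℂ)))
              (fun i => (t i : ℂ))) P := by
    intro l
    obtain ⟨Q, hQ⟩ := exists_eval_of_mem_polyMaps
      (linear_mem_polyMaps (LinearMap.proj l ∘ₗ LinearMap.snd ℂ (Fin n → ℂ) (Fin k → ℂ)) hW)
    refine ⟨Q - MvPolynomial.X (.inr l), fun x y t => ?_⟩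
    refine (hQ (x, y, t)).trans ?_
    simp
  choose p hp using hp
  choose q hq using hq
  refine ⟨Φ, p, q, fun w => r (Θ (b.complexVec w)), ?_, fun g g' => ?_, fun v => ?_,
    fun x y t => ?_, ?_, fun X => ?_⟩
  · exact (LinearMap.toContinuousLinearMap κ).contDiff.comp hπc
  · rw [← eq_iff_bch_neg_mem hA hB hd hπA hπB]
    refine ⟨fun h => ?_, fun h => congrArg κ h⟩
    rw [← hκA _ (hπA g), ← hκA _ (hπA g')]
    exact congrArg (fun w => Θ (b.complexVec w)) h
  · have h1 : Θ (b.complexVec v) ∈ A := by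
      refine ⟨_, ?_, rfl⟩
      rw [← b.range_complexVecLin]
      exact ⟨v, rfl⟩
    change κ (π _) = v
    rw [factor_eq_of_mem hA hd hπA hπB h1, hκ, complexCoord_complexVec]
  · refine Prod.ext ?_ (funext fun l => hq l x y t)
    rw [hz]
    exact funext fun j => hp j x y
  · have h1 := (LinearMap.toContinuousLinearMap (Θ.toLinearMap ∘ₗ b.complexVecLin)).contDiff (n := ∞)
    exact hr.comp (h1.restrict_scalars ℝ)
  · change r (Θ (b.complexVec (κ (π _)))) = _
    rw [hκA _ (hπA _)]
    exact hrπ _ ⟨X, rfl⟩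

end HorizontalCR.AdaptedBasis

/-! ### The embedding -/

namespace IsBracketOf

variable {E : Type*} [NormedAddCommGroup E] [NormedSpace ℝ E]
  {G : Type*} [TopologicalSpace G] [ChartedSpace E G] [Group G] [LieGroup 𝓘(ℝ, E) ∞ G]
  [T2Space G] [FiniteDimensional ℝ E] [CompleteSpace E] [SimplyConnectedSpace G]
  {β : NilBracket ℝ E} (hβ : IsBracketOf β G)

/-- The logarithm as a homeomorphism. -/
def logHomeomorph : G ≃ₜ E where
  toFun := hβ.modelLog
  invFun := modelExp G
  left_inv := hβ.modelExp_modelLog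
  right_inv := hβ.modelLog_modelExp
  continuous_toFun := hβ.contMDiff_modelLog.continuous
  continuous_invFun := hβ.contMDiff_modelExp.continuous

theorem bijective_lieExp (hβ : IsBracketOf β G) : Function.Bijective (lieExp : GroupLieAlgebra 𝓘(ℝ, E) G → G) :=
  (hβ.logHomeomorph.symm.bijective.comp (lieModel E G).bijective :)

theorem modelLog_lieExp (X : GroupLieAlgebra 𝓘(ℝ, E) G) :
    hβ.modelLog (lieExp X : G) = lieModel E G X :=
  hβ.modelLog_modelExp (lieModel E G X)

/-- A holomorphic function on the complex group that is invariant under `exp B` restricts to a CR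
embedding of the real group if its restriction has a smooth left inverse. -/
theorem isCREmbedding {V : Type} [NormedAddCommGroup V] [NormedSpace ℂ V] [FiniteDimensional ℂ V]
    [NormedSpace ℝ V] [IsScalarTower ℝ ℂ V] {γ : NilBracket ℂ V} {W : Type*}
    [NormedAddCommGroup W] [NormedSpace ℂ W] [NormedSpace ℝ W] [IsScalarTower ℝ ℂ W]
    [FiniteDimensional ℝ W] {n k : ℕ}
    (S : HorizontalCR (GroupLieAlgebra 𝓘(ℝ, E) G) n k) {B : Submodule ℂ V}
    {Φ : V → W} (hΦ : ContDiff ℂ ∞ Φ)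
    (hΦB : ∀ g, ∀ y ∈ B, Φ (γ.bch g y) = Φ g) (j : E →L[ℝ] V)
    (hj : ∀ X Y, j (β.bch X Y) = γ.bch (j X) (j Y))
    (hjB : ∀ X : S.𝔥, j (lieModel E G X) + Complex.I • j (lieModel E G (S.J X : S.𝔥)) ∈ B)
    {R : W → E} (hR : ContDiff ℝ ∞ R) (hRΦ : ∀ X, R (Φ (j X)) = X) :
    IsCREmbedding S fun g => Φ (j (hβ.modelLog g)) := by
  have hg : ContDiff ℝ ∞ fun X => Φ (j X) := (hΦ.restrict_scalars ℝ).comp j.contDiff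
  refine ⟨isSmoothEmbedding_of_leftInverse hβ.logHomeomorph hβ.contMDiff_modelLog
    hβ.contMDiff_modelExp hg hR hRΦ, fun g => ?_⟩
  set D := fderiv ℂ (fun v => Φ (γ.bch (j (hβ.modelLog g)) v)) 0 with hD
  have h1 : ∀ Y : E, (mfderiv 𝓘(ℝ, E) 𝓘(ℝ, W) (fun g => Φ (j (hβ.modelLog g))) g :
      TangentSpace 𝓘(ℝ, E) g →L[ℝ] W) (leftField Y g) = D (j Y) := fun Y => by
    have h2 : HasMFDerivAt 𝓘(ℝ, E) 𝓘(ℝ, E) hβ.modelLog g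
        (mfderiv 𝓘(ℝ, E) 𝓘(ℝ, E) hβ.modelLog g) :=
      ((hβ.contMDiff_modelLog g).mdifferentiableAt (by simp)).hasMFDerivAt
    have h3 := (hg.differentiable (by simp) (hβ.modelLog g)).hasFDerivAt.hasMFDerivAt.comp g h2
    have h4 := DFunLike.congr_fun h3.mfderiv (leftField Y g)
    refine h4.trans ?_
    refine (congrArg (fderiv ℝ (fun X => Φ (j X)) (hβ.modelLog g)) (hβ.mfderiv_modelLog g Y)).trans ?_
    exact NilBracket.fderiv_comp_apply_mcInv hΦ j hj _ Y
  rintro _ ⟨X, rfl⟩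
  refine ⟨D (j (lieModel E G X)), ?_⟩
  -- D is complex linear and kills the image of X + iJX because Φ is constant along exp B; solving
  -- for the JX term is the (0,1) condition.
  have h2 : D (j (lieModel E G (S.J X : S.𝔥))) = Complex.I • D (j (lieModel E G X)) := by
    have h3 := NilBracket.fderiv_comp_bch_eq_zero hΦ hΦB (j (hβ.modelLog g)) (hjB X)
    rw [← hD, map_add, map_smul] at h3
    rw [eq_neg_of_add_eq_zero_left h3, smul_neg, smul_smul, Complex.I_mul_I]
    simp
  rw [map_add, LinearMap.baseChange_tmul, LinearMap.baseChange_tmul, ← h2]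
  exact congrArg₂ (fun u v : W => (1 : ℂ) ⊗ₜ[ℝ] u + Complex.I ⊗ₜ[ℝ] v) (h1 (lieModel E G X))
    (h1 (lieModel E G (S.J X : S.𝔥)))

end IsBracketOf

end

theorem theorem1
    {E : Type*} [NormedAddCommGroup E] [NormedSpace ℝ E] [FiniteDimensional ℝ E] [CompleteSpace E]
    {G : Type*} [TopologicalSpace G] [ChartedSpace E G] [Group G] [LieGroup 𝓘(ℝ, E) ∞ G]
    [T2Space G] [SimplyConnectedSpace G]
    [LieRing.IsNilpotent (GroupLieAlgebra 𝓘(ℝ, E) G)]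
    {n k : ℕ} (S : HorizontalCR (GroupLieAlgebra 𝓘(ℝ, E) G) n k) :
    ∃ C : Complexification (E := E) G,
    Nonempty S.AdaptedBasis ∧
    ∀ b : S.AdaptedBasis,
      -- exponential coordinates on `G`
      Function.Bijective (fun v : (Fin n → ℝ) × (Fin n → ℝ) × (Fin k → ℝ) =>
        (lieExp (b.realVec v) : G)) ∧
      ∃ (ι : G → (Fin n → ℂ) × (Fin k → ℂ))
        (p : Fin n → MvPolynomial (Fin n ⊕ Fin n) ℂ)
        (q : Fin k → MvPolynomial ((Fin n ⊕ Fin n) ⊕ Fin k) ℂ)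
        (H01 : Subgroup C.carrier)
        (Φ : C.carrier → (Fin n → ℂ) × (Fin k → ℂ)),
        IsCREmbedding S ι ∧
        -- the polynomial form of `ι` in exponential coordinates
        (∀ (x y : Fin n → ℝ) (t : Fin k → ℝ),
          ι (lieExp (b.realVec (x, y, t))) =
            (fun j => (x j : ℂ) + Complex.I * (y j : ℂ) +
                MvPolynomial.eval (Sum.elim (fun i => (x i : ℂ)) (fun i => (y i : ℂ))) (p j),
             fun l => (t l : ℂ) +
                MvPolynomial.eval (Sum.elim (Sum.elim (fun i => (x i : ℂ)) (fun i => (y i : ℂ)))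
                  (fun i => (t i : ℂ))) (q l))) ∧
        -- `Φ` is the map `G_ℂ → G_ℂ / H⁰¹ ≅ M = exp (𝔥¹⁰ ⊕ 𝔫_ℂ) ≅ ℂⁿ⁺ᵏ`
        (H01 : Set C.carrier) = C.exp '' S.h01 ∧
        (∀ g g' : C.carrier, Φ g = Φ g' ↔ (g : C.carrier ⧸ H01) = (g' : C.carrier ⧸ H01)) ∧
        Set.range (fun v => C.exp (b.complexVec v)) = C.exp '' S.m ∧
        (∀ v, Φ (C.exp (b.complexVec v)) = v) ∧
        MDifferentiable 𝓘(ℂ, Fin C.dim → ℂ) 𝓘(ℂ, (Fin n → ℂ) × (Fin k → ℂ)) Φ ∧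
        MDifferentiable 𝓘(ℂ, (Fin n → ℂ) × (Fin k → ℂ)) 𝓘(ℂ, Fin C.dim → ℂ)
          (fun v => C.exp (b.complexVec v)) ∧
        -- `ι` is the restriction of `Φ` to `G`
        (∀ g : G, ι g = Φ (C.incl g)) := by
  have hfd : FiniteDimensional ℝ (GroupLieAlgebra 𝓘(ℝ, E) G) :=
    inferInstanceAs (FiniteDimensional ℝ E)
  obtain ⟨β, d, Θ, γ, j, hβ, hγ, hjΘ, hj⟩ := exists_nilBracket_complexification (E := E) G
  have hexp := hβ.complexification_exp Θ j hjΘ hj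
  refine ⟨hβ.complexification Θ j hjΘ hj, S.nonempty_adaptedBasis, fun b =>
    ⟨hβ.bijective_lieExp.comp b.bijective_realVec, ?_⟩⟩
  obtain ⟨Φ, p, q, R, hΦ, hΦB, hΦv, hpq, hR, hRΦ⟩ := b.exists_projection hγ
  have hB : γ.IsClosed (S.sub01.map Θ.toLinearMap) :=
    HorizontalCR.AdaptedBasis.isClosed_map hγ fun u hu v hv => S.lie_mem_sub01 hu hv
  -- The real part recovers an element of 𝔤 from its image in the complexification, so ℓ ∘ R is a
  -- smooth left inverse with values in the model space of G.
  let ℓ : (Fin d → ℂ) →L[ℝ] E := LinearMap.toContinuousLinearMap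
    ((lieModel E G).toLinearMap ∘ₗ tensorRe _ ∘ₗ Θ.symm.toLinearMap.restrictScalars ℝ)
  have hRj : ∀ X : E, R (Φ (j X)) = j X := fun X => by
    have h := hRΦ ((lieModel E G).symm X)
    rwa [← hjΘ, LinearEquiv.apply_symm_apply] at h
  have hℓ : ∀ X : E, ℓ (j X) = X := fun X => by
    have h : tensorRe _ (Θ.symm (Θ (1 ⊗ₜ (lieModel E G).symm X))) = (lieModel E G).symm X := by
      rw [Θ.symm_apply_apply, tensorRe_tmul, Complex.one_re, one_smul]
    rw [← hjΘ, LinearEquiv.apply_symm_apply] at h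
    exact (congrArg (lieModel E G) h).trans (LinearEquiv.apply_symm_apply _ X)
  let H : Subgroup (NilGroup γ) := NilGroup.expSubgroup _ hB
  let Ψ : NilGroup γ → (Fin n → ℂ) × (Fin k → ℂ) := fun x => Φ (NilGroup.log γ x)
  refine ⟨fun g => Φ (j (hβ.modelLog g)), p, q, H, Ψ, ?_, fun x y t => ?_, ?_, fun g g' => ?_, ?_, fun v => ?_,
    ?_, ?_, fun g => rfl⟩
  · refine hβ.isCREmbedding S hΦ (B := S.sub01.map Θ.toLinearMap) (fun g y hy => ?_) j hj
      (fun X => ⟨_, ⟨X, rfl⟩, ?_⟩) (R := fun w => ℓ (R w)) (ℓ.contDiff.comp hR) fun X => ?_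
    · rw [eq_comm, hΦB, NilBracket.bch_neg_bch]
      exact hy
    · rw [hjΘ, hjΘ, ← map_smul, ← map_add, TensorProduct.smul_tmul', smul_eq_mul, mul_one]
      rfl
    · rw [hRj, hℓ]
  · beta_reduce
    rw [hβ.modelLog_lieExp, hjΘ]
    exact hpq x y t
  · refine Set.ext fun x => ?_
    constructor
    · rintro ⟨u, hu, hux⟩
      exact ⟨u, hu, (hexp u).trans (congrArg (NilGroup.of γ) hux)⟩
    · rintro ⟨u, hu, rfl⟩
      exact ⟨u, hu, congrArg (NilGroup.log γ) (hexp u).symm⟩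
  · exact (hΦB _ _).trans (QuotientGroup.eq (s := H)
      (a := (g : NilGroup γ)) (b := (g' : NilGroup γ))).symm
  · have h : S.m = Set.range b.complexVec := by
      rw [← S.coe_sub10_sup_subN, ← b.range_complexVecLin]
      rfl
    rw [h, ← Set.range_comp]
    rfl
  · exact (congrArg Ψ (hexp _)).trans (hΦv v)
  · have h1 : MDifferentiable 𝓘(ℂ, Fin d → ℂ) 𝓘(ℂ, (Fin n → ℂ) × (Fin k → ℂ)) Φ :=
      (hΦ.differentiable (by simp)).mdifferentiable
    exact h1
  · have h : (fun v => (hβ.complexification Θ j hjΘ hj).exp (b.complexVec v)) =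
        fun v => NilGroup.of γ (Θ (b.complexVec v)) := funext fun v => hexp _
    rw [h]
    have h1 : MDifferentiable 𝓘(ℂ, (Fin n → ℂ) × (Fin k → ℂ)) 𝓘(ℂ, Fin d → ℂ)
        (LinearMap.toContinuousLinearMap (Θ.toLinearMap ∘ₗ b.complexVecLin)) :=
      ContinuousLinearMap.mdifferentiable _
    exact h1
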